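/- **Definitions.** A *double category* $\mathcal C$ here has objects, a category $\mathcal C_v$ of vertical morphisms and a category $\mathcal C_h$ of horizontal morphisms on these objects, and a class of commutative squares (with two horizontal and two vertical sides) which contains the identity squares, is closed under horizontal and vertical pasting, and under inverting a pair of parallel invertible sides. A *polytope complex* is a double category $\mathcal C$ with a Grothendieck topology on $\mathcal C_v$ such that: * (V) $\mathcal C_v$ is a preorder with a unique initial object $\varnothing$ and has pullbacks; * (H) $\mathcal C_h$ is a groupoid; * (P) every horizontal $\Sigma\colon A\to B$ induces by pullback an equivalence $\Sigma^*\colon(\mathcal C_v\downarrow B)\to(\mathcal C_v\downarrow A)$, and for every vertical $B'\to B$ there is a unique horizontal $\Sigma^*B'\to B'$ forming a commutative square with $\Sigma$; this square is a pullback square, i.e. every commutative square over $\Sigma$ with right side $B_1\to B'\to B$ factors vertically through it; * (C) if $\{X_\alpha\to X\}$ is a covering family and $\Sigma\colon Y\to X$ is horizontal, then $\{\Sigma^*X_\alpha\to Y\}$ is a covering family; * (B) if $\{X_\alpha\to X\}$ is a family for which there are covering families $\{X_{\alpha\beta}\to X_\alpha\}_\beta$ such that $\{X_{\alpha\beta}\to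 X\}_{\alpha,\beta}$ is a covering family, then $\{X_\alpha\to X\}$ is a covering family. For a polytope complex $\mathcal C$, the category $\mathrm{SC}(\mathcal C)$ has as objects the finite families $\{a_i\}_{i\in I}$ of noninitial objects of $\mathcal C$. A vertical (horizontal) morphism of families $\{a_i\}_{i\in I}\to\{b_j\}_{j\in J}$ is a map $f\colon I\to J$ with vertical (horizontal) morphisms $a_i\to b_{f(i)}$. A vertical morphism is a *sub-map* if $a_i\times_{b_j}a_{i'}=\varnothing$ for all $j$ and all distinct $i,i'\in f^{-1}(j)$, and a *covering sub-map* if moreover $\{a_i\to b_j\}_{i\in f^{-1}(j)}$ is a covering family for every $j$. A morphism $A\to B$ of $\mathrm{SC}(\mathcal C)$ is a diagram $A\xleftarrow{p}A'\xrightarrow{\sigma}B$ with $p$ a sub-map and $\sigma$ horizontal, up to vertical isomorphism of $A'$ compatible with $p$ and $\sigma$; diagrams are composed by pulling back the second sub-map along the first horizontal morphism. It is a *cofibration* (*weak equivalence*) if $p$ is a covering sub-map and the set map of $\sigma$ is injective (bijective). For a Waldhausen category $\mathcal E$, $K_0\mathcal E$ is the abelian group generated by the classes $[A]$ of objects of $\mathcal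 E$ with relations $[A]=[B]$ for weak equivalences $A\to B$ and $[B]=[A]+[B/A]$ for cofibrations $A\to B$ with cofiber $B/A$. **Theorem.** Let $X$ be $E^n$, $S^n$ or $H^n$ with $n\ge 0$, and let $G$ be a subgroup of the group of isometries of $X$. A simplex of $X$ is the convex hull of $n+1$ points of $X$ in general position (contained in an open hemisphere if $X=S^n$), and a polytope of $X$ is a nonempty finite union of simplices. Let $\mathcal C$ be the double category whose objects are the polytopes of $X$ and the empty set, whose vertical morphisms are the inclusions, whose horizontal morphisms $P\to Q$ are the elements $g\in G$ with $g\cdot P=Q$, and in which a square commutes if its two horizontal sides are given by the same element of $G$. Then: 1. there is a Grothendieck topology on $\mathcal C_v$ for which a family $\{P_\alpha\to P\}_{\alpha\in A}$ is a covering family if and only if $\bigcup_{\alpha\in A_0}P_\alpha=P$ for some finite $A_0\subseteq A$, and with it $\mathcal C$ is a polytope complex; 2. $\mathrm{SC}(X):=\mathrm{SC}(\mathcal C)$, with its cofibrations and weak equivalences, is a Waldhausen category; 3. there is an isomorphism $K_0\,\mathrm{SC}(X)\cong\mathcal P(X,G)$ which takes the class of the one-member family $\{P\}$ to $[P]$ for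 every polytope $P$. Here $\mathcal P(X,G)$ is the free abelian group generated by the polytopes of $X$ modulo the relations $[P]=[g\cdot P]$ for polytopes $P$ and $g\in G$, and $[P\cup P']=[P]+[P']$ for polytopes $P,P'$ such that $P\cap P'$ has measure $0$. -/

import Mathlib

open CategoryTheory CategoryTheory.Limits

namespace ScissorsCongruence

universe v w u

/-! ### Double categories and polytope complexes -/

/-- A double category whose squares are a property ("commutative squares").  The given category
structure on `C` is the vertical one; `HHom` is the set of horizontal morphisms.  `Sq σ p q τ` says
that the square with top `σ`, left side `p`, right side `q` and bottom `τ` commutes.  Commutative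
squares contain the identities, are closed under pasting in both directions, and may be inverted
when two parallel sides are invertible, as in any ordinary category. -/
class DoubleCategory (C : Type u) [Category.{v} C] where
  HHom : C → C → Type w
  hid (A : C) : HHom A A
  hcomp {A B D : C} : HHom A B → HHom B D → HHom A D
  hid_hcomp {A B : C} (σ : HHom A B) : hcomp (hid A) σ = σ
  hcomp_hid {A B : C} (σ : HHom A B) : hcomp σ (hid B) = σ
  hcomp_assoc {A B D E : C} (σ : HHom A B) (τ : HHom B D) (ρ : HHom D E) :
    hcomp (hcomp σ τ) ρ = hcomp σ (hcomp τ ρ)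
  Sq {A B A' B' : C} (σ : HHom A B) (p : A ⟶ A') (q : B ⟶ B') (τ : HHom A' B') : Prop
  sq_vid {A B : C} (σ : HHom A B) : Sq σ (𝟙 A) (𝟙 B) σ
  sq_hid {A A' : C} (p : A ⟶ A') : Sq (hid A) p p (hid A')
  sq_hcomp {A B D A' B' D' : C} {σ : HHom A B} {σ' : HHom B D} {p : A ⟶ A'} {q : B ⟶ B'}
    {r : D ⟶ D'} {τ : HHom A' B'} {τ' : HHom B' D'} :
    Sq σ p q τ → Sq σ' q r τ' → Sq (hcomp σ σ') p r (hcomp τ τ')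
  sq_vcomp {A B A' B' A'' B'' : C} {σ : HHom A B} {p : A ⟶ A'} {q : B ⟶ B'} {τ : HHom A' B'}
    {p' : A' ⟶ A''} {q' : B' ⟶ B''} {ρ : HHom A'' B''} :
    Sq σ p q τ → Sq τ p' q' ρ → Sq σ (p ≫ p') (q ≫ q') ρ
  sq_hinv {A B A' B' : C} {σ : HHom A B} {σ' : HHom B A} {p : A ⟶ A'} {q : B ⟶ B'}
    {τ : HHom A' B'} {τ' : HHom B' A'} :
    hcomp σ σ' = hid A → hcomp σ' σ = hid B → hcomp τ τ' = hid A' → hcomp τ' τ = hid B' →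
    Sq σ p q τ → Sq σ' q p τ'
  sq_vinv {A B A' B' : C} {σ : HHom A B} {p : A ⟶ A'} {q : B ⟶ B'} {τ : HHom A' B'}
    [IsIso p] [IsIso q] : Sq σ p q τ → Sq τ (inv p) (inv q) σ

open DoubleCategory

section

variable {C : Type u} [Category.{v} C] [DoubleCategory.{v, w} C]

/-- The square with top `τ : A' → B'`, left side `p`, right side `q` and bottom `σ` is a pullback
of `q` along `σ`: every commutative square over `σ` whose right side factors through `q`
factors (vertically) through it. -/
def IsPullbackSq {A B A' B' : C} (τ : HHom A' B') (p : A' ⟶ A) (q : B' ⟶ B)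
    (σ : HHom A B) : Prop :=
  Sq τ p q σ ∧
    ∀ {A₁ B₁ : C} (τ₁ : HHom A₁ B₁) (p₁ : A₁ ⟶ A) (s : B₁ ⟶ B'),
      Sq τ₁ p₁ (s ≫ q) σ → ∃ r : A₁ ⟶ A', r ≫ p = p₁ ∧ Sq τ₁ r s τ

/-- The family of vertical morphisms `f i : Y i ⟶ X` is a covering family. -/
def IsCovering (J : GrothendieckTopology C) {X : C} {ι : Type*} (Y : ι → C)
    (f : ∀ i, Y i ⟶ X) : Prop :=
  Sieve.ofArrows Y f ∈ J X

/-- The double category `C` with the Grothendieck topology `J` on its vertical category is a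
polytope complex. -/
structure IsPolytopeComplex (J : GrothendieckTopology C) : Prop where
  /-- (V) vertically `C` is a preorder -/
  thin : Quiver.IsThin C
  /-- (V) there is a unique vertically initial object -/
  unique_initial : ∃! X : C, Nonempty (IsInitial X)
  /-- (V) `C` is vertically closed under pullbacks -/
  hasPullbacks : HasPullbacks C
  /-- (H) horizontally `C` is a groupoid -/
  groupoid {A B : C} (σ : HHom A B) : ∃ τ : HHom B A, hcomp σ τ = hid A ∧ hcomp τ σ = hid B
  /-- (P) every horizontal `σ : A → B` induces, by pullback, an equivalence `σ^*` of slice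
  categories, and there is a unique horizontal morphism `σ^* B' → B'` over `σ` -/
  pull {A B : C} (σ : HHom A B) : ∃ Φ : Over B ≌ Over A, ∀ P : Over B,
    (∃! τ : HHom (Φ.functor.obj P).left P.left, Sq τ (Φ.functor.obj P).hom P.hom σ) ∧
    ∀ τ : HHom (Φ.functor.obj P).left P.left, Sq τ (Φ.functor.obj P).hom P.hom σ →
      IsPullbackSq τ (Φ.functor.obj P).hom P.hom σ
  /-- (C) pulling back along a horizontal morphism preserves covering families -/
  cover_pull {X Y : C} (σ : HHom Y X) {ι : Type u} (U : ι → C) (f : ∀ i, U i ⟶ X)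
    (V : ι → C) (g : ∀ i, V i ⟶ Y) (τ : ∀ i, HHom (V i) (U i))
    (h : ∀ i, IsPullbackSq (τ i) (g i) (f i) σ) :
    IsCovering J U f → IsCovering J V g
  /-- (B) a family which has a refinement that is a covering family is a covering family -/
  cover_of_refinement {X : C} {ι : Type u} (U : ι → C) (f : ∀ i, U i ⟶ X) (κ : ι → Type u)
    (V : ∀ i, κ i → C) (g : ∀ i (k : κ i), V i k ⟶ U i) (h : ∀ i, IsCovering J (V i) (g i)) :
    IsCovering J (fun x : Σ i, κ i => V x.1 x.2) (fun x => g x.1 x.2 ≫ f x.1) →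
      IsCovering J U f

/-- A polytope is a (vertically) noninitial object. -/
def IsPolytope (A : C) : Prop := IsEmpty (IsInitial A)

variable (C) in
/-- Objects of `Tw(C_p)`: finite families of polytopes of `C`. -/
structure Tw where
  ι : Type
  fin : Finite ι
  obj : ι → C
  poly : ∀ i, IsPolytope (obj i)

/-- Vertical morphisms of `Tw(C_p)`. -/
structure Tw.VHom (A B : Tw C) where
  map : A.ι → B.ι
  hom : ∀ i, A.obj i ⟶ B.obj (map i)

/-- Horizontal morphisms of `Tw(C_p)` (shuffles). -/
structure Tw.HHom (A B : Tw C) where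
  map : A.ι → B.ι
  hom : ∀ i, DoubleCategory.HHom (A.obj i) (B.obj (map i))

/-- The members of the family `A` lying over the `j`-th member of `B`, with their vertical
morphisms to it. -/
def Tw.VHom.fiberHom {A B : Tw C} (p : Tw.VHom A B) (j : B.ι) (i : {i : A.ι // p.map i = j}) :
    A.obj i.1 ⟶ B.obj j :=
  p.hom i.1 ≫ eqToHom (congrArg B.obj i.2)

/-- A sub-map: the pullback over `b_j` of two distinct members lying over `b_j` is initial. -/
def Tw.VHom.IsSubMap {A B : Tw C} (p : Tw.VHom A B) : Prop :=
  ∀ (j : B.ι) (i i' : {i : A.ι // p.map i = j}), i ≠ i' →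
    ∀ (Z : C) (f : Z ⟶ A.obj i.1) (g : Z ⟶ A.obj i'.1),
      IsPullback f g (p.fiberHom j i) (p.fiberHom j i') → Nonempty (IsInitial Z)

/-- For a sub-map `p`, being a covering sub-map: the members of `A` over `b_j` cover `b_j`. -/
def Tw.VHom.IsCover (J : GrothendieckTopology C) {A B : Tw C} (p : Tw.VHom A B) : Prop :=
  ∀ j : B.ι, IsCovering J (fun i : {i : A.ι // p.map i = j} => A.obj i.1) (p.fiberHom j)

/-- A diagram `A ← A' → B` consisting of a sub-map `A' → A` and a shuffle `A' → B`. -/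
structure Span (A B : Tw C) where
  apex : Tw C
  left : Tw.VHom apex A
  isSubMap : left.IsSubMap
  right : Tw.HHom apex B

/-- Two diagrams are equivalent if there is a vertical isomorphism of their apices which is
compatible with the sub-maps and with the shuffles. -/
def Span.Rel {A B : Tw C} (s t : Span A B) : Prop :=
  ∃ (e : s.apex.ι ≃ t.apex.ι) (ι : ∀ i, s.apex.obj i ≅ t.apex.obj (e i))
    (hl : ∀ i, s.left.map i = t.left.map (e i)) (hr : ∀ i, s.right.map i = t.right.map (e i)),
    (∀ i, s.left.hom i ≫ eqToHom (congrArg A.obj (hl i)) = (ι i).hom ≫ t.left.hom (e i)) ∧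
    ∀ i, Sq (s.right.hom i) (ι i).hom (eqToHom (congrArg B.obj (hr i))) (t.right.hom (e i))

end

/-! ### Pullbacks in a polytope complex -/

lemma isInitial_of_hom {C : Type u} [Category.{v} C] [Quiver.IsThin C] {Z P : C} (f : Z ⟶ P) (hP : IsInitial P) :
    Nonempty (IsInitial Z) :=
  ⟨hP.ofIso ⟨hP.to Z, f, Subsingleton.elim _ _, Subsingleton.elim _ _⟩⟩

lemma Tw.VHom.IsSubMap.disjoint {C : Type u} [Category.{v} C] [Quiver.IsThin C] [HasPullbacks C] {A B : Tw C} {p : Tw.VHom A B}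
    (hp : p.IsSubMap) {i i' : A.ι} (hne : i ≠ i') (hm : p.map i = p.map i') (Z : C)
    (f : Z ⟶ A.obj i) (g : Z ⟶ A.obj i') : Nonempty (IsInitial Z) := by
  obtain ⟨hP⟩ := hp (p.map i') ⟨i, hm⟩ ⟨i', rfl⟩ (fun e => hne (congrArg Subtype.val e)) _ _ _
    (IsPullback.of_hasPullback _ _)
  exact isInitial_of_hom (pullback.lift f g (Subsingleton.elim _ _)) hP

section

variable {C : Type u} [Category.{v} C] [DoubleCategory.{v, w} C]

lemma IsPullbackSq.comparison [Quiver.IsThin C] {A B A' B' A₂ B₂ A₂' B₂' : C}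
    {τ : HHom A' B'} {p : A' ⟶ A} {q : B' ⟶ B} {σ : HHom A B} (h : IsPullbackSq τ p q σ)
    {τ₂ : HHom A₂' B₂'} {p₂ : A₂' ⟶ A₂} {q₂ : B₂' ⟶ B₂} {σ₂ : HHom A₂ B₂}
    (h₂ : IsPullbackSq τ₂ p₂ q₂ σ₂) (a : A ⟶ A₂) (b : B ⟶ B₂) (b' : B' ⟶ B₂')
    [IsIso a] [IsIso b] [IsIso b'] (hs : Sq σ a b σ₂) :
    ∃ e : A' ≅ A₂', Sq τ e.hom b' τ₂ := by
  have h1 := sq_vcomp h.1 hs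
  rw [Subsingleton.elim (q ≫ b) (b' ≫ q₂)] at h1
  obtain ⟨r, -, hr⟩ := h₂.2 _ _ _ h1
  have h2 := sq_vcomp h₂.1 (sq_vinv hs)
  rw [Subsingleton.elim (q₂ ≫ inv b) (inv b' ≫ q)] at h2
  obtain ⟨r', -, -⟩ := h.2 _ _ _ h2
  exact ⟨⟨r, r', Subsingleton.elim _ _, Subsingleton.elim _ _⟩, hr⟩

lemma IsPullbackSq.iso [Quiver.IsThin C] {A B A' B' A₂' : C}
    {τ : HHom A' B'} {p : A' ⟶ A} {q : B' ⟶ B} {σ : HHom A B} (h : IsPullbackSq τ p q σ)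
    {τ₂ : HHom A₂' B'} {p₂ : A₂' ⟶ A} {q₂ : B' ⟶ B} (h₂ : IsPullbackSq τ₂ p₂ q₂ σ) :
    ∃ e : A' ≅ A₂', Sq τ e.hom (𝟙 B') τ₂ :=
  h.comparison h₂ (𝟙 _) (𝟙 _) (𝟙 _) (sq_vid _)

lemma IsPullbackSq.cancel [Quiver.IsThin C] {A B A' B' A'' B'' : C}
    {τ : HHom A' B'} {p : A' ⟶ A} {q : B' ⟶ B} {σ : HHom A B} (h : IsPullbackSq τ p q σ)
    {τ' : HHom A'' B''} {p' : A'' ⟶ A} {q'' : B'' ⟶ B} (h' : IsPullbackSq τ' p' q'' σ)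
    (q' : B'' ⟶ B') : ∃ r : A'' ⟶ A', IsPullbackSq τ' r q' τ := by
  obtain rfl : q' ≫ q = q'' := Subsingleton.elim _ _
  obtain ⟨r, -, hr⟩ := h.2 _ _ _ h'.1
  refine ⟨r, hr, fun τ₁ p₁ s hs => ?_⟩
  have h1 := sq_vcomp hs h.1
  rw [Category.assoc] at h1
  obtain ⟨r₁, -, hr₁⟩ := h'.2 _ _ _ h1
  exact ⟨r₁, Subsingleton.elim _ _, hr₁⟩

namespace IsPolytopeComplex

variable {J : GrothendieckTopology C} (h : IsPolytopeComplex J)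

/-- The chosen pullback `σ^* B'` of a vertical `q : B' ⟶ B` along a horizontal `σ : A → B`. -/
noncomputable def pb {A B B' : C} (σ : HHom A B) (q : B' ⟶ B) : C :=
  ((h.pull σ).choose.functor.obj (Over.mk q)).left

/-- The vertical morphism `σ^* B' ⟶ A`. -/
noncomputable def pbV {A B B' : C} (σ : HHom A B) (q : B' ⟶ B) : h.pb σ q ⟶ A :=
  ((h.pull σ).choose.functor.obj (Over.mk q)).hom

/-- The horizontal morphism `σ^* B' → B'`. -/
noncomputable def pbH {A B B' : C} (σ : HHom A B) (q : B' ⟶ B) : HHom (h.pb σ q) B' :=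
  ((h.pull σ).choose_spec (Over.mk q)).1.choose

lemma pb_isPullbackSq {A B B' : C} (σ : HHom A B) (q : B' ⟶ B) :
    IsPullbackSq (h.pbH σ q) (h.pbV σ q) q σ :=
  ((h.pull σ).choose_spec (Over.mk q)).2 _ ((h.pull σ).choose_spec (Over.mk q)).1.choose_spec.1

lemma hpaste {J : GrothendieckTopology C} (h : IsPolytopeComplex J) {A B D A' B' D' : C} {σ : HHom A B} {σ' : HHom B D} {p : A' ⟶ A} {q : B' ⟶ B}
    {r : D' ⟶ D} {τ : HHom A' B'} {τ' : HHom B' D'} (h₁ : IsPullbackSq τ p q σ)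
    (h₂ : IsPullbackSq τ' q r σ') : IsPullbackSq (hcomp τ τ') p r (hcomp σ σ') := by
  refine ⟨sq_hcomp h₁.1 h₂.1, fun {A₁ D₁} ρ p₁ s hs => ?_⟩
  have hβ := (h.pb_isPullbackSq τ' s).1
  obtain ⟨β', e1, e2⟩ := h.groupoid (h.pbH τ' s)
  obtain ⟨σ'', e3, e4⟩ := h.groupoid σ'
  have h3 := sq_hcomp hs (sq_hinv e1 e2 e3 e4 (sq_vcomp hβ h₂.1))
  rw [hcomp_assoc, e3, hcomp_hid] at h3
  obtain ⟨r', hr, h4⟩ := h₁.2 _ _ _ h3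
  have h5 := sq_hcomp h4 hβ
  rw [hcomp_assoc, e2, hcomp_hid] at h5
  exact ⟨r', hr, h5⟩

lemma id_isPullbackSq {J : GrothendieckTopology C} (h : IsPolytopeComplex J) {B B' : C}
    (q : B' ⟶ B) : IsPullbackSq (hid B') q q (hid B) := by
  have := h.thin
  let Φ := (h.pull (hid B)).choose
  let P := Φ.inverse.obj (Over.mk q)
  let i : (Φ.functor.obj P).left ⟶ B' := (Φ.counitIso.app (Over.mk q)).hom.left
  let i' : B' ⟶ (Φ.functor.obj P).left := (Φ.counitIso.app (Over.mk q)).inv.left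
  obtain ⟨⟨ω, hω, -⟩, hω'⟩ := (h.pull (hid B)).choose_spec P
  have h1 := hω' ω hω
  have h2 := h.pb_isPullbackSq (hid B) (Φ.functor.obj P).hom
  have h3 := h.hpaste h2 h1
  rw [hid_hcomp] at h3
  obtain ⟨e, he⟩ := h3.iso h1
  obtain ⟨ω', e1, e2⟩ := h.groupoid ω
  have h4 := sq_hcomp he (sq_vid ω')
  rw [hcomp_assoc, e1, hcomp_hid] at h4
  refine ⟨sq_hid q, fun τ₁ p₁ s hs => ?_⟩
  rw [Subsingleton.elim (s ≫ q) ((s ≫ i') ≫ (Φ.functor.obj P).hom)] at hs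
  obtain ⟨r, -, hr⟩ := h2.2 _ _ _ hs
  have h5 := sq_vcomp (sq_vcomp hr h4) (sq_hid i)
  rw [Subsingleton.elim (((s ≫ i') ≫ 𝟙 _) ≫ i) s] at h5
  exact ⟨_, Subsingleton.elim _ _, h5⟩

lemma pb_isPolytope {A B B' : C} (σ : HHom A B) (q : B' ⟶ B) (hB : IsPolytope B') :
    IsPolytope (h.pb σ q) := by
  have := h.thin
  refine ⟨fun hi => ?_⟩
  obtain ⟨O, ⟨hO⟩, -⟩ := h.unique_initial
  let Φ := (h.pull σ).choose
  let f : Φ.functor.obj (Over.mk q) ⟶ Φ.functor.obj (Over.mk (hO.to B)) :=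
    Over.homMk (hi.to _) (Subsingleton.elim _ _)
  obtain ⟨hB'⟩ := isInitial_of_hom (Φ.functor.preimage f).left hO
  exact hB.false hB'

lemma pb_disjoint {A B B' B'' : C} (σ : HHom A B) (q : B' ⟶ B) (q' : B'' ⟶ B)
    (hd : ∀ Z : C, (Z ⟶ B') → (Z ⟶ B'') → Nonempty (IsInitial Z)) (Z : C)
    (f : Z ⟶ h.pb σ q) (f' : Z ⟶ h.pb σ q') : Nonempty (IsInitial Z) := by
  have := h.thin
  obtain ⟨O, ⟨hO⟩, -⟩ := h.unique_initial
  let Φ := (h.pull σ).choose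
  let Z₀ : Over A := Over.mk (f ≫ h.pbV σ q)
  let g : Z₀ ⟶ Φ.functor.obj (Over.mk q) := Over.homMk f rfl
  let g' : Z₀ ⟶ Φ.functor.obj (Over.mk q') := Over.homMk f' (Subsingleton.elim _ _)
  let W := Φ.inverse.obj Z₀
  let k : W ⟶ Over.mk q := Φ.functor.preimage ((Φ.counitIso.app Z₀).hom ≫ g)
  let k' : W ⟶ Over.mk q' := Φ.functor.preimage ((Φ.counitIso.app Z₀).hom ≫ g')
  obtain ⟨hW⟩ := hd W.left k.left k'.left
  let O₀ : Over A := Over.mk (hO.to A)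
  let m : W ⟶ Φ.inverse.obj O₀ := Over.homMk (hW.to _) (hW.hom_ext _ _)
  exact isInitial_of_hom (Φ.inverse.preimage m).left hO

end IsPolytopeComplex

/-! ### The category `SC(C)` -/

/-- The identity diagram. -/
def Span.id [Quiver.IsThin C] (A : Tw C) : Span A A where
  apex := A
  left := ⟨fun i => i, fun _ => 𝟙 _⟩
  isSubMap := fun _ i i' hne => (hne (Subtype.ext (i.2.trans i'.2.symm))).elim
  right := ⟨fun i => i, fun _ => hid _⟩

namespace IsPolytopeComplex

variable {J : GrothendieckTopology C} (h : IsPolytopeComplex J)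

/-- The index set of the apex of a composite. -/
abbrev compIdx {A B D : Tw C} (s : Span A B) (t : Span B D) : Type :=
  {x : s.apex.ι × t.apex.ι // t.left.map x.2 = s.right.map x.1}

/-- The vertical morphism to be pulled back. -/
abbrev compV {A B D : Tw C} (s : Span A B) (t : Span B D) (x : compIdx s t) :
    t.apex.obj x.1.2 ⟶ B.obj (s.right.map x.1.1) :=
  t.left.hom x.1.2 ≫ eqToHom (congrArg B.obj x.2)

/-- Composition of diagrams: the sub-map `p ∘ σ^* q` and the shuffle `τ ∘ σ̃`. -/
noncomputable def compSpan {A B D : Tw C} (s : Span A B) (t : Span B D) : Span A D where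
  apex :=
    { ι := compIdx s t
      fin := by
        have := s.apex.fin
        have := t.apex.fin
        infer_instance
      obj := fun x => h.pb (s.right.hom x.1.1) (compV s t x)
      poly := fun x => h.pb_isPolytope _ _ (t.apex.poly _) }
  left :=
    { map := fun x => s.left.map x.1.1
      hom := fun x => h.pbV (s.right.hom x.1.1) (compV s t x) ≫ s.left.hom x.1.1 }
  isSubMap := by
    have := h.thin
    have := h.hasPullbacks
    rintro j ⟨⟨⟨i, k⟩, hx⟩, hj⟩ ⟨⟨⟨i', k'⟩, hx'⟩, hj'⟩ hne Z f g -
    by_cases hi : i = i'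
    · subst hi
      have hk : k ≠ k' := by
        rintro rfl
        exact hne rfl
      exact h.pb_disjoint _ _ _
        (fun Z f g => t.isSubMap.disjoint hk (Eq.trans hx (Eq.symm hx')) Z f g) Z f g
    · exact s.isSubMap.disjoint hi (Eq.trans hj (Eq.symm hj')) Z (f ≫ h.pbV _ _) (g ≫ h.pbV _ _)
  right :=
    { map := fun x => t.right.map x.1.2
      hom := fun x => hcomp (h.pbH (s.right.hom x.1.1) (compV s t x)) (t.right.hom x.1.2) }

lemma rel_equivalence {J : GrothendieckTopology C} (h : IsPolytopeComplex J) (A B : Tw C) : Equivalence (Span.Rel (A := A) (B := B)) := by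
  have := h.thin
  refine ⟨fun s => ⟨Equiv.refl _, fun i => Iso.refl _, fun i => rfl, fun i => rfl,
    fun i => Subsingleton.elim _ _, fun i => sq_vid _⟩, ?_, ?_⟩
  · rintro s t ⟨e, ι, hl, hr, -, hs⟩
    refine ⟨e.symm, fun i => eqToIso (by simp) ≪≫ (ι (e.symm i)).symm, fun i => by simp [hl],
      fun i => by simp [hr], fun i => Subsingleton.elim _ _, fun i => ?_⟩
    obtain ⟨i, rfl⟩ := e.surjective i
    have key : ∀ (k : s.apex.ι) (hk : k = i) (a : t.apex.obj (e i) ⟶ s.apex.obj k)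
        (b : B.obj (t.right.map (e i)) ⟶ B.obj (s.right.map k)),
        Sq (t.right.hom (e i)) a b (s.right.hom k) := by
      rintro k rfl a b
      rw [Subsingleton.elim a (inv (ι k).hom),
        Subsingleton.elim b (inv (eqToHom (congrArg B.obj (hr k))))]
      exact sq_vinv (hs k)
    exact key _ (by simp) _ _
  · rintro s t r ⟨e, ι, hl, hr, -, hs⟩ ⟨e', ι', hl', hr', -, hs'⟩
    refine ⟨e.trans e', fun i => ι i ≪≫ ι' (e i), fun i => (hl i).trans (hl' (e i)),
      fun i => (hr i).trans (hr' (e i)), fun i => Subsingleton.elim _ _, fun i => ?_⟩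
    have := sq_vcomp (hs i) (hs' (e i))
    rw [eqToHom_trans] at this
    exact this

lemma compSpan_rel {A B D : Tw C} {s s' : Span A B} {t t' : Span B D} (hs : s.Rel s')
    (ht : t.Rel t') : (h.compSpan s t).Rel (h.compSpan s' t') := by
  have := h.thin
  obtain ⟨e, ι, hl, hr, -, hsq⟩ := hs
  obtain ⟨e', ι', hl', hr', -, hsq'⟩ := ht
  have hE : ∀ x : s.apex.ι × t.apex.ι, t.left.map x.2 = s.right.map x.1 ↔
      t'.left.map (e.prodCongr e' x).2 = s'.right.map (e.prodCongr e' x).1 := by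
    rintro ⟨i, k⟩
    simp [hr, hl']
  let E : compIdx s t ≃ compIdx s' t' := (e.prodCongr e').subtypeEquiv hE
  have key : ∀ x : compIdx s t, ∃ a : h.pb (s.right.hom x.1.1) (compV s t x) ≅
      h.pb (s'.right.hom (E x).1.1) (compV s' t' (E x)),
      Sq (h.pbH (s.right.hom x.1.1) (compV s t x)) a.hom (ι' x.1.2).hom
        (h.pbH (s'.right.hom (E x).1.1) (compV s' t' (E x))) := fun x =>
    (h.pb_isPullbackSq _ _).comparison (h.pb_isPullbackSq _ _) (ι x.1.1).hom
      (eqToHom (congrArg B.obj (hr x.1.1))) (ι' x.1.2).hom (hsq x.1.1)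
  choose a ha using key
  exact ⟨E, a, fun x => hl x.1.1, fun x => hr' x.1.2, fun x => Subsingleton.elim _ _,
    fun x => sq_hcomp (ha x) (hsq' x.1.2)⟩

/-- The setoid of diagrams `A ← A' → B`. -/
def spanSetoid (A B : Tw C) : Setoid (Span A B) := ⟨Span.Rel, h.rel_equivalence A B⟩

end IsPolytopeComplex

/-- The objects of the category `SC(C)`: finite families of polytopes of `C`. -/
structure SC {J : GrothendieckTopology C} (h : IsPolytopeComplex J) where
  tw : Tw C

namespace SC

variable {J : GrothendieckTopology C} {h : IsPolytopeComplex J}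

/-- A morphism of `SC(C)` is an equivalence class of diagrams `A ← A' → B`. -/
def Hom (A B : SC h) : Type (max 1 u v w) := Quotient (h.spanSetoid A.tw B.tw)

/-- The morphism represented by a diagram. -/
def Hom.mk {A B : SC h} (s : Span A.tw B.tw) : Hom A B := Quotient.mk _ s

lemma id_comp_rel {A B : Tw C} [Quiver.IsThin C] (s : Span A B) :
    (h.compSpan (Span.id A) s).Rel s := by
  let E : IsPolytopeComplex.compIdx (Span.id A) s ≃ s.apex.ι :=
    { toFun := fun x => x.1.2
      invFun := fun k => ⟨(s.left.map k, k), rfl⟩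
      left_inv := by
        rintro ⟨⟨i, k⟩, hx⟩
        have hx' : s.left.map k = i := hx
        subst hx'
        rfl
      right_inv := fun k => rfl }
  have key : ∀ x : IsPolytopeComplex.compIdx (Span.id A) s,
      ∃ a : h.pb (hid (A.obj x.1.1)) (IsPolytopeComplex.compV (Span.id A) s x) ≅
        s.apex.obj x.1.2,
      Sq (h.pbH (hid (A.obj x.1.1)) (IsPolytopeComplex.compV (Span.id A) s x)) a.hom
        (𝟙 _) (hid (s.apex.obj x.1.2)) := by
    exact fun x => (h.pb_isPullbackSq _ _).iso
      (h.id_isPullbackSq (IsPolytopeComplex.compV (Span.id A) s x))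
  choose a ha using key
  refine ⟨E, a, fun x => x.2.symm, fun x => rfl, fun x => Subsingleton.elim _ _, fun x => ?_⟩
  have := sq_hcomp (ha x) (sq_vid (s.right.hom x.1.2))
  rw [hid_hcomp] at this
  exact this

lemma comp_id_rel {A B : Tw C} [Quiver.IsThin C] (s : Span A B) :
    (h.compSpan s (Span.id B)).Rel s := by
  let E : IsPolytopeComplex.compIdx s (Span.id B) ≃ s.apex.ι :=
    { toFun := fun x => x.1.1
      invFun := fun k => ⟨(k, s.right.map k), rfl⟩
      left_inv := by
        rintro ⟨⟨i, k⟩, hx⟩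
        have hx' : k = s.right.map i := hx
        subst hx'
        rfl
      right_inv := fun k => rfl }
  have key : ∀ x : IsPolytopeComplex.compIdx s (Span.id B),
      ∃ a : h.pb (s.right.hom x.1.1) (IsPolytopeComplex.compV s (Span.id B) x) ≅
        s.apex.obj x.1.1,
      Sq (h.pbH (s.right.hom x.1.1) (IsPolytopeComplex.compV s (Span.id B) x)) a.hom
        (eqToHom (congrArg B.obj x.2)) (s.right.hom x.1.1) := fun x =>
    (h.pb_isPullbackSq _ _).comparison
      ⟨sq_vid (s.right.hom x.1.1), fun τ₁ p₁ t ht =>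
        ⟨p₁, Subsingleton.elim _ _, by rwa [Category.comp_id] at ht⟩⟩
      (𝟙 _) (𝟙 _) (eqToHom (congrArg B.obj x.2)) (sq_vid _)
  choose a ha using key
  refine ⟨E, a, fun x => rfl, fun x => x.2, fun x => Subsingleton.elim _ _, fun x => ?_⟩
  have h1 : hcomp (h.pbH (s.right.hom x.1.1) (IsPolytopeComplex.compV s (Span.id B) x))
      (hid (B.obj x.1.2)) = _ := hcomp_hid _
  have h2 := ha x
  rw [← h1] at h2
  exact h2

lemma sq_hcomp_assoc {A A' B D E : C} {τ : HHom A D} {p : A ⟶ A'} {τ₁ : HHom A' B}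
    {τ₂ : HHom B D} (hs : Sq τ p (𝟙 D) (hcomp τ₁ τ₂)) (ρ : HHom D E) :
    Sq (hcomp τ ρ) p (𝟙 E) (hcomp τ₁ (hcomp τ₂ ρ)) := by
  rw [← hcomp_assoc]
  exact sq_hcomp hs (sq_vid ρ)

lemma assoc_rel {A B D E : Tw C} [Quiver.IsThin C] (s : Span A B) (t : Span B D) (r : Span D E) :
    (h.compSpan (h.compSpan s t) r).Rel (h.compSpan s (h.compSpan t r)) := by
  let F : IsPolytopeComplex.compIdx (h.compSpan s t) r ≃
      IsPolytopeComplex.compIdx s (h.compSpan t r) :=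
    { toFun := fun x => ⟨(x.1.1.1.1, ⟨(x.1.1.1.2, x.1.2), x.2⟩), x.1.1.2⟩
      invFun := fun y => ⟨(⟨(y.1.1, y.1.2.1.1), y.2⟩, y.1.2.1.2), y.1.2.2⟩
      left_inv := fun x => rfl
      right_inv := fun y => rfl }
  have key : ∀ x : IsPolytopeComplex.compIdx (h.compSpan s t) r,
      ∃ a : (h.compSpan (h.compSpan s t) r).apex.obj x ≅
          (h.compSpan s (h.compSpan t r)).apex.obj (F x),
        Sq (h.pbH ((h.compSpan s t).right.hom x.1.1) (IsPolytopeComplex.compV (h.compSpan s t) r x))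
          a.hom (𝟙 _)
          (hcomp (h.pbH (s.right.hom (F x).1.1)
              (IsPolytopeComplex.compV s (h.compSpan t r) (F x)))
            (h.pbH (t.right.hom (F x).1.2.1.1)
              (IsPolytopeComplex.compV t r (F x).1.2))) := by
    intro x
    have h1 := h.pb_isPullbackSq ((h.compSpan s t).right.hom x.1.1)
      (IsPolytopeComplex.compV (h.compSpan s t) r x)
    have h2 := h.pb_isPullbackSq (s.right.hom (F x).1.1)
      (IsPolytopeComplex.compV s (h.compSpan t r) (F x))
    have h3 := h.pb_isPullbackSq (t.right.hom (F x).1.2.1.1)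
      (IsPolytopeComplex.compV t r (F x).1.2)
    have h4 := h.pb_isPullbackSq (s.right.hom x.1.1.1.1) (IsPolytopeComplex.compV s t x.1.1)
    obtain ⟨q, h5⟩ := h4.cancel h2
      (h.pbV (t.right.hom (F x).1.2.1.1) (IsPolytopeComplex.compV t r (F x).1.2))
    exact h1.iso (h.hpaste h5 h3)
  choose a ha using key
  refine ⟨F, a, fun x => rfl, fun x => rfl, fun x => Subsingleton.elim _ _, fun x => ?_⟩
  exact sq_hcomp_assoc (ha x) (r.right.hom x.1.2)

/-- `SC(C)` is a category; composition is induced by composition of diagrams. -/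
noncomputable instance : Category.{max 1 u v w} (SC h) where
  Hom A B := Hom A B
  id A := have := h.thin; Hom.mk (Span.id A.tw)
  comp f g := Quotient.map₂ h.compSpan (fun _ _ hs _ _ ht => h.compSpan_rel hs ht) f g
  id_comp f := by
    have := h.thin
    induction f using Quotient.inductionOn with
    | h s => exact Quotient.sound (id_comp_rel s)
  comp_id f := by
    have := h.thin
    induction f using Quotient.inductionOn with
    | h s => exact Quotient.sound (comp_id_rel s)
  assoc f g k := by
    have := h.thin
    induction f using Quotient.inductionOn with
    | h s =>
      induction g using Quotient.inductionOn with
      | h t =>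
        induction k using Quotient.inductionOn with
        | h r => exact Quotient.sound (assoc_rel s t r)

variable (h)

/-- Cofibrations of `SC(C)`: represented by a covering sub-map and a shuffle with injective set
map. -/
def cofibrations : MorphismProperty (SC h) := fun A B f =>
  ∃ s : Span A.tw B.tw, Hom.mk s = f ∧ s.left.IsCover J ∧ Function.Injective s.right.map

/-- Weak equivalences of `SC(C)`: represented by a covering sub-map and a shuffle with bijective
set map. -/
def weakEquivalences : MorphismProperty (SC h) := fun A B f =>
  ∃ s : Span A.tw B.tw, Hom.mk s = f ∧ s.left.IsCover J ∧ Function.Bijective s.right.map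

/-- The object of `SC(C)` given by a single polytope. -/
def single (a : C) (ha : IsPolytope a) : SC h := ⟨⟨Unit, inferInstance, fun _ => a, fun _ => ha⟩⟩

end SC

end

/-! ### Waldhausen categories and `K_0` -/

section

variable {E : Type u} [Category.{v} E]

/-- `E`, with the cofibrations `cof` and the weak equivalences `we`, is a Waldhausen category. -/
structure IsWaldhausen (cof we : MorphismProperty E) : Prop where
  hasZero : HasZeroObject E
  cof_of_iso {A B : E} (f : A ⟶ B) [IsIso f] : cof f
  cof_comp {A B D : E} (f : A ⟶ B) (g : B ⟶ D) : cof f → cof g → cof (f ≫ g)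
  cof_of_zero {Z A : E} (f : Z ⟶ A) : IsZero Z → cof f
  hasPushout {A B D : E} (f : A ⟶ B) (g : A ⟶ D) : cof f → HasPushout f g
  cof_pushout {A B D Q : E} {f : A ⟶ B} {g : A ⟶ D} {i : B ⟶ Q} {j : D ⟶ Q} :
    IsPushout f g i j → cof f → cof j
  we_of_iso {A B : E} (f : A ⟶ B) [IsIso f] : we f
  we_comp {A B D : E} (f : A ⟶ B) (g : B ⟶ D) : we f → we g → we (f ≫ g)
  gluing {A B D Q A' B' D' Q' : E} {f : A ⟶ B} {g : A ⟶ D} {i : B ⟶ Q} {j : D ⟶ Q}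
    {f' : A' ⟶ B'} {g' : A' ⟶ D'} {i' : B' ⟶ Q'} {j' : D' ⟶ Q'}
    (a : A ⟶ A') (b : B ⟶ B') (d : D ⟶ D') (q : Q ⟶ Q') :
    IsPushout f g i j → IsPushout f' g' i' j' → cof f → cof f' → we a → we b → we d →
    f ≫ b = a ≫ f' → g ≫ d = a ≫ g' → i ≫ q = b ≫ i' → j ≫ q = d ≫ j' → we q

/-- The defining relations of `K_0`: `[A] = [B]` for a weak equivalence `A → B`, and
`[B] = [A] + [B/A]` for a cofibration `A → B` with cofiber `B/A` (its pushout along `A → 0`). -/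
def K0Relations (cof we : MorphismProperty E) : Set (FreeAbelianGroup E) :=
  {x | ∃ (A B : E) (f : A ⟶ B), we f ∧ x = FreeAbelianGroup.of A - FreeAbelianGroup.of B} ∪
  {x | ∃ (A B Q Z : E) (f : A ⟶ B) (z : A ⟶ Z) (g : B ⟶ Q) (y : Z ⟶ Q),
    cof f ∧ IsZero Z ∧ IsPushout f z g y ∧
      x = FreeAbelianGroup.of B - (FreeAbelianGroup.of A + FreeAbelianGroup.of Q)}

/-- `K_0` of a Waldhausen category. -/
abbrev K0 (cof we : MorphismProperty E) : Type u :=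
  FreeAbelianGroup E ⧸ AddSubgroup.closure (K0Relations cof we)

/-- The class of an object in `K_0`. -/
def K0.of (cof we : MorphismProperty E) (A : E) : K0 cof we :=
  QuotientAddGroup.mk (FreeAbelianGroup.of A)

end

/-! ### The three geometries -/

/-- Lorentz form `x₀ y₀ - ⟨x', y'⟩` on `ℝ × ℝⁿ`. -/
noncomputable def lorentz {n : ℕ} (x y : ℝ × EuclideanSpace ℝ (Fin n)) : ℝ :=
  x.1 * y.1 - inner ℝ x.2 y.2

/-- Hyperbolic `n`-space: the upper sheet of the hyperboloid `x₀² - |x'|² = 1` in `ℝ × ℝⁿ`. -/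
abbrev Hyperboloid (n : ℕ) : Type :=
  {x : ℝ × EuclideanSpace ℝ (Fin n) // lorentz x x = 1 ∧ 0 < x.1}

/-- The spaces `E^n`, `S^n` and `H^n`. -/
inductive SpaceForm where
  | euclidean (n : ℕ)
  | spherical (n : ℕ)
  | hyperbolic (n : ℕ)

namespace SpaceForm

/-- The set of points: `ℝⁿ`, the unit sphere of `ℝⁿ⁺¹`, or the hyperboloid in `ℝ × ℝⁿ`. -/
abbrev Pt : SpaceForm → Type
  | euclidean n => EuclideanSpace ℝ (Fin n)
  | spherical n => Metric.sphere (0 : EuclideanSpace ℝ (Fin (n + 1))) 1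
  | hyperbolic n => Hyperboloid n

/-- The distance: Euclidean distance, angle, or hyperbolic distance. -/
noncomputable def distance : (X : SpaceForm) → X.Pt → X.Pt → ℝ
  | euclidean _ => fun x y => dist x y
  | spherical _ => fun x y => InnerProductGeometry.angle x.1 y.1
  | hyperbolic _ => fun x y => Real.arcosh (lorentz x.1 y.1)

/-- The group of isometries of `X`. -/
def isometryGroup (X : SpaceForm) : Subgroup (Equiv.Perm X.Pt) where
  carrier := {g | ∀ x y, X.distance (g x) (g y) = X.distance x y}
  mul_mem' := fun {a b} ha hb x y => (ha (b x) (b y)).trans (hb x y)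
  one_mem' := fun _ _ => rfl
  inv_mem' := fun {a} ha x y => by simpa using (ha (a⁻¹ x) (a⁻¹ y)).symm

/-- (Nondegenerate) simplices of `X`: the convex hull of `n + 1` points in general position.  On the
sphere the points have to lie in an open hemisphere.  The convex hull of points of the sphere, or of
the hyperboloid, is the radial projection to it of their convex hull in the ambient vector space. -/
def IsSimplex : (X : SpaceForm) → Set X.Pt → Prop
  | euclidean n => fun s => ∃ p : Fin (n + 1) → EuclideanSpace ℝ (Fin n),
      AffineIndependent ℝ p ∧ s = convexHull ℝ (Set.range p)
  | spherical n => fun s => ∃ p : Fin (n + 1) →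
        Metric.sphere (0 : EuclideanSpace ℝ (Fin (n + 1))) 1,
      (∃ u : EuclideanSpace ℝ (Fin (n + 1)), ∀ i, 0 < inner ℝ u (p i).1) ∧
      LinearIndependent ℝ (fun i => (p i).1) ∧
      s = {x | ∃ r : ℝ, 0 < r ∧ r • x.1 ∈ convexHull ℝ (Set.range fun i => (p i).1)}
  | hyperbolic n => fun s => ∃ p : Fin (n + 1) → Hyperboloid n,
      LinearIndependent ℝ (fun i => (p i).1) ∧
      s = {x | ∃ r : ℝ, 0 < r ∧ r • x.1 ∈ convexHull ℝ (Set.range fun i => (p i).1)}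

/-- The `n`-dimensional volume on `X`: Lebesgue measure, surface measure of the sphere, or
hyperbolic volume, which in the coordinate `y = x'` on the hyperboloid is `dy / √(1 + |y|²)`. -/
noncomputable def vol : (X : SpaceForm) → Set X.Pt → ENNReal
  | euclidean n => fun s =>
      (MeasureTheory.volume : MeasureTheory.Measure (EuclideanSpace ℝ (Fin n))) s
  | spherical n => fun s =>
      (MeasureTheory.volume :
        MeasureTheory.Measure (EuclideanSpace ℝ (Fin (n + 1)))).toSphere s
  | hyperbolic n => fun s =>
      ∫⁻ y : EuclideanSpace ℝ (Fin n) in (fun x : Hyperboloid n => x.1.2) '' s,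
        ENNReal.ofReal (1 / Real.sqrt (1 + ‖y‖ ^ 2))

/-- A finite union of simplices (possibly empty). -/
def IsSimplexUnion (X : SpaceForm) (s : Set X.Pt) : Prop :=
  ∃ F : Set (Set X.Pt), F.Finite ∧ (∀ t ∈ F, X.IsSimplex t) ∧ s = ⋃₀ F

/-- The polytopes of `X`: the nonempty finite unions of simplices. -/
abbrev Polytope (X : SpaceForm) : Type := {s : Set X.Pt // X.IsSimplexUnion s ∧ s.Nonempty}

/-- The defining relations of the scissors congruence group: `[P] = [g P]` for `g ∈ G`, and
`[P ∪ Q] = [P] + [Q]` if `P ∩ Q` has measure zero. -/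
def scissorsRelations (X : SpaceForm) (G : Subgroup (Equiv.Perm X.Pt)) :
    Set (FreeAbelianGroup X.Polytope) :=
  {x | ∃ (P Q : X.Polytope) (g : Equiv.Perm X.Pt), g ∈ G ∧ g '' P.1 = Q.1 ∧
    x = FreeAbelianGroup.of P - FreeAbelianGroup.of Q} ∪
  {x | ∃ P Q R : X.Polytope, X.vol (P.1 ∩ Q.1) = 0 ∧ R.1 = P.1 ∪ Q.1 ∧
    x = FreeAbelianGroup.of R - (FreeAbelianGroup.of P + FreeAbelianGroup.of Q)}

/-- The scissors congruence group `𝒫(X, G)`. -/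
abbrev ScissorsGroup (X : SpaceForm) (G : Subgroup (Equiv.Perm X.Pt)) : Type :=
  FreeAbelianGroup X.Polytope ⧸ AddSubgroup.closure (X.scissorsRelations G)

/-- The class of a polytope in `𝒫(X, G)`. -/
def ScissorsGroup.of (X : SpaceForm) (G : Subgroup (Equiv.Perm X.Pt)) (P : X.Polytope) :
    X.ScissorsGroup G :=
  QuotientAddGroup.mk (FreeAbelianGroup.of P)

/-- The objects of the double category of polytopes of `X` (with the action of `G`): the polytopes
and the empty set. -/
@[ext]
structure Obj (X : SpaceForm) (G : Subgroup (Equiv.Perm X.Pt)) where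
  carrier : Set X.Pt
  isSimplexUnion : X.IsSimplexUnion carrier

variable {X : SpaceForm} {G : Subgroup (Equiv.Perm X.Pt)}

/-- Objects are ordered by inclusion; the vertical morphisms are the inclusions. -/
instance : PartialOrder (X.Obj G) :=
  PartialOrder.lift Obj.carrier (fun _ _ => Obj.ext)

/-- Horizontal morphisms `P → Q` are the `g ∈ G` with `g P = Q`; a square of inclusions and
horizontal morphisms commutes if its two horizontal sides are given by the same element of `G`. -/
instance : DoubleCategory.{0, 0} (X.Obj G) where
  HHom P Q := {g : Equiv.Perm X.Pt // g ∈ G ∧ g '' P.carrier = Q.carrier}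
  hid P := ⟨1, G.one_mem, Set.image_id _⟩
  hcomp g k := ⟨k.1 * g.1, G.mul_mem k.2.1 g.2.1, by
    rw [Equiv.Perm.coe_mul, Set.image_comp, g.2.2, k.2.2]⟩
  hid_hcomp _ := Subtype.ext (mul_one _)
  hcomp_hid _ := Subtype.ext (one_mul _)
  hcomp_assoc _ _ _ := Subtype.ext (mul_assoc _ _ _).symm
  Sq g _ _ k := g.1 = k.1
  sq_vid _ := rfl
  sq_hid _ := rfl
  sq_hcomp h₁ h₂ := congrArg₂ (fun a b => b * a) h₁ h₂
  sq_vcomp h₁ h₂ := h₁.trans h₂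
  sq_hinv {_ _ _ _ g g' _ _ k k'} h₁ _ h₃ _ hs := by
    have e₁ : g'.1 * g.1 = 1 := congrArg Subtype.val h₁
    have e₃ : k'.1 * k.1 = 1 := congrArg Subtype.val h₃
    rw [eq_inv_of_mul_eq_one_left e₁, eq_inv_of_mul_eq_one_left e₃, hs]
  sq_vinv hs := hs.symm

/-- A polytope of `X`, as an object of the double category. -/
def Polytope.toObj (P : X.Polytope) : X.Obj G := ⟨P.1, P.2.1⟩

lemma Polytope.isPolytope_toObj (P : X.Polytope) : IsPolytope (P.toObj : X.Obj G) := by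
  refine ⟨fun hi => ?_⟩
  have h0 : X.IsSimplexUnion (∅ : Set X.Pt) := ⟨∅, Set.finite_empty, by simp, by simp⟩
  have hle : P.1 ⊆ ∅ := leOfHom (hi.to (⟨∅, h0⟩ : X.Obj G))
  exact P.2.2.ne_empty (Set.subset_empty_iff.mp hle)

end SpaceForm

end ScissorsCongruence

open ScissorsCongruence

/-!
The intersection of two polytopes need not be a polytope. But simplices are the traces of simplicial
cones, and the intersection of two such cones is, up to a null set, a finite union of simplicial
cones. Hence the finite unions of simplices form a distributive lattice on which `G` acts, and two
polytopes are disjoint in it if and only if their intersection has measure zero.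

A morphism `A ⟶ B` of `SC` amounts to a finite set of copies `g⁻¹ • B j` inside the `A i`, so it is
a relation labelled by elements of `G`, and composition is composition of relations. The pushout of
a cofibration `A ⟶ B` along `A ⟶ D` is obtained by cutting the members of `D` along the partitions
of the members of `A` into copies of members of `B`, and by adding the members of `B` without a copy
in `A`. Finally both `K₀` and `𝒫(X, G)` carry a universal `G`-invariant finitely additive function
on polytopes, hence they are isomorphic.
-/

universe v w u

namespace ScissorsCongruence

open Set

section SimplicialCone

variable {V ι : Type*} [AddCommGroup V] [Module ℝ V] {p : ι → V}

/-- The convex cone generated by a family of vectors; it is simplicial if the family is linearly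
independent. -/
abbrev coneSpan (p : ι → V) : PointedCone ℝ V := PointedCone.hull ℝ (range p)

lemma mem_coneSpan_self (p : ι → V) (i : ι) : p i ∈ coneSpan p :=
  PointedCone.subset_hull (mem_range_self i)

lemma coneSpan_le {C : PointedCone ℝ V} : coneSpan p ≤ C ↔ ∀ i, p i ∈ C :=
  Submodule.span_le.trans range_subset_iff

lemma mem_coneSpan_iff [Fintype ι] {v : V} :
    v ∈ coneSpan p ↔ ∃ c : ι → ℝ, (∀ i, 0 ≤ c i) ∧ ∑ i, c i • p i = v := by
  refine (Submodule.mem_span_range_iff_exists_fun _).trans ⟨?_, ?_⟩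
  · rintro ⟨c, hc⟩
    exact ⟨fun i => c i, fun i => (c i).2, hc⟩
  · rintro ⟨c, c_nonneg, hc⟩
    exact ⟨fun i => ⟨c i, c_nonneg i⟩, hc⟩

lemma coneSpan_basis [Finite ι] (b : Module.Basis ι ℝ V) :
    (coneSpan b : Set V) = {v | ∀ i, 0 ≤ b.coord i v} := by
  have := Fintype.ofFinite ι
  ext v
  refine mem_coneSpan_iff.trans ⟨?_, fun h => ⟨_, h, b.sum_repr v⟩⟩
  rintro ⟨c, c_nonneg, rfl⟩ i
  rw [b.coord_apply, b.repr_sum_self]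
  exact c_nonneg i

lemma coneSpan_smul {t : ι → ℝ} (ht : ∀ i, 0 < t i) :
    coneSpan (fun i => t i • p i) = coneSpan p := by
  refine le_antisymm (coneSpan_le.2 fun i => PointedCone.smul_mem _ (ht i).le
    (mem_coneSpan_self p i)) (coneSpan_le.2 fun i => ?_)
  exact (PointedCone.smul_mem_iff _ (ht i)).1 (mem_coneSpan_self (fun i => t i • p i) i)

lemma map_nonneg_of_mem_coneSpan {f : V →ₗ[ℝ] ℝ} (h : ∀ i, 0 ≤ f (p i)) {v : V}
    (hv : v ∈ coneSpan p) : 0 ≤ f v :=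
  coneSpan_le (C := (PointedCone.positive ℝ ℝ).comap f) |>.2 h hv

lemma map_nonpos_of_mem_coneSpan {f : V →ₗ[ℝ] ℝ} (h : ∀ i, f (p i) ≤ 0) {v : V}
    (hv : v ∈ coneSpan p) : f v ≤ 0 :=
  neg_nonneg.1 (map_nonneg_of_mem_coneSpan (f := -f) (fun i => neg_nonneg.2 (h i)) hv)

/-- `HasSign f s` says that `s` lies on one side of the hyperplane `f = 0`. -/
def HasSign (f : V →ₗ[ℝ] ℝ) (s : Set V) : Prop := (∀ v ∈ s, 0 ≤ f v) ∨ ∀ v ∈ s, f v ≤ 0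

lemma HasSign.mono {f : V →ₗ[ℝ] ℝ} {s t : Set V} (h : HasSign f t) (hst : s ⊆ t) :
    HasSign f s :=
  h.imp (fun h v hv => h v (hst hv)) fun h v hv => h v (hst hv)

variable [DecidableEq ι] {i j : ι} {a b : ℝ}

lemma coneSpan_update_le (ha : 0 ≤ a) (hb : 0 ≤ b) (k : ι) :
    coneSpan (Function.update p k (a • p i + b • p j)) ≤ coneSpan p := by
  refine coneSpan_le.2 fun l => ?_
  rcases eq_or_ne l k with rfl | hl
  · rw [Function.update_self]
    exact add_mem (PointedCone.smul_mem _ ha (mem_coneSpan_self p i))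
      (PointedCone.smul_mem _ hb (mem_coneSpan_self p j))
  · rw [Function.update_of_ne hl]
    exact mem_coneSpan_self p l

lemma sum_smul_mem_coneSpan_update [Fintype ι] (hij : i ≠ j) (ha : 0 < a) (hb : 0 < b)
    {c : ι → ℝ} (hc : ∀ k, 0 ≤ c k) (h : c i / a ≤ c j / b) :
    ∑ k, c k • p k ∈ coneSpan (Function.update p i (a • p i + b • p j)) := by
  set q := Function.update p i (a • p i + b • p j) with hq
  have q_self : q i = a • p i + b • p j := Function.update_self ..
  have q_of_ne {k : ι} (hk : k ≠ i) : q k = p k := Function.update_of_ne hk ..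
  have hj : j ∈ Finset.univ.erase i := by simp [hij.symm]
  have two_terms :
      c i • p i + c j • p j = (c i / a) • q i + (c j - b * (c i / a)) • q j := by
    rw [q_self, q_of_ne hij.symm]
    match_scalars <;> field_simp
    ring
  have coeff_nonneg : 0 ≤ c j - b * (c i / a) := by
    rw [le_div_iff₀ hb] at h
    linarith
  rw [← Finset.add_sum_erase _ _ (Finset.mem_univ i), ← Finset.add_sum_erase _ _ hj,
    ← add_assoc, two_terms]
  refine add_mem (add_mem ?_ ?_) (sum_mem fun k hk => ?_)
  · exact PointedCone.smul_mem _ (div_nonneg (hc i) ha.le) (mem_coneSpan_self q i)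
  · exact PointedCone.smul_mem _ coeff_nonneg (mem_coneSpan_self q j)
  · rw [← q_of_ne (Finset.ne_of_mem_erase (Finset.mem_of_mem_erase hk))]
    exact PointedCone.smul_mem _ (hc k) (mem_coneSpan_self q k)

lemma coneSpan_eq_union_update [Finite ι] (hij : i ≠ j) (ha : 0 < a) (hb : 0 < b) :
    (coneSpan p : Set V) = (coneSpan (Function.update p i (a • p i + b • p j)) : Set V) ∪
      (coneSpan (Function.update p j (a • p i + b • p j)) : Set V) := by
  have := Fintype.ofFinite ι
  refine subset_antisymm (fun v hv => ?_)
    (union_subset (coneSpan_update_le ha.le hb.le i) (coneSpan_update_le ha.le hb.le j))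
  obtain ⟨c, hc, rfl⟩ := mem_coneSpan_iff.1 hv
  rcases le_total (c i / a) (c j / b) with h | h
  · exact Or.inl (sum_smul_mem_coneSpan_update hij ha hb hc h)
  · rw [add_comm (a • p i)]
    exact Or.inr (sum_smul_mem_coneSpan_update hij.symm hb ha hc h)

lemma linearIndependent_update_smul_add_smul (hp : LinearIndependent ℝ p) (hij : i ≠ j)
    (ha : a ≠ 0) (hb : b ≠ 0) {k : ι} (hk : k = i ∨ k = j) :
    LinearIndependent ℝ (Function.update p k (a • p i + b • p j)) := by
  refine hp.update k _ ⟨1, one_mem _, Finsupp.single i a + Finsupp.single j b, ?_, ?_⟩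
  · rw [mem_nonZeroDivisors_iff_ne_zero]
    rcases hk with rfl | rfl
    · simpa [hij.symm] using ha
    · simpa [hij] using hb
  · simp

lemma card_filter_update_lt [Fintype ι] (f : V →ₗ[ℝ] ℝ) {q : V} (hq : f q = 0) {k : ι}
    (hk : f (p k) ≠ 0) :
    (Finset.univ.filter fun l => f (Function.update p k q l) ≠ 0).card <
      (Finset.univ.filter fun l => f (p l) ≠ 0).card := by
  refine Finset.card_lt_card ((Finset.ssubset_iff_of_subset fun l hl => ?_).2 ⟨k, ?_, ?_⟩)
  · rcases eq_or_ne l k with rfl | h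
    · simpa using hk
    · simpa [Function.update_of_ne h] using hl
  · simpa using hk
  · simp [hq]

end SimplicialCone

lemma nonneg_coord_subset_closure_pos_coord {V ι : Type*} [NormedAddCommGroup V]
    [NormedSpace ℝ V] [Finite ι] (b : Module.Basis ι ℝ V) :
    {v | ∀ i, 0 ≤ b.coord i v} ⊆ closure {v | ∀ i, 0 < b.coord i v} := by
  have pos_eq : {v | ∀ i, 0 < b.coord i v} = b.equivFunL ⁻¹' pi univ fun _ => Ioi (0 : ℝ) := by
    ext v
    simp
  intro v hv
  rw [pos_eq, ← b.equivFunL.preimage_closure, closure_pi_set]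
  simpa [Pi.le_def] using hv

/-- A presentation of the simplices of a space as the traces of the simplicial cones whose
generators lie on the rays through the points of the space, with the properties of the volume which
relate null sets to linear hyperplanes. The index type `ι` has as many elements as a simplex has
vertices. -/
structure ConeModel (T : Type*) (IsSimplex : Set T → Prop) (vol : Set T → ENNReal) (ι V : Type*)
    [Fintype ι] [NormedAddCommGroup V] [NormedSpace ℝ V] where
  card_eq_finrank : Fintype.card ι = Module.finrank ℝ V
  /-- the embedding of the space in the vector space -/
  emb : T → V
  emb_ne_zero (x : T) : emb x ≠ 0
  add_mem (r s : ℝ) (hr : 0 < r) (hs : 0 < s) (x y : T) : r • emb x + s • emb y ≠ 0 →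
    ∃ t : ℝ, 0 < t ∧ ∃ z : T, t • emb z = r • emb x + s • emb y
  isSimplex_iff (s : Set T) : IsSimplex s ↔ ∃ p : ι → T,
    LinearIndependent ℝ (emb ∘ p) ∧ s = emb ⁻¹' (coneSpan (emb ∘ p) : Set V)
  vol_empty : vol ∅ = 0
  vol_mono {s t : Set T} : s ⊆ t → vol t = 0 → vol s = 0
  vol_union {s t : Set T} : vol s = 0 → vol t = 0 → vol (s ∪ t) = 0
  vol_hyperplane (f : V →ₗ[ℝ] ℝ) : f ≠ 0 → vol (emb ⁻¹' {v | f v = 0}) = 0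
  vol_open (O : Set V) : IsOpen O → (emb ⁻¹' O).Nonempty → vol (emb ⁻¹' O) ≠ 0

namespace ConeModel

variable {T : Type*} {IsSimplex : Set T → Prop} {vol : Set T → ENNReal} {ι V : Type*}
  [Fintype ι] [NormedAddCommGroup V] [NormedSpace ℝ V]
  (M : ConeModel T IsSimplex vol ι V)

/-- The union of the open rays through the points of the space. -/
def rays : Set V := {v | ∃ t : ℝ, 0 < t ∧ ∃ z : T, t • M.emb z = v}

lemma emb_mem_rays (x : T) : M.emb x ∈ M.rays := ⟨1, one_pos, x, one_smul _ _⟩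

lemma smul_mem_rays {v : V} (hv : v ∈ M.rays) {r : ℝ} (hr : 0 < r) : r • v ∈ M.rays := by
  obtain ⟨t, ht, z, rfl⟩ := hv
  exact ⟨r * t, mul_pos hr ht, z, mul_smul _ _ _⟩

lemma add_mem_rays {v w : V} (hv : v ∈ M.rays) (hw : w ∈ M.rays) (h : v + w ≠ 0) :
    v + w ∈ M.rays := by
  obtain ⟨t, ht, z, rfl⟩ := hv
  obtain ⟨t', ht', z', rfl⟩ := hw
  exact M.add_mem _ _ ht ht' _ _ h

lemma mem_rays_of_mem_coneSpan {κ : Type*} {p : κ → V} (hp : ∀ i, p i ∈ M.rays) {v : V}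
    (hv : v ∈ coneSpan p) : v = 0 ∨ v ∈ M.rays := by
  induction hv using Submodule.span_induction with
  | mem x hx => obtain ⟨i, rfl⟩ := hx; exact Or.inr (hp i)
  | zero => exact Or.inl rfl
  | add x y _ _ hx hy =>
    by_cases h : x + y = 0
    · exact Or.inl h
    rcases hx with rfl | hx
    · rwa [zero_add]
    rcases hy with rfl | hy
    · rw [add_zero]; exact Or.inr hx
    exact Or.inr (M.add_mem_rays hx hy h)
  | smul a x _ hx =>
    rcases hx with rfl | hx
    · exact Or.inl (smul_zero _)
    rcases eq_or_ne a 0 with rfl | ha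
    · exact Or.inl (zero_smul _ _)
    · exact Or.inr (M.smul_mem_rays hx (r := (a : ℝ)) (lt_of_le_of_ne a.2 fun h =>
        ha (Subtype.ext h.symm)))

/-- Linearly independent families of maximal length on the rays of a cone model: the generators of
the cones over simplices. -/
def IsGen (p : ι → V) : Prop :=
  LinearIndependent ℝ p ∧ ∀ i, p i ∈ M.rays

variable {M} {p : ι → V}

lemma IsGen.isSimplex (hp : M.IsGen p) : IsSimplex (M.emb ⁻¹' (coneSpan p : Set V)) := by
  choose t ht z hz using hp.2
  obtain rfl : p = fun i => t i • (M.emb ∘ z) i := funext fun i => (hz i).symm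
  refine (M.isSimplex_iff _).2 ⟨z, ?_, by rw [coneSpan_smul ht]⟩
  exact (LinearIndependent.units_smul_iff _ fun i => Units.mk0 (t i) (ht i).ne').1 hp.1

variable (M) in
lemma exists_isGen {s : Set T} (hs : IsSimplex s) :
    ∃ p, M.IsGen p ∧ s = M.emb ⁻¹' (coneSpan p : Set V) := by
  obtain ⟨p, hp, rfl⟩ := (M.isSimplex_iff _).1 hs
  exact ⟨_, ⟨hp, fun i => M.emb_mem_rays _⟩, rfl⟩

lemma IsGen.update (hp : M.IsGen p) [DecidableEq ι] {i j k : ι} (hij : i ≠ j)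
    (hk : k = i ∨ k = j) {a b : ℝ} (ha : 0 < a) (hb : 0 < b) :
    M.IsGen (Function.update p k (a • p i + b • p j)) := by
  have linInd := linearIndependent_update_smul_add_smul hp.1 hij ha.ne' hb.ne' hk
  refine ⟨linInd, fun l => ?_⟩
  rcases eq_or_ne l k with rfl | hl
  · have h0 := linInd.ne_zero l
    rw [Function.update_self] at h0 ⊢
    exact M.add_mem_rays (M.smul_mem_rays (hp.2 i) ha) (M.smul_mem_rays (hp.2 j) hb) h0
  · rw [Function.update_of_ne hl]
    exact hp.2 l

-- If `f` changes sign along the edge from `p i` to `p j`, cutting the cone through the zero of `f`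
-- on that edge leaves two cones with fewer generators outside of the kernel of `f`.
lemma IsGen.exists_subdivision_hasSign (hp : M.IsGen p) (f : V →ₗ[ℝ] ℝ) :
    ∃ F : Set (ι → V), F.Finite ∧
      (∀ q ∈ F, M.IsGen q ∧ HasSign f (coneSpan q : Set V)) ∧
      (coneSpan p : Set V) = ⋃ q ∈ F, (coneSpan q : Set V) := by
  classical
  induction hn : (Finset.univ.filter fun l => f (p l) ≠ 0).card using Nat.strong_induction_on
    generalizing p with
  | h n ih =>
  subst hn
  by_cases hasSign : HasSign f (coneSpan p : Set V)
  · exact ⟨{p}, finite_singleton _, by simpa using ⟨hp, hasSign⟩, by simp⟩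
  obtain ⟨j, hj⟩ : ∃ j, f (p j) < 0 := by
    by_contra! h
    exact hasSign (Or.inl fun v => map_nonneg_of_mem_coneSpan h)
  obtain ⟨i, hi⟩ : ∃ i, 0 < f (p i) := by
    by_contra! h
    exact hasSign (Or.inr fun v => map_nonpos_of_mem_coneSpan h)
  have hij : i ≠ j := by
    rintro rfl
    exact lt_asymm hi hj
  have hj' : 0 < -f (p j) := neg_pos.2 hj
  have cut_zero : f ((-f (p j)) • p i + f (p i) • p j) = 0 := by
    simp only [map_add, map_smul, smul_eq_mul]
    ring
  obtain ⟨F₁, F₁_finite, hF₁, cover₁⟩ := ih _ (card_filter_update_lt f cut_zero hi.ne')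
    (hp.update hij (Or.inl rfl) hj' hi) rfl
  obtain ⟨F₂, F₂_finite, hF₂, cover₂⟩ := ih _ (card_filter_update_lt f cut_zero hj.ne)
    (hp.update hij (Or.inr rfl) hj' hi) rfl
  refine ⟨F₁ ∪ F₂, F₁_finite.union F₂_finite, fun r hr => hr.elim (hF₁ r) (hF₂ r), ?_⟩
  rw [biUnion_union, ← cover₁, ← cover₂]
  exact coneSpan_eq_union_update hij hj' hi

lemma IsGen.exists_subdivision_forall_hasSign (hp : M.IsGen p) (L : List (V →ₗ[ℝ] ℝ)) :
    ∃ F : Set (ι → V), F.Finite ∧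
      (∀ q ∈ F, M.IsGen q ∧ ∀ f ∈ L, HasSign f (coneSpan q : Set V)) ∧
      (coneSpan p : Set V) = ⋃ q ∈ F, (coneSpan q : Set V) := by
  induction L with
  | nil => exact ⟨{p}, finite_singleton _, by simpa using hp, by simp⟩
  | cons f L ih =>
    obtain ⟨F, F_finite, hF, coverF⟩ := ih
    choose! F' F'_finite hF' coverF' using fun q hq => (hF q hq).1.exists_subdivision_hasSign f
    refine ⟨⋃ q ∈ F, F' q, F_finite.biUnion F'_finite, fun r hr => ?_, ?_⟩
    · obtain ⟨q, hq, hr⟩ := mem_iUnion₂.1 hr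
      have cone_le : (coneSpan r : Set V) ⊆ coneSpan q := by
        rw [coverF' q hq]
        exact subset_biUnion_of_mem (u := fun r => (coneSpan r : Set V)) hr
      exact ⟨(hF' q hq r hr).1, List.forall_mem_cons.2
        ⟨(hF' q hq r hr).2, fun g hg => ((hF q hq).2 g hg).mono cone_le⟩⟩
    · rw [coverF, iUnion₂_congr coverF']
      ext v
      simp only [mem_iUnion, exists_prop, ← exists_and_right, and_assoc]
      exact ⟨fun ⟨q, hq, r, hr, hv⟩ => ⟨r, q, hq, hr, hv⟩,
        fun ⟨r, q, hq, hr, hv⟩ => ⟨q, hq, r, hr, hv⟩⟩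

/-- The basis of the vector space given by the generators of a simplicial cone. -/
noncomputable def IsGen.basis [FiniteDimensional ℝ V] (hp : M.IsGen p) :
    Module.Basis ι ℝ V :=
  basisOfTopLeSpanOfCardEqFinrank p
    (hp.1.span_eq_top_of_card_eq_finrank' M.card_eq_finrank).ge M.card_eq_finrank

lemma IsGen.coneSpan_eq [FiniteDimensional ℝ V] (hp : M.IsGen p) :
    (coneSpan p : Set V) = {v | ∀ i, 0 ≤ hp.basis.coord i v} := by
  rw [← coneSpan_basis, IsGen.basis, coe_basisOfTopLeSpanOfCardEqFinrank]

lemma exists_subdivision [FiniteDimensional ℝ V] (M : ConeModel T IsSimplex vol ι V) {s t : Set T}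
    (hs : IsSimplex s) (ht : IsSimplex t) :
    ∃ F : Set (Set T), F.Finite ∧ (∀ r ∈ F, IsSimplex r ∧ (r ⊆ t ∨ vol (r ∩ t) = 0)) ∧
      s = ⋃₀ F := by
  obtain ⟨p, hp, rfl⟩ := M.exists_isGen hs
  obtain ⟨q, hq, rfl⟩ := M.exists_isGen ht
  obtain ⟨F, F_finite, hF, cover⟩ :=
    hp.exists_subdivision_forall_hasSign (Finset.univ.toList.map hq.basis.coord)
  refine ⟨(fun r => M.emb ⁻¹' (coneSpan r : Set V)) '' F, F_finite.image _, ?_, ?_⟩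
  · rintro _ ⟨r, hr, rfl⟩
    refine ⟨(hF r hr).1.isSimplex, ?_⟩
    rw [hq.coneSpan_eq]
    by_cases h : ∀ i, ∀ v ∈ coneSpan r, 0 ≤ hq.basis.coord i v
    · exact Or.inl (preimage_mono fun v hv i => h i v hv)
    · push Not at h
      obtain ⟨i, v, hv, v_neg⟩ := h
      have nonpos := ((hF r hr).2 (hq.basis.coord i) (by simp)).resolve_left
        fun h => (h v hv).not_gt v_neg
      have coord_ne_zero : hq.basis.coord i ≠ 0 := fun h0 => by simp [h0] at v_neg
      exact Or.inr (M.vol_mono (fun x hx => le_antisymm (nonpos _ hx.1) (hx.2 i))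
        (M.vol_hyperplane _ coord_ne_zero))
  · rw [cover, sUnion_image, preimage_iUnion₂]

lemma exists_isClosed_cone [FiniteDimensional ℝ V] (M : ConeModel T IsSimplex vol ι V)
    {F : Set (Set T)} (F_finite : F.Finite) (hF : ∀ r ∈ F, IsSimplex r) :
    ∃ C : Set V, IsClosed C ∧ (∀ v ∈ C, ∀ r : ℝ, 0 ≤ r → r • v ∈ C) ∧ ⋃₀ F = M.emb ⁻¹' C := by
  choose! p hp e using fun r hr => M.exists_isGen (hF r hr)
  refine ⟨⋃ r ∈ F, (coneSpan (p r) : Set V), F_finite.isClosed_biUnion fun r hr => ?_,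
    fun v hv c hc => ?_, ?_⟩
  · rw [(hp r hr).coneSpan_eq, ofPred_forall]
    exact isClosed_iInter fun i => isClosed_le continuous_const
      ((hp r hr).basis.coord i).continuous_of_finiteDimensional
  · obtain ⟨r, hr, hv⟩ := mem_iUnion₂.1 hv
    exact mem_iUnion₂.2 ⟨r, hr, PointedCone.smul_mem _ hc hv⟩
  · rw [preimage_iUnion₂, sUnion_eq_biUnion]
    exact iUnion₂_congr e

-- Points of `s` outside of the closed set `⋃₀ F` are limits of interior points of `s`, so if there
-- is one, then `s \ ⋃₀ F` contains a nonempty open set.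
lemma subset_sUnion_of_vol_diff_eq_zero [FiniteDimensional ℝ V]
    (M : ConeModel T IsSimplex vol ι V) {s : Set T} (hs : IsSimplex s) {F : Set (Set T)}
    (F_finite : F.Finite) (hF : ∀ r ∈ F, IsSimplex r) (h0 : vol (s \ ⋃₀ F) = 0) :
    s ⊆ ⋃₀ F := by
  obtain ⟨C, C_closed, C_smul, e⟩ := M.exists_isClosed_cone F_finite hF
  obtain ⟨p, hp, rfl⟩ := M.exists_isGen hs
  rw [e] at h0 ⊢
  by_contra h
  obtain ⟨x, hx, hxC⟩ := not_subset.1 h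
  set I : Set V := {v | ∀ i, 0 < hp.basis.coord i v}
  have I_open : IsOpen I := by
    simp only [I, ofPred_forall]
    exact isOpen_iInter_of_finite fun i => isOpen_lt continuous_const
      (hp.basis.coord i).continuous_of_finiteDimensional
  have I_subset : I ⊆ coneSpan p := by
    rw [hp.coneSpan_eq]
    exact fun v hv i => (hv i).le
  have x_mem_closure : M.emb x ∈ closure I := by
    rw [mem_preimage, hp.coneSpan_eq] at hx
    exact nonneg_coord_subset_closure_pos_coord _ hx
  obtain ⟨v, ⟨hvC, hv0⟩, hvI⟩ := mem_closure_iff.1 x_mem_closure (Cᶜ ∩ {0}ᶜ)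
    (C_closed.isOpen_compl.inter isOpen_compl_singleton) ⟨hxC, M.emb_ne_zero x⟩
  obtain ⟨t, ht, z, rfl⟩ := (M.mem_rays_of_mem_coneSpan hp.2 (I_subset hvI)).resolve_left hv0
  have hzC : M.emb z ∉ C := fun hz => hvC (C_smul _ hz t ht.le)
  have hzI : M.emb z ∈ I := fun i => by simpa [ht] using hvI i
  have nonempty : (M.emb ⁻¹' (Cᶜ ∩ I)).Nonempty := ⟨z, And.intro hzC hzI⟩
  refine M.vol_open _ (C_closed.isOpen_compl.inter I_open) nonempty
    (M.vol_mono (fun y hy => ?_) h0)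
  exact ⟨I_subset hy.2, hy.1⟩

end ConeModel

end ScissorsCongruence

namespace ScissorsCongruence

open Set MeasureTheory
open scoped Pointwise

section ConvexHull

variable {V ι : Type*} [AddCommGroup V] [Module ℝ V] {p : ι → V}

lemma mem_convexHull_range_iff [Fintype ι] {x : V} :
    x ∈ convexHull ℝ (range p) ↔
      ∃ c : ι → ℝ, (∀ i, 0 ≤ c i) ∧ ∑ i, c i = 1 ∧ ∑ i, c i • p i = x := by
  classical
  have range_eq :
      range p = Fintype.linearCombination ℝ p '' range fun i j : ι => if i = j then 1 else 0 := by
    rw [← range_comp]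
    congr 1
    ext i
    simp [Fintype.linearCombination_apply]
  rw [range_eq, ← LinearMap.image_convexHull, convexHull_basis_eq_stdSimplex]
  simp only [stdSimplex, mem_image, mem_ofPred_eq, and_assoc, Fintype.linearCombination_apply]

lemma exists_smul_mem_convexHull_iff [Finite ι] {x : V} (hx : x ≠ 0) :
    (∃ r : ℝ, 0 < r ∧ r • x ∈ convexHull ℝ (range p)) ↔ x ∈ coneSpan p := by
  have := Fintype.ofFinite ι
  constructor
  · rintro ⟨r, hr, h⟩
    obtain ⟨c, c_nonneg, -, hc⟩ := mem_convexHull_range_iff.1 h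
    exact (PointedCone.smul_mem_iff _ hr).1 (mem_coneSpan_iff.2 ⟨c, c_nonneg, hc⟩)
  · rintro hx'
    obtain ⟨c, c_nonneg, rfl⟩ := mem_coneSpan_iff.1 hx'
    have sum_pos : 0 < ∑ i, c i := by
      refine (Finset.sum_nonneg fun i _ => c_nonneg i).lt_of_ne fun h => hx ?_
      have c_eq_zero := (Finset.sum_eq_zero_iff_of_nonneg fun i _ => c_nonneg i).1 h.symm
      exact Finset.sum_eq_zero fun i hi => by rw [c_eq_zero i hi, zero_smul]
    refine ⟨(∑ i, c i)⁻¹, inv_pos.2 sum_pos, mem_convexHull_range_iff.2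
      ⟨fun i => (∑ i, c i)⁻¹ * c i,
        fun i => mul_nonneg (inv_nonneg.2 sum_pos.le) (c_nonneg i), ?_, ?_⟩⟩
    · rw [← Finset.mul_sum, inv_mul_cancel₀ sum_pos.ne']
    · simp only [mul_smul, Finset.smul_sum]

lemma mem_convexHull_range_iff_prod_one_mem_coneSpan [Finite ι] {x : V} :
    x ∈ convexHull ℝ (range p) ↔ ((1 : ℝ), x) ∈ coneSpan fun i => ((1 : ℝ), p i) := by
  have := Fintype.ofFinite ι
  rw [mem_convexHull_range_iff, mem_coneSpan_iff]
  refine exists_congr fun c => and_congr_right fun _ => ?_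
  simp [Prod.ext_iff, Prod.fst_sum, Prod.snd_sum]

lemma linearIndependent_prod_one_iff [Finite ι] :
    LinearIndependent ℝ (fun i => ((1 : ℝ), p i)) ↔ AffineIndependent ℝ p := by
  have := Fintype.ofFinite ι
  rw [Fintype.linearIndependent_iff, affineIndependent_iff_of_fintype]
  refine forall_congr' fun c => ?_
  rw [← and_imp]
  have sum_eq_zero_iff : ∑ i, c i • ((1 : ℝ), p i) = 0 ↔
      ∑ i, c i = 0 ∧ ∑ i, c i • p i = 0 := by
    simp [Prod.ext_iff, Prod.fst_sum, Prod.snd_sum]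
  rw [sum_eq_zero_iff]
  refine imp_congr_left (and_congr_right fun hc => ?_)
  rw [Finset.univ.weightedVSub_eq_linear_combination hc]

end ConvexHull

lemma map_prod_eq {E : Type*} [AddCommGroup E] [Module ℝ E] (f : ℝ × E →ₗ[ℝ] ℝ) (v : ℝ × E) :
    f v = f (1, 0) * v.1 + f (0, v.2) := by
  have decomp : v = v.1 • ((1 : ℝ), (0 : E)) + (0, v.2) := by ext1 <;> simp
  rw [mul_comm, ← smul_eq_mul, ← map_smul, ← map_add, ← decomp]

section NullSets

variable {E : Type*} [NormedAddCommGroup E] [NormedSpace ℝ E] [MeasurableSpace E] [BorelSpace E]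
  [FiniteDimensional ℝ E] (μ : Measure E) [μ.IsAddHaarMeasure]

lemma addHaar_eq_zero_of_map_eq_zero {f : E →ₗ[ℝ] ℝ} (hf : f ≠ 0) : μ {x | f x = 0} = 0 :=
  Measure.addHaar_submodule μ (LinearMap.ker f) fun h => hf (LinearMap.ker_eq_top.1 h)

lemma addHaar_eq_zero_of_map_prod_one_eq_zero {f : ℝ × E →ₗ[ℝ] ℝ} (hf : f ≠ 0) :
    μ {x | f (1, x) = 0} = 0 := by
  let A : AffineSubspace ℝ E := (LinearMap.ker f).toAffineSubspace.comap
    (AffineMap.const ℝ E (1 : ℝ) |>.prod (AffineMap.id ℝ E))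
  refine Measure.addHaar_affineSubspace μ A fun h => hf (LinearMap.ext fun v => ?_)
  have vanish (x : E) : f (1, x) = 0 := by
    have : x ∈ A := h ▸ AffineSubspace.mem_top ℝ E x
    simpa [A] using this
  have at_zero : f (1, 0) = 0 := vanish 0
  simpa [map_prod_eq f v, at_zero, map_prod_eq f (1, v.2)] using vanish v.2

-- The dilates of `s` are uncountably many disjoint sets, so one of them is null.
lemma addHaar_eq_zero_of_forall_smul_mem {s : Set E} (hs : MeasurableSet s)
    (h : ∀ x ∈ s, ∀ t : ℝ, 0 < t → t • x ∈ s → t = 1) : μ s = 0 := by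
  have disjoint : Pairwise (Function.onFun Disjoint fun r : Ioi (0 : ℝ) => r.1 • s) := by
    rintro ⟨r, hr⟩ ⟨t, ht⟩ hrt
    refine disjoint_left.2 ?_
    rintro _ ⟨x, hx, rfl⟩ ⟨y, hy, e⟩
    have hr0 : r ≠ 0 := ne_of_gt hr
    have e' : (r⁻¹ * t) • y = x := by
      rw [mul_smul, inv_smul_eq_iff₀ hr0]
      exact e
    have := h y hy _ (mul_pos (inv_pos.2 hr) ht) (e' ▸ hx)
    exact hrt (Subtype.ext (inv_mul_eq_one₀ hr0 |>.1 this))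
  have countable := Measure.countable_meas_pos_of_disjoint_iUnion (μ := μ)
    (fun r : Ioi (0 : ℝ) => hs.const_smul_of_ne_zero (ne_of_gt r.2)) disjoint
  obtain ⟨r, hr⟩ : ∃ r : Ioi (0 : ℝ), μ (r.1 • s) = 0 := by
    by_contra! pos
    rw [show {r : Ioi (0 : ℝ) | 0 < μ (r.1 • s)} = univ from
      eq_univ_of_forall fun r => pos_iff_ne_zero.2 (pos r), countable_univ_iff] at countable
    have card_le := Cardinal.mk_le_aleph0_iff.2 countable
    rw [Cardinal.mk_Ioi_real] at card_le
    exact card_le.not_gt Cardinal.aleph0_lt_continuum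
  rw [Measure.addHaar_smul, mul_eq_zero] at hr
  exact hr.resolve_left (by simp [(mem_Ioi.1 r.2).ne'])

lemma addHaar_hyperboloid_section_eq_zero {a : ℝ} (ha : a ≠ 0) (φ : E →ₗ[ℝ] ℝ) :
    μ {y | a * Real.sqrt (1 + ‖y‖ ^ 2) + φ y = 0} = 0 := by
  have φ_continuous : Continuous φ := φ.continuous_of_finiteDimensional
  refine addHaar_eq_zero_of_forall_smul_mem μ
    (isClosed_eq (by fun_prop) continuous_const).measurableSet fun y hy t ht hty => ?_
  have hy : a * Real.sqrt (1 + ‖y‖ ^ 2) + φ y = 0 := hy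
  have hty : a * Real.sqrt (1 + ‖t • y‖ ^ 2) + φ (t • y) = 0 := hty
  have sqrt_eq : Real.sqrt (1 + ‖t • y‖ ^ 2) = t * Real.sqrt (1 + ‖y‖ ^ 2) := by
    rw [map_smul, smul_eq_mul] at hty
    exact mul_left_cancel₀ ha (by linear_combination hty - t * hy)
  have sq_eq := congrArg (· ^ 2) sqrt_eq
  simp only [mul_pow] at sq_eq
  rw [Real.sq_sqrt (by positivity), Real.sq_sqrt (by positivity), norm_smul,
    Real.norm_of_nonneg ht.le] at sq_eq
  exact (sq_eq_sq₀ ht.le zero_le_one).1 (by linear_combination -sq_eq)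

end NullSets

-- Linear relations between points can be tested by pairing them with points, so a map which
-- preserves the form `B` on points also preserves linear relations between them.
lemma ConeModel.isSimplex_image {T : Type*} {IsSimplex : Set T → Prop} {vol : Set T → ENNReal}
    {ι V : Type*} [Fintype ι] [NormedAddCommGroup V] [NormedSpace ℝ V]
    (M : ConeModel T IsSimplex vol ι V) (B : LinearMap.BilinForm ℝ V)
    (hB : ∀ v, (∀ x, B v (M.emb x) = 0) → v = 0) (g : Equiv.Perm T)
    (hg : ∀ x y, B (M.emb (g x)) (M.emb (g y)) = B (M.emb x) (M.emb y))
    {s : Set T} (hs : IsSimplex s) : IsSimplex (g '' s) := by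
  obtain ⟨p, hp, rfl⟩ := (M.isSimplex_iff _).1 hs
  have relation_iff (c : ι → ℝ) (d : ℝ) (x : T) :
      ∑ i, c i • M.emb (p i) = d • M.emb x ↔ ∑ i, c i • M.emb (g (p i)) = d • M.emb (g x) := by
    have pairing (y : T) : B (∑ i, c i • M.emb (g (p i)) - d • M.emb (g x)) (M.emb (g y)) =
        B (∑ i, c i • M.emb (p i) - d • M.emb x) (M.emb y) := by
      simp [map_sub, map_sum, LinearMap.sum_apply, hg]
    rw [← sub_eq_zero, ← sub_eq_zero (b := d • M.emb (g x))]
    refine ⟨fun h => hB _ fun y => ?_, fun h => hB _ fun y => ?_⟩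
    · obtain ⟨y, rfl⟩ := g.surjective y
      rw [pairing, h, map_zero, LinearMap.zero_apply]
    · rw [← pairing, h, map_zero, LinearMap.zero_apply]
  refine (M.isSimplex_iff _).2 ⟨g ∘ p, ?_, ?_⟩
  · rw [Fintype.linearIndependent_iff] at hp ⊢
    refine fun c hc i => hp c ?_ i
    simpa using (relation_iff c 0 (p i)).2 (by simpa using hc)
  · ext y
    obtain ⟨x, rfl⟩ := g.surjective y
    rw [g.injective.mem_set_image, mem_preimage, mem_preimage, SetLike.mem_coe, SetLike.mem_coe,
      mem_coneSpan_iff, mem_coneSpan_iff]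
    refine exists_congr fun c => and_congr_right fun _ => ?_
    simpa only [Function.comp_apply, one_smul] using relation_iff c 1 x

section Euclidean

variable {n : ℕ}

lemma euclidean_isSimplex_iff (s : Set (EuclideanSpace ℝ (Fin n))) :
    (SpaceForm.euclidean n).IsSimplex s ↔ ∃ p : Fin (n + 1) → EuclideanSpace ℝ (Fin n),
      LinearIndependent ℝ (fun i => ((1 : ℝ), p i)) ∧
        s = (fun x => ((1 : ℝ), x)) ⁻¹' (coneSpan (fun i => ((1 : ℝ), p i)) : Set _) := by
  refine exists_congr fun p => and_congr linearIndependent_prod_one_iff.symm ?_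
  rw [show convexHull ℝ (range p) = _ from
    Set.ext fun x => mem_convexHull_range_iff_prod_one_mem_coneSpan]
  rfl

/-- Euclidean space as the affine hyperplane at height `1`. -/
noncomputable def euclideanModel (n : ℕ) :
    ConeModel (SpaceForm.euclidean n).Pt (SpaceForm.euclidean n).IsSimplex
      (SpaceForm.euclidean n).vol (Fin (n + 1)) (ℝ × EuclideanSpace ℝ (Fin n)) where
  card_eq_finrank := by simp [add_comm]
  emb x := (1, x)
  emb_ne_zero x h := one_ne_zero (congrArg Prod.fst h)
  add_mem r s hr hs x y _ := by
    refine ⟨r + s, add_pos hr hs, (r + s)⁻¹ • (r • x + s • y), ?_⟩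
    ext1
    · simp
    · exact smul_inv_smul₀ (add_pos hr hs).ne' _
  isSimplex_iff := euclidean_isSimplex_iff
  vol_empty := measure_empty
  vol_mono h h0 := measure_mono_null h h0
  vol_union h h' := measure_union_null h h'
  vol_hyperplane _ hf := addHaar_eq_zero_of_map_prod_one_eq_zero volume hf
  vol_open _ hO nonempty := (hO.preimage (Continuous.prodMk_right 1)).measure_ne_zero _ nonempty

lemma euclidean_isSimplex_image {g : Equiv.Perm (SpaceForm.euclidean n).Pt}
    (hg : g ∈ (SpaceForm.euclidean n).isometryGroup) {s : Set (SpaceForm.euclidean n).Pt}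
    (hs : (SpaceForm.euclidean n).IsSimplex s) : (SpaceForm.euclidean n).IsSimplex (g '' s) := by
  obtain ⟨p, hp, rfl⟩ := hs
  let φ : EuclideanSpace ℝ (Fin n) ≃ᵢ EuclideanSpace ℝ (Fin n) := ⟨g, Isometry.of_dist_eq hg⟩
  let ψ := φ.toRealAffineIsometryEquiv.toAffineEquiv.toAffineMap
  have hψ : ⇑ψ = g := φ.coeFn_toRealAffineIsometryEquiv
  refine ⟨g ∘ p, ?_, ?_⟩
  · rw [← hψ]
    exact hp.map' ψ φ.toRealAffineIsometryEquiv.injective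
  · rw [range_comp, ← hψ, ← AffineMap.image_convexHull]

end Euclidean

section Spherical

variable {n : ℕ}

lemma exists_inner_pos_of_linearIndependent {p : Fin (n + 1) → EuclideanSpace ℝ (Fin (n + 1))}
    (hp : LinearIndependent ℝ p) :
    ∃ u : EuclideanSpace ℝ (Fin (n + 1)), ∀ i, 0 < inner ℝ u (p i) := by
  let b := basisOfLinearIndependentOfCardEqFinrank hp (by simp)
  let f : EuclideanSpace ℝ (Fin (n + 1)) →ₗ[ℝ] ℝ := b.constr ℝ fun _ => (1 : ℝ)
  refine ⟨(InnerProductSpace.toDual ℝ _).symm (LinearMap.toContinuousLinearMap f), fun i => ?_⟩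
  have f_apply : f (b i) = 1 := b.constr_basis ℝ _ i
  rw [InnerProductSpace.toDual_symm_apply, LinearMap.coe_toContinuousLinearMap',
    ← coe_basisOfLinearIndependentOfCardEqFinrank hp (by simp), f_apply]
  exact one_pos

lemma spherical_isSimplex_iff (s : Set (Metric.sphere (0 : EuclideanSpace ℝ (Fin (n + 1))) 1)) :
    (SpaceForm.spherical n).IsSimplex s ↔
      ∃ p : Fin (n + 1) → Metric.sphere (0 : EuclideanSpace ℝ (Fin (n + 1))) 1,
        LinearIndependent ℝ (Subtype.val ∘ p) ∧
          s = Subtype.val ⁻¹' (coneSpan (Subtype.val ∘ p) : Set _) := by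
  refine exists_congr fun p => ?_
  rw [show {x : Metric.sphere (0 : EuclideanSpace ℝ (Fin (n + 1))) 1 |
    ∃ r : ℝ, 0 < r ∧ r • x.1 ∈ convexHull ℝ (range fun i => (p i).1)} = _ from
    Set.ext fun x => exists_smul_mem_convexHull_iff (ne_zero_of_mem_unit_sphere x)]
  exact ⟨fun h => h.2, fun h => ⟨exists_inner_pos_of_linearIndependent h.1, h⟩⟩

lemma toSphere_eq_zero_of_map_eq_zero {f : EuclideanSpace ℝ (Fin (n + 1)) →ₗ[ℝ] ℝ} (hf : f ≠ 0) :
    (volume : Measure (EuclideanSpace ℝ (Fin (n + 1)))).toSphere {x | f x.1 = 0} = 0 := by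
  have f_continuous : Continuous f := f.continuous_of_finiteDimensional
  have measurable : MeasurableSet
      {x : Metric.sphere (0 : EuclideanSpace ℝ (Fin (n + 1))) 1 | f x.1 = 0} :=
    (isClosed_eq (f_continuous.comp continuous_subtype_val) continuous_const).measurableSet
  rw [Measure.toSphere_apply' _ measurable]
  refine mul_eq_zero_of_right _ (measure_mono_null ?_ (addHaar_eq_zero_of_map_eq_zero volume hf))
  rintro _ ⟨r, -, _, ⟨x, hx, rfl⟩, rfl⟩
  change f (r • x.1) = 0
  rw [map_smul, show f x.1 = 0 from hx, smul_zero]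

/-- The unit sphere in the ambient vector space. -/
noncomputable def sphericalModel (n : ℕ) :
    ConeModel (SpaceForm.spherical n).Pt (SpaceForm.spherical n).IsSimplex
      (SpaceForm.spherical n).vol (Fin (n + 1)) (EuclideanSpace ℝ (Fin (n + 1))) where
  card_eq_finrank := by simp
  emb := Subtype.val
  emb_ne_zero := ne_zero_of_mem_unit_sphere
  add_mem r s _ _ x y h := by
    refine ⟨‖r • x.1 + s • y.1‖, norm_pos_iff.2 h, ⟨‖r • x.1 + s • y.1‖⁻¹ • (r • x.1 + s • y.1),
      ?_⟩, smul_inv_smul₀ (norm_ne_zero_iff.2 h) _⟩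
    exact mem_sphere_zero_iff_norm.2 (norm_smul_inv_norm (𝕜 := ℝ) h)
  isSimplex_iff := spherical_isSimplex_iff
  vol_empty := measure_empty
  vol_mono h h0 := measure_mono_null h h0
  vol_union h h' := measure_union_null h h'
  vol_hyperplane _ hf := toSphere_eq_zero_of_map_eq_zero hf
  vol_open _ hO nonempty := (hO.preimage continuous_subtype_val).measure_ne_zero _ nonempty

lemma spherical_isSimplex_image {g : Equiv.Perm (SpaceForm.spherical n).Pt}
    (hg : g ∈ (SpaceForm.spherical n).isometryGroup) {s : Set (SpaceForm.spherical n).Pt}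
    (hs : (SpaceForm.spherical n).IsSimplex s) : (SpaceForm.spherical n).IsSimplex (g '' s) := by
  refine (sphericalModel n).isSimplex_image (innerₗ _) (fun v hv => ?_) g (fun x y => ?_) hs
  · by_contra v_ne_zero
    have orthogonal : inner ℝ v (‖v‖⁻¹ • v) = 0 :=
      hv ⟨‖v‖⁻¹ • v, mem_sphere_zero_iff_norm.2 (norm_smul_inv_norm (𝕜 := ℝ) v_ne_zero)⟩
    rw [inner_smul_right, real_inner_self_eq_norm_sq] at orthogonal
    simp [v_ne_zero] at orthogonal
  · have norm_eq_one (z : Metric.sphere (0 : EuclideanSpace ℝ (Fin (n + 1))) 1) : ‖z.1‖ = 1 :=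
      norm_eq_of_mem_sphere z
    have cos_eq := congrArg Real.cos (show InnerProductGeometry.angle (g x).1 (g y).1 =
      InnerProductGeometry.angle x.1 y.1 from hg x y)
    change inner ℝ (g x).1 (g y).1 = inner ℝ x.1 y.1
    simpa only [InnerProductGeometry.cos_angle, norm_eq_one, mul_one, div_one] using cos_eq

end Spherical

section Hyperbolic

variable {n : ℕ}

/-- The Lorentz form as a bilinear form. -/
noncomputable def lorentzForm (n : ℕ) : LinearMap.BilinForm ℝ (ℝ × EuclideanSpace ℝ (Fin n)) :=
  LinearMap.mk₂ ℝ lorentz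
    (fun x x' y => by
      simp only [lorentz, Prod.fst_add, Prod.snd_add, inner_add_left]
      ring)
    (fun c x y => by
      simp only [lorentz, Prod.smul_fst, Prod.smul_snd, real_inner_smul_left, smul_eq_mul]
      ring)
    (fun x y y' => by
      simp only [lorentz, Prod.fst_add, Prod.snd_add, inner_add_right]
      ring)
    (fun c x y => by
      simp only [lorentz, Prod.smul_fst, Prod.smul_snd, inner_smul_right, smul_eq_mul]
      ring)

lemma lorentz_comm (x y : ℝ × EuclideanSpace ℝ (Fin n)) : lorentz x y = lorentz y x := by
  rw [lorentz, lorentz, real_inner_comm, mul_comm]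

lemma lorentz_smul_self (r : ℝ) (x : ℝ × EuclideanSpace ℝ (Fin n)) :
    lorentz (r • x) (r • x) = r ^ 2 * lorentz x x := by
  change lorentzForm n (r • x) (r • x) = r ^ 2 * lorentzForm n x x
  rw [map_smul, map_smul, LinearMap.smul_apply, smul_eq_mul, smul_eq_mul]
  ring

lemma lorentz_smul_add_smul_self (r s : ℝ) (x y : ℝ × EuclideanSpace ℝ (Fin n)) :
    lorentz (r • x + s • y) (r • x + s • y) =
      r ^ 2 * lorentz x x + 2 * r * s * lorentz x y + s ^ 2 * lorentz y y := by
  have symm : lorentzForm n y x = lorentzForm n x y := lorentz_comm y x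
  change lorentzForm n (r • x + s • y) (r • x + s • y) = r ^ 2 * lorentzForm n x x +
    2 * r * s * lorentzForm n x y + s ^ 2 * lorentzForm n y y
  simp only [map_add, map_smul, LinearMap.add_apply, LinearMap.smul_apply, smul_eq_mul, symm]
  ring

namespace Hyperboloid

lemma ne_zero (x : Hyperboloid n) : x.1 ≠ 0 := fun h => x.2.2.ne' (congrArg Prod.fst h)

lemma sq_fst (x : Hyperboloid n) : x.1.1 ^ 2 = 1 + ‖x.1.2‖ ^ 2 := by
  have hx := x.2.1
  simp only [lorentz, real_inner_self_eq_norm_sq] at hx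
  linear_combination hx

lemma one_le_lorentz (x y : Hyperboloid n) : 1 ≤ lorentz x.1 y.1 := by
  have cauchy_schwarz := real_inner_le_norm x.1.2 y.1.2
  have norm_mul_le : 1 + ‖x.1.2‖ * ‖y.1.2‖ ≤ x.1.1 * y.1.1 := by
    refine (abs_le_of_sq_le_sq' ?_ (mul_pos x.2.2 y.2.2).le).2
    rw [mul_pow, x.sq_fst, y.sq_fst]
    nlinarith [sq_nonneg (‖x.1.2‖ - ‖y.1.2‖)]
  rw [lorentz]
  linarith

/-- The parametrization of the hyperboloid by the coordinate in which its volume is given. -/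
noncomputable def ofCoord (y : EuclideanSpace ℝ (Fin n)) : Hyperboloid n :=
  ⟨(Real.sqrt (1 + ‖y‖ ^ 2), y), by
    rw [lorentz, real_inner_self_eq_norm_sq, Real.mul_self_sqrt (by positivity)]
    ring, Real.sqrt_pos.2 (by positivity)⟩

lemma ofCoord_snd (x : Hyperboloid n) : ofCoord x.1.2 = x := by
  refine Subtype.ext (Prod.ext ?_ rfl)
  change Real.sqrt (1 + ‖x.1.2‖ ^ 2) = x.1.1
  rw [← x.sq_fst, Real.sqrt_sq x.2.2.le]

lemma continuous_ofCoord :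
    Continuous fun y : EuclideanSpace ℝ (Fin n) => (ofCoord y).1 := by
  change Continuous fun y : EuclideanSpace ℝ (Fin n) => (Real.sqrt (1 + ‖y‖ ^ 2), y)
  fun_prop

lemma image_snd_preimage (O : Set (ℝ × EuclideanSpace ℝ (Fin n))) :
    (fun x : Hyperboloid n => x.1.2) '' (Subtype.val ⁻¹' O) = (fun y => (ofCoord y).1) ⁻¹' O := by
  ext y
  refine ⟨?_, fun hy => ⟨ofCoord y, hy, rfl⟩⟩
  rintro ⟨x, hx, rfl⟩
  rwa [mem_preimage, ofCoord_snd]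

end Hyperboloid

lemma eq_zero_of_forall_lorentz_eq_zero {v : ℝ × EuclideanSpace ℝ (Fin n)}
    (hv : ∀ x : Hyperboloid n, lorentz v x.1 = 0) : v = 0 := by
  have h1 : v.1 = 0 := by simpa [lorentz, Hyperboloid.ofCoord] using hv (Hyperboloid.ofCoord 0)
  have h2 : v.2 = 0 := by
    simpa [lorentz, Hyperboloid.ofCoord, h1] using hv (Hyperboloid.ofCoord v.2)
  exact Prod.ext h1 h2

lemma hyperbolic_vol_eq_zero_iff (s : Set (Hyperboloid n)) :
    (SpaceForm.hyperbolic n).vol s = 0 ↔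
      volume ((fun x : Hyperboloid n => x.1.2) '' s) = 0 := by
  have support_density : Function.support (fun y : EuclideanSpace ℝ (Fin n) =>
      ENNReal.ofReal (1 / Real.sqrt (1 + ‖y‖ ^ 2))) = univ := by
    refine eq_univ_of_forall fun y => ?_
    have : 0 < 1 / Real.sqrt (1 + ‖y‖ ^ 2) := by positivity
    simpa using this
  have pos_iff := setLIntegral_pos_iff (μ := volume) (f := fun y : EuclideanSpace ℝ (Fin n) =>
      ENNReal.ofReal (1 / Real.sqrt (1 + ‖y‖ ^ 2))) (by fun_prop)
      (s := (fun x : Hyperboloid n => x.1.2) '' s)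
  rw [support_density, univ_inter] at pos_iff
  rw [pos_iff_ne_zero, pos_iff_ne_zero] at pos_iff
  exact not_iff_not.1 pos_iff

lemma hyperbolic_isSimplex_iff (s : Set (Hyperboloid n)) :
    (SpaceForm.hyperbolic n).IsSimplex s ↔ ∃ p : Fin (n + 1) → Hyperboloid n,
      LinearIndependent ℝ (Subtype.val ∘ p) ∧
        s = Subtype.val ⁻¹' (coneSpan (Subtype.val ∘ p) : Set _) := by
  refine exists_congr fun p => ?_
  have preimage_cone : {x : Hyperboloid n | ∃ r : ℝ, 0 < r ∧
      r • x.1 ∈ convexHull ℝ (range fun i => (p i).1)} = _ :=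
    Set.ext fun x => exists_smul_mem_convexHull_iff x.ne_zero
  rw [preimage_cone]
  rfl

lemma hyperbolic_vol_eq_zero_of_map_eq_zero {f : ℝ × EuclideanSpace ℝ (Fin n) →ₗ[ℝ] ℝ}
    (hf : f ≠ 0) : (SpaceForm.hyperbolic n).vol {x : Hyperboloid n | f x.1 = 0} = 0 := by
  rw [hyperbolic_vol_eq_zero_iff]
  refine (congrArg volume (Hyperboloid.image_snd_preimage {v | f v = 0})).trans ?_
  set φ := f.comp (LinearMap.inr ℝ ℝ (EuclideanSpace ℝ (Fin n)))
  have section_eq : (fun y => (Hyperboloid.ofCoord y).1) ⁻¹' {v | f v = 0} =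
      {y : EuclideanSpace ℝ (Fin n) | f (1, 0) * Real.sqrt (1 + ‖y‖ ^ 2) + φ y = 0} := by
    ext y
    rw [mem_preimage, mem_ofPred_eq, map_prod_eq]
    rfl
  rw [section_eq]
  by_cases h : f (1, 0) = 0
  · have φ_ne_zero : φ ≠ 0 := fun h0 => hf (LinearMap.ext fun v => by
      rw [map_prod_eq, h, show f (0, v.2) = 0 from LinearMap.congr_fun h0 v.2]
      simp)
    simpa [h] using addHaar_eq_zero_of_map_eq_zero volume φ_ne_zero
  · exact addHaar_hyperboloid_section_eq_zero volume h φ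

lemma hyperbolic_vol_open {O : Set (ℝ × EuclideanSpace ℝ (Fin n))} (hO : IsOpen O)
    (nonempty : (Subtype.val ⁻¹' O : Set (Hyperboloid n)).Nonempty) :
    (SpaceForm.hyperbolic n).vol (Subtype.val ⁻¹' O : Set (Hyperboloid n)) ≠ 0 := by
  rw [Ne, hyperbolic_vol_eq_zero_iff, Hyperboloid.image_snd_preimage]
  obtain ⟨x, hx⟩ := nonempty
  refine (hO.preimage Hyperboloid.continuous_ofCoord).measure_ne_zero _ ⟨x.1.2, ?_⟩
  rwa [mem_preimage, Hyperboloid.ofCoord_snd]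

lemma Hyperboloid.exists_smul_eq_add {r s : ℝ} (hr : 0 < r) (hs : 0 < s) (x y : Hyperboloid n) :
    ∃ t : ℝ, 0 < t ∧ ∃ z : Hyperboloid n, t • z.1 = r • x.1 + s • y.1 := by
  set v := r • x.1 + s • y.1
  have timelike : 0 < lorentz v v := by
    have := one_le_lorentz x y
    rw [lorentz_smul_add_smul_self, x.2.1, y.2.1]
    positivity
  have future : 0 < v.1 := add_pos (mul_pos hr x.2.2) (mul_pos hs y.2.2)
  have sqrt_pos := Real.sqrt_pos.2 timelike
  refine ⟨Real.sqrt (lorentz v v), sqrt_pos, ⟨(Real.sqrt (lorentz v v))⁻¹ • v, ?_,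
    mul_pos (inv_pos.2 sqrt_pos) future⟩, smul_inv_smul₀ sqrt_pos.ne' v⟩
  rw [lorentz_smul_self, inv_pow, Real.sq_sqrt timelike.le, inv_mul_cancel₀ timelike.ne']

/-- The hyperboloid in the ambient vector space. -/
noncomputable def hyperbolicModel (n : ℕ) :
    ConeModel (SpaceForm.hyperbolic n).Pt (SpaceForm.hyperbolic n).IsSimplex
      (SpaceForm.hyperbolic n).vol (Fin (n + 1)) (ℝ × EuclideanSpace ℝ (Fin n)) where
  card_eq_finrank := by simp [add_comm]
  emb := Subtype.val
  emb_ne_zero := Hyperboloid.ne_zero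
  add_mem _ _ hr hs x y _ := Hyperboloid.exists_smul_eq_add hr hs x y
  isSimplex_iff := hyperbolic_isSimplex_iff
  vol_empty := by rw [hyperbolic_vol_eq_zero_iff, image_empty, measure_empty]
  vol_mono h h0 := by
    rw [hyperbolic_vol_eq_zero_iff] at h0 ⊢
    exact measure_mono_null (image_mono h) h0
  vol_union h h' := by
    rw [hyperbolic_vol_eq_zero_iff] at h h' ⊢
    rw [image_union]
    exact measure_union_null h h'
  vol_hyperplane _ hf := hyperbolic_vol_eq_zero_of_map_eq_zero hf
  vol_open _ hO nonempty := hyperbolic_vol_open hO nonempty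

lemma hyperbolic_isSimplex_image {g : Equiv.Perm (SpaceForm.hyperbolic n).Pt}
    (hg : g ∈ (SpaceForm.hyperbolic n).isometryGroup) {s : Set (SpaceForm.hyperbolic n).Pt}
    (hs : (SpaceForm.hyperbolic n).IsSimplex s) : (SpaceForm.hyperbolic n).IsSimplex (g '' s) := by
  refine (hyperbolicModel n).isSimplex_image (lorentzForm n)
    (fun v hv => eq_zero_of_forall_lorentz_eq_zero hv) g (fun x y => ?_) hs
  have distance_eq : Real.arcosh (lorentz (g x).1 (g y).1) = Real.arcosh (lorentz x.1 y.1) :=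
    hg x y
  exact Real.arcosh_injOn (Hyperboloid.one_le_lorentz _ _) (Hyperboloid.one_le_lorentz _ _)
    distance_eq

end Hyperbolic

namespace SpaceForm

lemma IsSimplex.image {X : SpaceForm} {g : Equiv.Perm X.Pt} (hg : g ∈ X.isometryGroup)
    {s : Set X.Pt} (hs : X.IsSimplex s) : X.IsSimplex (g '' s) := by
  cases X with
  | euclidean n => exact euclidean_isSimplex_image hg hs
  | spherical n => exact spherical_isSimplex_image hg hs
  | hyperbolic n => exact hyperbolic_isSimplex_image hg hs

lemma exists_coneModel (X : SpaceForm) : ∃ (n : ℕ) (V : Type) (_ : NormedAddCommGroup V)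
    (_ : NormedSpace ℝ V) (_ : FiniteDimensional ℝ V),
    Nonempty (ConeModel X.Pt X.IsSimplex X.vol (Fin n) V) := by
  cases X with
  | euclidean n => exact ⟨_, _, _, _, inferInstance, ⟨euclideanModel n⟩⟩
  | spherical n => exact ⟨_, _, _, _, inferInstance, ⟨sphericalModel n⟩⟩
  | hyperbolic n => exact ⟨_, _, _, _, inferInstance, ⟨hyperbolicModel n⟩⟩

end SpaceForm

end ScissorsCongruence

namespace ScissorsCongruence

namespace SpaceForm

open Set

section Unions

variable {X : SpaceForm} {s t : Set X.Pt}

lemma vol_empty : X.vol ∅ = 0 := by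
  obtain ⟨n, V, _, _, _, ⟨M⟩⟩ := X.exists_coneModel
  exact M.vol_empty

lemma vol_mono_null (h : s ⊆ t) (h0 : X.vol t = 0) : X.vol s = 0 := by
  obtain ⟨n, V, _, _, _, ⟨M⟩⟩ := X.exists_coneModel
  exact M.vol_mono h h0

lemma vol_union_null (hs : X.vol s = 0) (ht : X.vol t = 0) : X.vol (s ∪ t) = 0 := by
  obtain ⟨n, V, _, _, _, ⟨M⟩⟩ := X.exists_coneModel
  exact M.vol_union hs ht

lemma vol_biUnion_null {ι : Type*} {F : Set ι} (hF : F.Finite) {f : ι → Set X.Pt}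
    (h : ∀ i ∈ F, X.vol (f i) = 0) : X.vol (⋃ i ∈ F, f i) = 0 := by
  induction F, hF using Set.Finite.induction_on with
  | empty => simpa using vol_empty
  | insert _ _ ih =>
    rw [biUnion_insert]
    exact vol_union_null (h _ (mem_insert _ _)) (ih fun i hi => h i (mem_insert_of_mem _ hi))

lemma isSimplexUnion_empty : X.IsSimplexUnion ∅ :=
  ⟨∅, finite_empty, fun _ => False.elim, sUnion_empty.symm⟩

namespace IsSimplexUnion

lemma union (hs : X.IsSimplexUnion s) (ht : X.IsSimplexUnion t) : X.IsSimplexUnion (s ∪ t) := by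
  obtain ⟨F, hF, hF_simplex, rfl⟩ := hs
  obtain ⟨F', hF', hF'_simplex, rfl⟩ := ht
  exact ⟨F ∪ F', hF.union hF', fun r hr => hr.elim (hF_simplex r) (hF'_simplex r),
    (sUnion_union _ _).symm⟩

lemma image {g : Equiv.Perm X.Pt} (hg : g ∈ X.isometryGroup) (hs : X.IsSimplexUnion s) :
    X.IsSimplexUnion (g '' s) := by
  obtain ⟨F, hF, hF_simplex, rfl⟩ := hs
  refine ⟨(fun r => g '' r) '' F, hF.image _, ?_, by rw [image_sUnion]⟩
  rintro _ ⟨r, hr, rfl⟩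
  exact (hF_simplex r hr).image hg

lemma subset_of_vol_diff_eq_zero (hs : X.IsSimplexUnion s) (ht : X.IsSimplexUnion t)
    (h : X.vol (s \ t) = 0) : s ⊆ t := by
  obtain ⟨n, V, _, _, _, ⟨M⟩⟩ := X.exists_coneModel
  obtain ⟨F, -, hF_simplex, rfl⟩ := hs
  obtain ⟨F', hF', hF'_simplex, rfl⟩ := ht
  exact sUnion_subset fun r hr =>
    M.subset_sUnion_of_vol_diff_eq_zero (hF_simplex r hr) hF' hF'_simplex
      (vol_mono_null (sdiff_subset_sdiff_left (subset_sUnion_of_mem hr)) h)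

lemma exists_subdivision (hs : X.IsSimplexUnion s) {T : Set (Set X.Pt)} (hT : T.Finite)
    (hT_simplex : ∀ t ∈ T, X.IsSimplex t) :
    ∃ F : Set (Set X.Pt), F.Finite ∧ (∀ r ∈ F, X.IsSimplex r) ∧ s = ⋃₀ F ∧
      ∀ r ∈ F, ∀ t ∈ T, r ⊆ t ∨ X.vol (r ∩ t) = 0 := by
  obtain ⟨n, V, _, _, _, ⟨M⟩⟩ := X.exists_coneModel
  induction T, hT using Set.Finite.induction_on with
  | empty =>
    obtain ⟨F, hF, hF_simplex, hs⟩ := hs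
    exact ⟨F, hF, hF_simplex, hs, fun _ _ _ => False.elim⟩
  | @insert t T _ _ ih =>
    obtain ⟨F, hF, hF_simplex, rfl, hF_sub⟩ := ih fun t ht => hT_simplex t (mem_insert_of_mem _ ht)
    choose D hD hD_simplex hD_union using fun r : F =>
      M.exists_subdivision (hF_simplex r r.2) (hT_simplex t (mem_insert _ _))
    have := hF.to_subtype
    refine ⟨⋃ r : F, D r, finite_iUnion hD, fun q hq => ?_, ?_, fun q hq t' ht' => ?_⟩
    · obtain ⟨r, hr⟩ := mem_iUnion.1 hq
      exact (hD_simplex r q hr).1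
    · rw [sUnion_iUnion, sUnion_eq_iUnion]
      exact iUnion_congr hD_union
    · obtain ⟨r, hr⟩ := mem_iUnion.1 hq
      have hqr : q ⊆ r := (subset_sUnion_of_mem hr).trans (hD_union r).ge
      rcases ht' with rfl | ht'
      · exact (hD_simplex r q hr).2
      · exact (hF_sub r r.2 t' ht').imp hqr.trans
          (vol_mono_null (inter_subset_inter_left _ hqr))

lemma exists_regularized_inter (hs : X.IsSimplexUnion s) (ht : X.IsSimplexUnion t) :
    ∃ m, X.IsSimplexUnion m ∧ m ⊆ s ∩ t ∧ X.vol ((s ∩ t) \ m) = 0 := by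
  obtain ⟨T, hT, hT_simplex, rfl⟩ := ht
  obtain ⟨F, hF, hF_simplex, rfl, hF_sub⟩ := hs.exists_subdivision hT hT_simplex
  refine ⟨⋃₀ {r ∈ F | r ⊆ ⋃₀ T},
    ⟨_, hF.subset (sep_subset _ _), fun r hr => hF_simplex r hr.1, rfl⟩,
    sUnion_subset fun r hr => subset_inter (subset_sUnion_of_mem hr.1) hr.2, ?_⟩
  refine vol_mono_null (t := ⋃ r ∈ {r ∈ F | ¬ r ⊆ ⋃₀ T}, ⋃ t ∈ T, r ∩ t) ?_ ?_
  · rintro x ⟨⟨⟨r, hr, hxr⟩, t, ht, hxt⟩, hx⟩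
    have hrT : ¬ r ⊆ ⋃₀ T := fun h => hx ⟨r, ⟨hr, h⟩, hxr⟩
    exact mem_biUnion (show r ∈ {r ∈ F | ¬ r ⊆ ⋃₀ T} from ⟨hr, hrT⟩)
      (mem_biUnion ht ⟨hxr, hxt⟩)
  · refine vol_biUnion_null (hF.subset (sep_subset _ _)) fun r hr =>
      vol_biUnion_null hT fun t ht => ?_
    exact (hF_sub r hr.1 t ht).resolve_left fun h => hr.2 (h.trans (subset_sUnion_of_mem ht))

end IsSimplexUnion

end Unions

namespace Obj

variable {X : SpaceForm} {G : Subgroup (Equiv.Perm X.Pt)} {P Q : X.Obj G}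

lemma le_of_vol_diff_eq_zero (h : X.vol (P.carrier \ Q.carrier) = 0) : P ≤ Q :=
  P.isSimplexUnion.subset_of_vol_diff_eq_zero Q.isSimplexUnion h

/-- The regularized intersection of two polytopes: the largest finite union of simplices contained
in both. It differs from the intersection by a null set. -/
noncomputable def meet (P Q : X.Obj G) : X.Obj G :=
  ⟨_, (P.isSimplexUnion.exists_regularized_inter Q.isSimplexUnion).choose_spec.1⟩

lemma meet_subset (P Q : X.Obj G) : (P.meet Q).carrier ⊆ P.carrier ∩ Q.carrier :=
  (P.isSimplexUnion.exists_regularized_inter Q.isSimplexUnion).choose_spec.2.1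

lemma vol_inter_diff_meet (P Q : X.Obj G) :
    X.vol ((P.carrier ∩ Q.carrier) \ (P.meet Q).carrier) = 0 :=
  (P.isSimplexUnion.exists_regularized_inter Q.isSimplexUnion).choose_spec.2.2

noncomputable instance : Lattice (X.Obj G) :=
  { (inferInstance : PartialOrder (X.Obj G)) with
    sup := fun P Q => ⟨P.carrier ∪ Q.carrier, P.isSimplexUnion.union Q.isSimplexUnion⟩
    inf := meet
    le_sup_left := fun _ _ => subset_union_left
    le_sup_right := fun _ _ => subset_union_right
    sup_le := fun _ _ _ => union_subset
    inf_le_left := fun P Q => (P.meet_subset Q).trans inter_subset_left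
    inf_le_right := fun P Q => (P.meet_subset Q).trans inter_subset_right
    le_inf := fun _ Q R h h' => le_of_vol_diff_eq_zero
      (vol_mono_null (sdiff_subset_sdiff_left (subset_inter h h')) (Q.vol_inter_diff_meet R)) }

lemma sup_carrier (P Q : X.Obj G) : (P ⊔ Q).carrier = P.carrier ∪ Q.carrier := rfl

noncomputable instance : DistribLattice (X.Obj G) :=
  { (inferInstance : Lattice (X.Obj G)) with
    le_sup_inf := fun P Q R => le_of_vol_diff_eq_zero <| vol_mono_null
      (t := (Q.carrier ∩ R.carrier) \ (Q.meet R).carrier) (by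
        rintro x ⟨hx, hx'⟩
        have h := meet_subset _ _ hx
        simp only [sup_carrier, mem_union, mem_inter_iff, not_or] at h hx'
        exact ⟨⟨h.1.resolve_left hx'.1, h.2.resolve_left hx'.1⟩, hx'.2⟩)
      (Q.vol_inter_diff_meet R) }

instance : OrderBot (X.Obj G) where
  bot := ⟨∅, isSimplexUnion_empty⟩
  bot_le _ := empty_subset _

lemma bot_carrier : (⊥ : X.Obj G).carrier = ∅ := rfl

lemma ne_bot_iff : P ≠ ⊥ ↔ P.carrier.Nonempty := by
  rw [nonempty_iff_ne_empty, Ne, Ne, Obj.ext_iff, bot_carrier]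

lemma disjoint_iff_vol_inter : Disjoint P Q ↔ X.vol (P.carrier ∩ Q.carrier) = 0 := by
  rw [disjoint_iff]
  constructor
  · intro h
    have hdiff := P.vol_inter_diff_meet Q
    rwa [show P.meet Q = ⊥ from h, bot_carrier, sdiff_empty] at hdiff
  · intro h
    exact le_bot_iff.1
      (le_of_vol_diff_eq_zero (vol_mono_null (sdiff_subset.trans (P.meet_subset Q)) h))

lemma finset_sup_carrier {ι : Type*} (t : Finset ι) (U : ι → X.Obj G) :
    (t.sup U).carrier = ⋃ i ∈ t, (U i).carrier := by
  classical
  induction t using Finset.induction_on with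
  | empty => simp [bot_carrier]
  | insert a t _ ih => rw [Finset.sup_insert, sup_carrier, ih, Finset.set_biUnion_insert]

section Action

variable [hG : Fact (G ≤ X.isometryGroup)]

instance : MulAction G (X.Obj G) where
  smul g P := ⟨g.1 '' P.carrier, P.isSimplexUnion.image (hG.out g.2)⟩
  one_smul _ := Obj.ext (image_id _)
  mul_smul g k P := Obj.ext (image_comp g.1 k.1 P.carrier)

instance : CovariantClass G (X.Obj G) (· • ·) (· ≤ ·) := ⟨fun _ _ _ h => image_mono h⟩

end Action

end Obj

end SpaceForm

section ActionOnLattice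

variable {G L : Type*} [Group G]

section Order

variable [PartialOrder L] [MulAction G L] [CovariantClass G L (· • ·) (· ≤ ·)] {g : G} {P Q : L}

/-- Translation by `g`, as an automorphism of the partially ordered set `L`. -/
def smulOrderIso (g : G) : L ≃o L :=
  (MulAction.toPerm g).toOrderIso (smul_mono_right g) (smul_mono_right g⁻¹)

lemma smul_le_smul_iff_of_action : g • P ≤ g • Q ↔ P ≤ Q := (smulOrderIso g).le_iff_le

lemma inv_smul_le_iff_of_action : g⁻¹ • P ≤ Q ↔ P ≤ g • Q := (smulOrderIso g).symm_apply_le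

lemma smul_eq_bot_iff_of_action [OrderBot L] : g • P = ⊥ ↔ P = ⊥ := map_eq_bot_iff (smulOrderIso g)

end Order

variable [MulAction G L]

lemma disjoint_smul_iff_of_action [SemilatticeInf L] [OrderBot L]
    [CovariantClass G L (· • ·) (· ≤ ·)] {g : G} {P Q : L} :
    Disjoint (g • P) (g • Q) ↔ Disjoint P Q :=
  disjoint_map_orderIso_iff (smulOrderIso g)

lemma smul_finset_sup_of_action [SemilatticeSup L] [OrderBot L]
    [CovariantClass G L (· • ·) (· ≤ ·)] {ι : Type*} (g : G) (t : Finset ι) (U : ι → L) :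
    g • t.sup U = t.sup fun i => g • U i :=
  map_finset_sup (smulOrderIso g) t U

end ActionOnLattice

section FiniteCoverTopology

variable {L : Type u} [DistribLattice L] [OrderBot L] {P : L}

lemma nonempty_isInitial_iff : Nonempty (IsInitial P) ↔ P = ⊥ :=
  ⟨fun ⟨h⟩ => le_bot_iff.1 (leOfHom (h.to ⊥)), fun h => ⟨h ▸ isInitialBot⟩⟩

lemma isPolytope_iff_ne_bot : IsPolytope P ↔ P ≠ ⊥ := by
  rw [IsPolytope, ← not_nonempty_iff, nonempty_isInitial_iff]

variable (L) in
/-- The topology on a distributive lattice in which a sieve is covering if finitely many of its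
members have the whole object as supremum. -/
def finiteCoverTopology : GrothendieckTopology L where
  sieves P := {S | ∃ t : Finset L, (∀ Y ∈ t, ∃ f : Y ⟶ P, S f) ∧ t.sup id = P}
  top_mem' P := ⟨{P}, fun Y hY => by
    obtain rfl := Finset.mem_singleton.1 hY
    exact ⟨𝟙 Y, trivial⟩, Finset.sup_singleton⟩
  pullback_stable' P Q S f := by
    classical
    rintro ⟨t, ht, hsup⟩
    refine ⟨t.image (Q ⊓ ·), fun Y hY => ?_, ?_⟩
    · obtain ⟨Z, hZ, rfl⟩ := Finset.mem_image.1 hY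
      obtain ⟨g, hg⟩ := ht Z hZ
      refine ⟨homOfLE inf_le_left, ?_⟩
      rw [Sieve.pullback_apply, Subsingleton.elim (_ ≫ f) ((homOfLE inf_le_right : Q ⊓ Z ⟶ Z) ≫ g)]
      exact S.downward_closed hg _
    · calc (t.image (Q ⊓ ·)).sup id = t.sup fun Z => Q ⊓ id Z := Finset.sup_image _ _ _
        _ = Q ⊓ t.sup id := (Finset.sup_inf_distrib_left _ _ _).symm
        _ = Q := by rw [hsup, inf_eq_left.2 (leOfHom f)]
  transitive' P S hS R hR := by
    classical
    obtain ⟨t, ht, hsup⟩ := hS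
    have hfine : ∀ Y : t, ∃ s : Finset L, (∀ Z ∈ s, ∃ f : Z ⟶ P, R f) ∧ s.sup id = Y.1 := by
      rintro ⟨Y, hY⟩
      obtain ⟨f, hf⟩ := ht Y hY
      obtain ⟨s, hs, hsup⟩ := hR hf
      exact ⟨s, fun Z hZ => (hs Z hZ).imp' (· ≫ f) fun g hg => hg, hsup⟩
    choose s hs hs_sup using hfine
    refine ⟨t.attach.biUnion s, fun Z hZ => ?_, ?_⟩
    · obtain ⟨Y, -, hY⟩ := Finset.mem_biUnion.1 hZ
      exact hs Y Z hY
    · rw [Finset.sup_biUnion, ← hsup]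
      simp only [hs_sup]
      exact Finset.sup_attach t id

lemma isCovering_iff_exists_finset {ι : Type*} (U : ι → L) (f : ∀ i, U i ⟶ P) :
    IsCovering (finiteCoverTopology L) U f ↔ ∃ t : Finset ι, t.sup U = P := by
  classical
  constructor
  · rintro ⟨t, ht, hsup⟩
    have hbelow : ∀ Y : t, ∃ i, Y.1 ≤ U i := by
      rintro ⟨Y, hY⟩
      obtain ⟨g, Z, k, l, ⟨i⟩, -⟩ := ht Y hY
      exact ⟨i, leOfHom k⟩
    choose i hi using hbelow
    refine ⟨t.attach.image i, le_antisymm (Finset.sup_le fun j _ => leOfHom (f j)) ?_⟩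
    rw [← hsup]
    refine Finset.sup_le fun Y hY => (hi ⟨Y, hY⟩).trans (Finset.le_sup (f := U) ?_)
    exact Finset.mem_image_of_mem _ (Finset.mem_attach _ _)
  · rintro ⟨t, hsup⟩
    refine ⟨t.image U, fun Y hY => ?_, by rw [Finset.sup_image]; exact hsup⟩
    obtain ⟨i, -, rfl⟩ := Finset.mem_image.1 hY
    exact ⟨f i, Sieve.ofArrows_mk _ _ i⟩

lemma isCovering_iff_sup_univ {ι : Type*} [Fintype ι] (U : ι → L) (f : ∀ i, U i ⟶ P) :
    IsCovering (finiteCoverTopology L) U f ↔ Finset.univ.sup U = P := by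
  rw [isCovering_iff_exists_finset]
  refine ⟨fun ⟨t, hsup⟩ => le_antisymm (Finset.sup_le fun j _ => leOfHom (f j)) ?_, fun h => ⟨_, h⟩⟩
  rw [← hsup]
  exact Finset.sup_mono (Finset.subset_univ t)

end FiniteCoverTopology

lemma hasPullbacks_of_semilatticeInf (L : Type u) [SemilatticeInf L] : HasPullbacks L :=
  have (P Q R : L) (f : P ⟶ R) (g : Q ⟶ R) : HasLimit (cospan f g) :=
    IsPullback.hasPullback (fst := (homOfLE inf_le_left : P ⊓ Q ⟶ P)) (snd := homOfLE inf_le_right)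
      ⟨⟨Subsingleton.elim _ _⟩, ⟨PullbackCone.IsLimit.mk _
        (fun s => homOfLE (le_inf (leOfHom s.fst) (leOfHom s.snd)))
        (fun _ => Subsingleton.elim _ _) (fun _ => Subsingleton.elim _ _)
        (fun _ _ _ _ => Subsingleton.elim _ _)⟩⟩
  hasPullbacks_of_hasLimit_cospan L

open DoubleCategory

/-- The horizontal morphisms `P → Q` of the double category `L`, whose vertical category is a
partially ordered set acted on by the group `G`, are the elements `g` of `G` with `g • P = Q`, and
a square commutes if its horizontal sides are given by the same element. -/
class IsActionDoubleCategory (G : outParam Type*) (L : Type u) [PartialOrder L]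
    [DoubleCategory.{u, w} L] [Group G] [MulAction G L] where
  elt {P Q : L} : HHom P Q → G
  hmk {P Q : L} (g : G) : g • P = Q → HHom P Q
  elt_smul {P Q : L} (σ : HHom P Q) : elt σ • P = Q
  elt_hmk {P Q : L} (g : G) (h : g • P = Q) : elt (hmk g h) = g
  elt_injective {P Q : L} : Function.Injective (elt : HHom P Q → G)
  elt_hcomp {P Q R : L} (σ : HHom P Q) (τ : HHom Q R) : elt (hcomp σ τ) = elt τ * elt σ
  sq_iff {P Q P' Q' : L} {σ : HHom P Q} {p : P ⟶ P'} {q : Q ⟶ Q'} {τ : HHom P' Q'} :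
    Sq σ p q τ ↔ elt σ = elt τ

namespace IsActionDoubleCategory

variable {G : Type*} {L : Type u} [Group G]

section Horizontal

variable [PartialOrder L] [DoubleCategory.{u, w} L] [MulAction G L] [IsActionDoubleCategory G L]
  {P Q : L}

lemma elt_hid (P : L) : elt (hid P) = 1 :=
  mul_eq_left.1 ((elt_hcomp (hid P) (hid P)).symm.trans (congrArg elt (hid_hcomp (hid P))))

lemma source_eq_inv_smul (σ : HHom P Q) : P = (elt σ)⁻¹ • Q := eq_inv_smul_iff.2 (elt_smul σ)

end Horizontal

section Slices

variable [PartialOrder L] [MulAction G L] [CovariantClass G L (· • ·) (· ≤ ·)] {P Q : L} {g : G}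

/-- Translation by `g`, as a functor between slices. -/
def overFunctor (h : g • P = Q) : Over P ⥤ Over Q where
  obj R := Over.mk (homOfLE (h ▸ smul_le_smul_iff_of_action.2 (leOfHom R.hom)) : g • R.left ⟶ Q)
  map f := Over.homMk (homOfLE (smul_le_smul_iff_of_action.2 (leOfHom f.left)))
    (Subsingleton.elim _ _)
  map_id _ := Over.OverMorphism.ext (Subsingleton.elim _ _)
  map_comp _ _ := Over.OverMorphism.ext (Subsingleton.elim _ _)

/-- Pulling back along the horizontal morphism given by `g` is translation by `g⁻¹`. -/
def overEquivalence (h : g • P = Q) : Over Q ≌ Over P :=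
  CategoryTheory.Equivalence.mk (overFunctor (inv_smul_eq_iff.2 h.symm)) (overFunctor h)
    (NatIso.ofComponents
      (fun R => Over.isoMk (eqToIso (smul_inv_smul g R.left).symm) (Subsingleton.elim _ _))
      fun _ => Over.OverMorphism.ext (Subsingleton.elim _ _))
    (NatIso.ofComponents
      (fun R => Over.isoMk (eqToIso (inv_smul_smul g R.left)) (Subsingleton.elim _ _))
      fun _ => Over.OverMorphism.ext (Subsingleton.elim _ _))

end Slices

lemma isPullbackSq_of_sq [PartialOrder L] [DoubleCategory.{u, w} L] [MulAction G L]
    [CovariantClass G L (· • ·) (· ≤ ·)] [IsActionDoubleCategory G L] {P Q P' Q' : L}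
    {τ : HHom P' Q'} {p : P' ⟶ P} {q : Q' ⟶ Q} {σ : HHom P Q} (h : Sq τ p q σ) :
    IsPullbackSq τ p q σ := by
  refine ⟨h, fun {P₁ Q₁} τ₁ p₁ s hs => ?_⟩
  have helt : elt τ₁ = elt τ := (sq_iff.1 hs).trans (sq_iff.1 h).symm
  refine ⟨homOfLE ?_, Subsingleton.elim _ _, sq_iff.2 helt⟩
  rw [source_eq_inv_smul τ₁, source_eq_inv_smul τ, helt]
  exact smul_le_smul_iff_of_action.2 (leOfHom s)

variable (G L) in
theorem isPolytopeComplex [DistribLattice L] [OrderBot L] [DoubleCategory.{u, w} L]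
    [MulAction G L] [CovariantClass G L (· • ·) (· ≤ ·)]
    [IsActionDoubleCategory G L] : IsPolytopeComplex (finiteCoverTopology L) where
  thin := inferInstance
  unique_initial := ⟨⊥, nonempty_isInitial_iff.2 rfl, fun _ => nonempty_isInitial_iff.1⟩
  hasPullbacks := hasPullbacks_of_semilatticeInf L
  groupoid σ := ⟨hmk (elt σ)⁻¹ (source_eq_inv_smul σ).symm,
    elt_injective (by rw [elt_hcomp, elt_hmk, elt_hid, inv_mul_cancel]),
    elt_injective (by rw [elt_hcomp, elt_hmk, elt_hid, mul_inv_cancel])⟩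
  pull σ := ⟨overEquivalence (elt_smul σ), fun _ => ⟨⟨hmk (elt σ) (smul_inv_smul _ _),
    sq_iff.2 (elt_hmk _ _), fun _ hτ => elt_injective ((sq_iff.1 hτ).trans (elt_hmk _ _).symm)⟩,
    fun _ => isPullbackSq_of_sq⟩⟩
  cover_pull {P Q} σ {ι} U f V g τ h hU := by
    obtain ⟨t, ht⟩ := (isCovering_iff_exists_finset U f).1 hU
    refine (isCovering_iff_exists_finset V g).2 ⟨t, ?_⟩
    rw [(source_eq_inv_smul σ).trans (congrArg _ ht.symm), smul_finset_sup_of_action]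
    refine Finset.sup_congr rfl fun i _ => ?_
    rw [← sq_iff.1 (h i).1, ← source_eq_inv_smul]
  cover_of_refinement {P ι} U f κ V g _ hV := by
    classical
    obtain ⟨t, ht⟩ := (isCovering_iff_exists_finset _ _).1 hV
    refine (isCovering_iff_exists_finset U f).2 ⟨t.image Sigma.fst,
      le_antisymm (Finset.sup_le fun i _ => leOfHom (f i)) ?_⟩
    rw [← ht]
    exact Finset.sup_le fun x hx => (leOfHom (g x.1 x.2)).trans
      (Finset.le_sup (f := U) (Finset.mem_image_of_mem _ hx))

end IsActionDoubleCategory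

/-- A relation between finite families, labelled by elements of `G`. The triple `(i, g, j)` stands
for the copy `g⁻¹ • B.obj j` of the member `B.obj j` inside the member `A.obj i`. -/
abbrev FamRel {C : Type u} [Category.{v} C] (G : Type*) (A B : Tw C) : Type _ :=
  Set (A.ι × G × B.ι)

namespace FamRel

section Injectivity

variable {C : Type u} [Category.{v} C] {G : Type*} {A B : Tw C}

/-- Every member of the target has at most one copy in the source. -/
def IsInj (R : FamRel G A B) : Prop :=
  ∀ ⦃i g i' g' j⦄, (i, g, j) ∈ R → (i', g', j) ∈ R → i = i' ∧ g = g'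

/-- Every member of the target has a copy in the source. -/
def IsOnto (R : FamRel G A B) : Prop := ∀ j, ∃ i g, (i, g, j) ∈ R

end Injectivity

section Composition

variable {C : Type u} [Category.{v} C] {G : Type*} [Group G] {A B D : Tw C}

/-- The relation of an identity morphism. -/
def id (A : Tw C) : FamRel G A A := {x | x.2.1 = 1 ∧ x.1 = x.2.2}

/-- The relation of a composite: a copy inside a copy is a copy. -/
def comp (R : FamRel G A B) (S : FamRel G B D) : FamRel G A D :=
  {x | ∃ g j k, (x.1, g, j) ∈ R ∧ (j, k, x.2.2) ∈ S ∧ x.2.1 = k * g}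

variable {R : FamRel G A B} {S : FamRel G B D}

lemma mem_id {i : A.ι} {g : G} {j : A.ι} : (i, g, j) ∈ id A ↔ g = 1 ∧ i = j := Iff.rfl

lemma mem_comp {i : A.ι} {g : G} {l : D.ι} :
    (i, g, l) ∈ comp R S ↔ ∃ k j k', (i, k, j) ∈ R ∧ (j, k', l) ∈ S ∧ g = k' * k := Iff.rfl

lemma IsInj.comp (hR : IsInj R) (hS : IsInj S) : IsInj (comp R S) := by
  rintro i g i' g' l ⟨k, j, m, hk, hm, rfl⟩ ⟨k', j', m', hk', hm', rfl⟩
  obtain ⟨rfl, rfl⟩ := hS hm hm'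
  obtain ⟨rfl, rfl⟩ := hR hk hk'
  exact ⟨rfl, rfl⟩

lemma IsOnto.comp (hR : IsOnto R) (hS : IsOnto S) : IsOnto (comp R S) := by
  intro l
  obtain ⟨j, k, hj⟩ := hS l
  obtain ⟨i, g, hi⟩ := hR j
  exact ⟨i, _, _, _, _, hi, hj, rfl⟩

variable {T : FamRel G B A}

lemma IsInj.of_comp_eq_id (hRT : R.comp T = id A) (hTR : T.comp R = id B) : IsInj R := by
  intro i g i' g' j h h'
  obtain ⟨k, i₀, -, hk, -⟩ := mem_comp.1 (hTR ▸ mem_id.2 ⟨rfl, rfl⟩ : (j, (1 : G), j) ∈ T.comp R)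
  have key {i g} (h : (i, g, j) ∈ R) : k * g = 1 ∧ i = i₀ :=
    mem_id.1 (hRT ▸ mem_comp.2 ⟨_, _, _, h, hk, rfl⟩)
  exact ⟨(key h).2.trans (key h').2.symm, mul_left_cancel ((key h).1.trans (key h').1.symm)⟩

lemma IsOnto.of_comp_eq_id (hTR : T.comp R = id B) : IsOnto R := fun j => by
  obtain ⟨-, i, g, -, hg, -⟩ :=
    mem_comp.1 (hTR ▸ mem_id.2 ⟨rfl, rfl⟩ : (j, (1 : G), j) ∈ T.comp R)
  exact ⟨i, g, hg⟩

end Composition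

section Copies

variable {L : Type u} [PartialOrder L] [OrderBot L] {G : Type*} [Group G] [MulAction G L]
  {A B D : Tw L}

/-- The relations of the diagrams `A ← A' → B`: finitely many copies, those in the same member of
`A` being disjoint. -/
structure IsSub (R : FamRel G A B) : Prop where
  finite : R.Finite
  le : ∀ ⦃i g j⦄, (i, g, j) ∈ R → g⁻¹ • B.obj j ≤ A.obj i
  disj : ∀ ⦃i g j g' j'⦄, (i, g, j) ∈ R → (i, g', j') ∈ R → (g, j) ≠ (g', j') →
    Disjoint (g⁻¹ • B.obj j) (g'⁻¹ • B.obj j')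

lemma isSub_empty (A B : Tw L) : IsSub (∅ : FamRel G A B) :=
  ⟨Set.finite_empty, fun _ _ _ h => h.elim, fun _ _ _ _ _ h => h.elim⟩

lemma IsSub.eq_of_le {R : FamRel G A B} (hR : IsSub R) {i : A.ι} {g g' : G} {j j' : B.ι}
    (h : (i, g, j) ∈ R) (h' : (i, g', j') ∈ R) {c : L} (hc : c ≠ ⊥) (hle : c ≤ g⁻¹ • B.obj j)
    (hle' : c ≤ g'⁻¹ • B.obj j') : g = g' ∧ j = j' := by
  by_contra hne
  exact hc (le_bot_iff.1 (hR.disj h h' (hne ∘ Prod.mk.inj) hle hle'))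

end Copies

/-- The copies in every member of the source cover it. -/
def IsCov {L : Type u} [Preorder L] {G : Type*} [Group G] [MulAction G L] {A B : Tw L}
    (R : FamRel G A B) : Prop :=
  ∀ i c, (∀ g j, (i, g, j) ∈ R → g⁻¹ • B.obj j ≤ c) → A.obj i ≤ c

section Covering

variable {L : Type u} [PartialOrder L] {G : Type*} [Group G] [MulAction G L]
  [CovariantClass G L (· • ·) (· ≤ ·)] {A B D : Tw L} {R : FamRel G A B}

lemma IsCov.comp {S : FamRel G B D} (hR : IsCov R) (hS : IsCov S) : IsCov (comp R S) := by
  refine fun i c hc => hR i c fun g j hj =>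
    inv_smul_le_iff_of_action.2 (hS j _ fun k l hl => ?_)
  rw [← inv_smul_le_iff_of_action, ← mul_smul, ← mul_inv_rev]
  exact hc _ _ (mem_comp.2 ⟨_, _, _, hj, hl, rfl⟩)

lemma IsCov.of_comp_eq_id [OrderBot L] {T : FamRel G B A} (hT : IsSub T)
    (hRT : R.comp T = id A) : IsCov R := by
  intro i c hc
  obtain ⟨g, j, k, hg, hk, hkg⟩ :=
    mem_comp.1 (hRT ▸ mem_id.2 ⟨rfl, rfl⟩ : (i, (1 : G), i) ∈ R.comp T)
  obtain rfl := eq_inv_of_mul_eq_one_left hkg.symm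
  exact (inv_smul_le_iff_of_action.1 (hT.le hk)).trans (hc g j hg)

end Covering

section Partition

variable {L : Type u} [DistribLattice L] [OrderBot L] {G : Type*} [Group G] [MulAction G L]
  [CovariantClass G L (· • ·) (· ≤ ·)] {A B : Tw L} {R : FamRel G A B}

lemma smul_obj_ne_bot (A : Tw L) (i : A.ι) (g : G) : g • A.obj i ≠ ⊥ :=
  mt smul_eq_bot_iff_of_action.1 (isPolytope_iff_ne_bot.1 (A.poly i))

/-- The partition of a member of the source into the copies it contains. -/
noncomputable def partition (hR : IsSub R) (hcov : IsCov R) (i : A.ι) :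
    Finpartition (A.obj i) where
  parts := Set.Finite.toFinset (s := {u | ∃ g j, (i, g, j) ∈ R ∧ g⁻¹ • B.obj j = u})
    ((hR.finite.image fun x => x.2.1⁻¹ • B.obj x.2.2).subset
      fun _ ⟨_, _, h, hu⟩ => ⟨_, h, hu⟩)
  supIndep := by
    rw [Finset.supIndep_iff_pairwiseDisjoint, Set.Finite.coe_toFinset]
    rintro _ ⟨g, j, h, rfl⟩ _ ⟨g', j', h', rfl⟩ hne
    exact hR.disj h h' fun heq => hne (by rw [(Prod.mk.inj heq).1, (Prod.mk.inj heq).2])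
  sup_parts := by
    refine le_antisymm (Finset.sup_le fun u hu => ?_) (hcov i _ fun g j h => ?_)
    · obtain ⟨g, j, h, rfl⟩ := (Set.Finite.mem_toFinset _).1 hu
      exact hR.le h
    · exact Finset.le_sup (f := _root_.id) ((Set.Finite.mem_toFinset _).2 ⟨g, j, h, rfl⟩)
  bot_notMem h := by
    obtain ⟨g, j, -, hbot⟩ := (Set.Finite.mem_toFinset _).1 h
    exact smul_obj_ne_bot B j g⁻¹ hbot

lemma mem_parts_partition {hR : IsSub R} {hcov : IsCov R} {i : A.ι} {u : L} :
    u ∈ (partition hR hcov i).parts ↔ ∃ g j, (i, g, j) ∈ R ∧ g⁻¹ • B.obj j = u :=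
  Set.Finite.mem_toFinset _

lemma IsCov.inf_le (hcov : IsCov R) (hR : IsSub R) {i : A.ι} {x c : L}
    (h : ∀ g j, (i, g, j) ∈ R → g⁻¹ • B.obj j ⊓ x ≤ c) : A.obj i ⊓ x ≤ c := by
  rw [← (partition hR hcov i).sup_parts, Finset.sup_inf_distrib_right]
  refine Finset.sup_le fun u hu => ?_
  obtain ⟨g, j, hj, rfl⟩ := mem_parts_partition.1 hu
  exact h g j hj

end Partition

end FamRel

namespace Span

open DoubleCategory IsActionDoubleCategory FamRel

section Rel

variable {L : Type u} [PartialOrder L] [DoubleCategory.{u, w} L] {G : Type*} [Group G]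
  [MulAction G L] [IsActionDoubleCategory G L] {A B : Tw L}

/-- The triple of a member of the apex of a diagram. -/
def triple (s : Span A B) (x : s.apex.ι) : A.ι × G × B.ι :=
  (s.left.map x, elt (s.right.hom x), s.right.map x)

/-- The relation of a diagram. -/
def toRel (s : Span A B) : FamRel G A B := Set.range s.triple

lemma mem_toRel {s : Span A B} {i : A.ι} {g : G} {j : B.ι} : (i, g, j) ∈ s.toRel ↔
    ∃ x, s.left.map x = i ∧ elt (s.right.hom x) = g ∧ s.right.map x = j := by
  simp only [toRel, Set.mem_range, triple, Prod.mk.injEq]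

lemma surjective_right_iff (s : Span A B) : Function.Surjective s.right.map ↔ s.toRel.IsOnto := by
  simp only [IsOnto, mem_toRel, Function.Surjective]
  exact forall_congr' fun j => ⟨fun ⟨x, hx⟩ => ⟨_, _, x, rfl, rfl, hx⟩,
    fun ⟨_, _, x, _, _, hx⟩ => ⟨x, hx⟩⟩

lemma rel_of_triple_eq {s t : Span A B} (e : s.apex.ι ≃ t.apex.ι)
    (h : ∀ x, t.triple (e x) = s.triple x) : s.Rel t := by
  simp only [triple, Prod.mk.injEq] at h
  refine ⟨e, fun x => eqToIso ?_, fun x => (h x).1.symm, fun x => (h x).2.2.symm,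
    fun x => Subsingleton.elim _ _, fun x => sq_iff.2 (h x).2.1.symm⟩
  rw [source_eq_inv_smul (s.right.hom x), source_eq_inv_smul (t.right.hom (e x)), (h x).2.1,
    (h x).2.2]

end Rel

variable {L : Type u} [DistribLattice L] [OrderBot L] [DoubleCategory.{u, w} L] {G : Type*}
  [Group G] [MulAction G L] [IsActionDoubleCategory G L] {A B : Tw L}

lemma disjoint_of_left_eq (s : Span A B) {x x' : s.apex.ι} (hne : x ≠ x')
    (h : s.left.map x = s.left.map x') : Disjoint (s.apex.obj x) (s.apex.obj x') :=
  have := hasPullbacks_of_semilatticeInf L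
  disjoint_iff.2 (nonempty_isInitial_iff.1 (s.isSubMap.disjoint hne h _ (homOfLE inf_le_left)
    (homOfLE inf_le_right)))

lemma isSub_toRel (s : Span A B) : IsSub s.toRel where
  finite := have := s.apex.fin; Set.finite_range _
  le := by
    intro i g j h
    obtain ⟨x, rfl, rfl, rfl⟩ := mem_toRel.1 h
    exact (source_eq_inv_smul _).symm.trans_le (leOfHom (s.left.hom x))
  disj := by
    intro i g j g' j' h h' hne
    obtain ⟨x, rfl, rfl, rfl⟩ := mem_toRel.1 h
    obtain ⟨x', hleft, rfl, rfl⟩ := mem_toRel.1 h'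
    rw [← source_eq_inv_smul, ← source_eq_inv_smul]
    refine s.disjoint_of_left_eq ?_ hleft.symm
    rintro rfl
    exact hne rfl

lemma isCover_iff (s : Span A B) : s.left.IsCover (finiteCoverTopology L) ↔ s.toRel.IsCov := by
  have := s.apex.fin
  refine forall_congr' fun i => ?_
  cases nonempty_fintype {x : s.apex.ι // s.left.map x = i}
  refine (isCovering_iff_sup_univ _ _).trans ⟨fun h c hc => ?_, fun h => ?_⟩
  · rw [← h]
    refine Finset.sup_le fun x _ => ?_
    rw [source_eq_inv_smul (s.right.hom x.1)]
    exact hc _ _ (mem_toRel.2 ⟨x.1, x.2, rfl, rfl⟩)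
  · refine le_antisymm (Finset.sup_le fun x _ => leOfHom (s.left.fiberHom i x)) (h _ ?_)
    intro g j hj
    obtain ⟨x, hx, rfl, rfl⟩ := mem_toRel.1 hj
    rw [← source_eq_inv_smul]
    exact Finset.le_sup (f := fun x : {x : s.apex.ι // s.left.map x = i} => s.apex.obj x.1)
      (Finset.mem_univ ⟨x, hx⟩)

end Span

end ScissorsCongruence

namespace ScissorsCongruence

open DoubleCategory IsActionDoubleCategory FamRel

section Diagrams

variable {G : Type} {L : Type u} [Group G] [DistribLattice L] [OrderBot L] [DoubleCategory.{u, w} L]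
  [MulAction G L] [CovariantClass G L (· • ·) (· ≤ ·)] [IsActionDoubleCategory G L]
  {A B : Tw L}

namespace Span

lemma triple_injective (s : Span A B) : Function.Injective s.triple := by
  intro x x' h
  obtain ⟨hleft, helt, hright⟩ : _ ∧ _ ∧ _ := by simpa only [triple, Prod.mk.injEq] using h
  by_contra hne
  have := s.disjoint_of_left_eq hne hleft
  rw [source_eq_inv_smul (s.right.hom x), source_eq_inv_smul (s.right.hom x'), helt, hright,
    disjoint_self] at this
  exact smul_obj_ne_bot _ _ _ this

lemma injective_right_iff (s : Span A B) : Function.Injective s.right.map ↔ s.toRel.IsInj := by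
  refine ⟨fun h i g i' g' j hx hx' => ?_, fun h x x' hxx' => ?_⟩
  · obtain ⟨x, rfl, rfl, rfl⟩ := mem_toRel.1 hx
    obtain ⟨x', rfl, rfl, hxx'⟩ := mem_toRel.1 hx'
    obtain rfl := h hxx'
    exact ⟨rfl, rfl⟩
  · have := h ⟨x, rfl⟩ ⟨x', by rw [triple, hxx']⟩
    exact s.triple_injective (Prod.ext this.1 (Prod.ext this.2 hxx'))

lemma rel_iff_toRel_eq (s t : Span A B) : s.Rel t ↔ s.toRel = t.toRel := by
  constructor
  · rintro ⟨e, ι, hleft, hright, -, hsq⟩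
    have htriple : t.triple ∘ e = s.triple := funext fun x => by
      simp only [Function.comp, triple, hleft, hright, sq_iff.1 (hsq x)]
    rw [toRel, toRel, ← htriple, EquivLike.range_comp]
  · intro h
    let e : s.apex.ι ≃ t.apex.ι := (Equiv.ofInjective _ s.triple_injective).trans
      ((Equiv.setCongr h).trans (Equiv.ofInjective _ t.triple_injective).symm)
    exact rel_of_triple_eq e fun x => congrArg Subtype.val
      ((Equiv.ofInjective _ t.triple_injective).apply_symm_apply
        (Equiv.setCongr h (Equiv.ofInjective _ s.triple_injective x)))

/-- The diagram of a relation, whose apex is the family of all copies. -/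
def ofRel (R : FamRel G A B) (hR : IsSub R) : Span A B where
  apex :=
    { ι := R
      fin := hR.finite.to_subtype
      obj := fun x => x.1.2.1⁻¹ • B.obj x.1.2.2
      poly := fun _ => isPolytope_iff_ne_bot.2 (smul_obj_ne_bot _ _ _) }
  left := ⟨fun x => x.1.1, fun x => homOfLE (hR.le x.2)⟩
  isSubMap := by
    rintro _ ⟨⟨⟨i, g, j⟩, h⟩, rfl⟩ ⟨⟨⟨i', g', j'⟩, h'⟩, hi⟩ hne Z f f' -
    obtain rfl : i' = i := hi
    refine nonempty_isInitial_iff.2 (le_bot_iff.1 (hR.disj h h' ?_ (leOfHom f) (leOfHom f')))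
    rintro ⟨rfl, rfl⟩
    exact hne rfl
  right := ⟨fun x => x.1.2.2, fun x => hmk x.1.2.1 (smul_inv_smul _ _)⟩

lemma toRel_ofRel (R : FamRel G A B) (hR : IsSub R) : (ofRel R hR).toRel = R := by
  have htriple : (ofRel R hR).triple = Subtype.val :=
    funext fun x => Prod.ext_iff.2 ⟨rfl, Prod.ext_iff.2 ⟨elt_hmk _ _, rfl⟩⟩
  rw [toRel, htriple]
  exact Subtype.range_val

lemma toRel_compSpan {D : Tw L} (s : Span A B) (t : Span B D) :
    ((isPolytopeComplex G L).compSpan s t).toRel = s.toRel.comp t.toRel := by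
  have elt_right (x : IsPolytopeComplex.compIdx s t) :
      elt (((isPolytopeComplex G L).compSpan s t).right.hom x) =
        elt (t.right.hom x.1.2) * elt (s.right.hom x.1.1) :=
    (elt_hcomp _ _).trans (congrArg _ (sq_iff.1 ((isPolytopeComplex G L).pb_isPullbackSq
      (s.right.hom x.1.1) (IsPolytopeComplex.compV s t x)).1))
  ext ⟨i, g, l⟩
  rw [mem_toRel, mem_comp]
  constructor
  · rintro ⟨x, rfl, rfl, rfl⟩
    exact ⟨_, _, _, ⟨x.1.1, rfl⟩, mem_toRel.2 ⟨x.1.2, x.2, rfl, rfl⟩, elt_right x⟩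
  · rintro ⟨k, j, k', hx, hy, rfl⟩
    obtain ⟨x, rfl, rfl, rfl⟩ := mem_toRel.1 hx
    obtain ⟨y, hxy, rfl, rfl⟩ := mem_toRel.1 hy
    exact ⟨⟨(x, y), hxy⟩, rfl, elt_right _, rfl⟩

end Span

end Diagrams

/-- The category `SC` of the double category of a lattice with an action. -/
abbrev Fam (G : Type) (L : Type u) [Group G] [DistribLattice L] [OrderBot L]
    [DoubleCategory.{u, w} L] [MulAction G L] [CovariantClass G L (· • ·) (· ≤ ·)]
    [IsActionDoubleCategory G L] : Type _ :=
  SC (isPolytopeComplex G L)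

namespace Fam

variable {G : Type} {L : Type u} [Group G] [DistribLattice L] [OrderBot L] [DoubleCategory.{u, w} L]
  [MulAction G L] [CovariantClass G L (· • ·) (· ≤ ·)] [IsActionDoubleCategory G L]
  {A B D : Fam G L}

/-- The relation of a morphism, which determines it. -/
def toRel (f : A ⟶ B) : FamRel G A.tw B.tw :=
  Quotient.lift Span.toRel (fun s t h => (s.rel_iff_toRel_eq t).1 h) f

lemma exists_mk_eq (f : A ⟶ B) : ∃ s : Span A.tw B.tw, (SC.Hom.mk s : A ⟶ B) = f :=
  Quotient.exists_rep f

lemma isSub_toRel (f : A ⟶ B) : IsSub (toRel f) := by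
  obtain ⟨s, rfl⟩ := exists_mk_eq f
  exact s.isSub_toRel

lemma toRel_injective {f f' : A ⟶ B} (h : toRel f = toRel f') : f = f' := by
  obtain ⟨s, rfl⟩ := exists_mk_eq f
  obtain ⟨t, rfl⟩ := exists_mk_eq f'
  exact Quotient.sound ((s.rel_iff_toRel_eq t).2 h)

lemma hom_ext {f f' : A ⟶ B} (h : ∀ i g j, (i, g, j) ∈ toRel f ↔ (i, g, j) ∈ toRel f') :
    f = f' := toRel_injective (Set.ext fun x => h x.1 x.2.1 x.2.2)

/-- The morphism of a relation. -/
def ofRel (R : FamRel G A.tw B.tw) (hR : IsSub R) : A ⟶ B := SC.Hom.mk (Span.ofRel R hR)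

@[simp] lemma toRel_ofRel (R : FamRel G A.tw B.tw) (hR : IsSub R) :
    toRel (ofRel R hR : A ⟶ B) = R := Span.toRel_ofRel R hR

lemma toRel_id : toRel (𝟙 A) = FamRel.id A.tw := by
  ext ⟨i, g, j⟩
  refine Span.mem_toRel.trans (Iff.trans ⟨?_, ?_⟩ mem_id.symm)
  · rintro ⟨x, rfl, rfl, rfl⟩
    exact ⟨elt_hid _, rfl⟩
  · rintro ⟨rfl, rfl⟩
    exact ⟨i, rfl, elt_hid _, rfl⟩

lemma toRel_comp (f : A ⟶ B) (f' : B ⟶ D) : toRel (f ≫ f') = (toRel f).comp (toRel f') := by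
  obtain ⟨s, rfl⟩ := exists_mk_eq f
  obtain ⟨t, rfl⟩ := exists_mk_eq f'
  exact s.toRel_compSpan t

variable (G L) in
/-- The cofibrations of families. -/
abbrev cof : MorphismProperty (Fam G L) := SC.cofibrations (isPolytopeComplex G L)

variable (G L) in
/-- The weak equivalences of families. -/
abbrev weq : MorphismProperty (Fam G L) := SC.weakEquivalences (isPolytopeComplex G L)

lemma cof_iff (f : A ⟶ B) : cof G L f ↔ (toRel f).IsCov ∧ (toRel f).IsInj := by
  constructor
  · rintro ⟨s, rfl, hcov, hinj⟩
    exact ⟨s.isCover_iff.1 hcov, s.injective_right_iff.1 hinj⟩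
  · obtain ⟨s, rfl⟩ := exists_mk_eq f
    rintro ⟨hcov, hinj⟩
    exact ⟨s, rfl, s.isCover_iff.2 hcov, s.injective_right_iff.2 hinj⟩

lemma weq_iff (f : A ⟶ B) :
    weq G L f ↔ (toRel f).IsCov ∧ (toRel f).IsInj ∧ (toRel f).IsOnto := by
  constructor
  · rintro ⟨s, rfl, hcov, hbij⟩
    exact ⟨s.isCover_iff.1 hcov, s.injective_right_iff.1 hbij.1, s.surjective_right_iff.1 hbij.2⟩
  · obtain ⟨s, rfl⟩ := exists_mk_eq f
    rintro ⟨hcov, hinj, honto⟩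
    exact ⟨s, rfl, s.isCover_iff.2 hcov, s.injective_right_iff.2 hinj,
      s.surjective_right_iff.2 honto⟩

lemma weq.cof {f : A ⟶ B} (h : weq G L f) : cof G L f :=
  (cof_iff f).2 ⟨((weq_iff f).1 h).1, ((weq_iff f).1 h).2.1⟩

lemma cof_comp {f : A ⟶ B} {f' : B ⟶ D} (h : cof G L f) (h' : cof G L f') :
    cof G L (f ≫ f') := by
  rw [cof_iff] at *
  exact toRel_comp f f' ▸ ⟨h.1.comp h'.1, h.2.comp h'.2⟩

lemma weq_comp {f : A ⟶ B} {f' : B ⟶ D} (h : weq G L f) (h' : weq G L f') :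
    weq G L (f ≫ f') := by
  rw [weq_iff] at *
  exact toRel_comp f f' ▸ ⟨h.1.comp h'.1, h.2.1.comp h'.2.1, h.2.2.comp h'.2.2⟩

lemma weq_of_isIso (f : A ⟶ B) [IsIso f] : weq G L f := by
  have hom_inv : (toRel f).comp (toRel (inv f)) = FamRel.id A.tw := by
    rw [← toRel_comp, IsIso.hom_inv_id, toRel_id]
  have inv_hom : (toRel (inv f)).comp (toRel f) = FamRel.id B.tw := by
    rw [← toRel_comp, IsIso.inv_hom_id, toRel_id]
  exact (weq_iff f).2 ⟨.of_comp_eq_id (isSub_toRel _) hom_inv, .of_comp_eq_id hom_inv inv_hom,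
    .of_comp_eq_id inv_hom⟩

lemma isZero_iff (Z : Fam G L) : IsZero Z ↔ IsEmpty Z.tw.ι := by
  constructor
  · refine fun h => ⟨fun i => ?_⟩
    have hi : (i, (1 : G), i) ∈ toRel (𝟙 Z) := by rw [toRel_id, mem_id]; exact ⟨rfl, rfl⟩
    rwa [h.eq_of_src (𝟙 Z) (ofRel ∅ (isSub_empty Z.tw Z.tw)), toRel_ofRel] at hi
  · intro h
    refine ⟨fun Y => ⟨⟨⟨ofRel ∅ (isSub_empty _ _)⟩, fun f => hom_ext fun i => h.elim i⟩⟩,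
      fun Y => ⟨⟨⟨ofRel ∅ (isSub_empty _ _)⟩, fun f => hom_ext fun _ _ i => h.elim i⟩⟩⟩

variable (G L) in
/-- The empty family. -/
def zero : Fam G L := ⟨⟨Empty, inferInstance, Empty.elim, fun i => i.elim⟩⟩

lemma isZero_zero : IsZero (zero G L) :=
  (isZero_iff _).2 (inferInstanceAs (IsEmpty Empty))

end Fam

end ScissorsCongruence

namespace ScissorsCongruence

namespace FamRel

section Partitions

variable {α : Type*} [DistribLattice α] [OrderBot α] [DecidableEq α] {a b t u v : α}

lemma exists_le_part_restrict {P : Finpartition a} (hb : b ≤ a) (ht : t ≠ ⊥) (htb : t ≤ b)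
    (hu : u ∈ P.parts) (htu : t ≤ u) : ∃ w ∈ (P.restrict hb).parts, t ≤ w :=
  ⟨u ⊓ b, Finset.mem_erase.2 ⟨ne_bot_of_le_ne_bot ht (le_inf htu htb),
    Finset.mem_image_of_mem _ hu⟩, le_inf htu htb⟩

lemma exists_le_part_inf {P Q : Finpartition a} (ht : t ≠ ⊥) (hu : u ∈ P.parts) (htu : t ≤ u)
    (hv : v ∈ Q.parts) (htv : t ≤ v) : ∃ w ∈ (P ⊓ Q).parts, t ≤ w :=
  ⟨u ⊓ v, Finset.mem_erase.2 ⟨ne_bot_of_le_ne_bot ht (le_inf htu htv),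
    Finset.mem_image.2 ⟨(u, v), Finset.mk_mem_product hu hv, rfl⟩⟩, le_inf htu htv⟩

lemma exists_le_part_finset_inf {ι : Type*} (ht : t ≠ ⊥) (hta : t ≤ a) (s : Finset ι)
    (P : ι → Finpartition a) (h : ∀ x ∈ s, ∃ u ∈ (P x).parts, t ≤ u) :
    ∃ w ∈ (s.inf P).parts, t ≤ w := by
  classical
  induction s using Finset.induction_on with
  | empty =>
    rw [Finset.inf_empty]
    obtain ⟨w, hw⟩ := (⊤ : Finpartition a).parts_nonempty (ne_bot_of_le_ne_bot ht hta)
    obtain rfl := Finset.mem_singleton.1 (Finpartition.parts_top_subset a hw)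
    exact ⟨w, hw, hta⟩
  | insert x s _ ih =>
    rw [Finset.inf_insert]
    obtain ⟨u, hu, htu⟩ := h x (Finset.mem_insert_self x s)
    obtain ⟨v, hv, htv⟩ := ih fun y hy => h y (Finset.mem_insert_of_mem hy)
    exact exists_le_part_inf ht hu htu hv htv

end Partitions

variable {L : Type u} [DistribLattice L] [OrderBot L] {G : Type*} [Group G] [MulAction G L]
  {A B D : Tw L} {R : FamRel G A B} {S : FamRel G A D}

/-- `W` partitions the members of `D` into the largest pieces all of whose copies in `A` are
contained in copies of members of `B`. -/
structure IsRefinement (R : FamRel G A B) (S : FamRel G A D)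
    (W : ∀ k, Finpartition (D.obj k)) : Prop where
  refines : ∀ ⦃k w i g⦄, w ∈ (W k).parts → (i, g, k) ∈ S →
    ∃ h j, (i, h, j) ∈ R ∧ w ≤ g • h⁻¹ • B.obj j
  maximal : ∀ ⦃k t⦄, t ≠ ⊥ → t ≤ D.obj k →
    (∀ i g, (i, g, k) ∈ S → ∃ h j, (i, h, j) ∈ R ∧ t ≤ g • h⁻¹ • B.obj j) →
    ∃ w ∈ (W k).parts, t ≤ w

lemma exists_isRefinement [CovariantClass G L (· • ·) (· ≤ ·)] (hR : IsSub R) (hcov : IsCov R)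
    (hS : IsSub S) : ∃ W, IsRefinement R S W := by
  classical
  have fin_copies (k : D.ι) : Fintype {x // x ∈ S ∧ x.2.2 = k} :=
    (hS.finite.subset (Set.sep_subset _ _)).fintype
  have obj_le {k : D.ι} (x : {x // x ∈ S ∧ x.2.2 = k}) : D.obj k ≤ x.1.2.1 • A.obj x.1.1 := by
    obtain ⟨⟨i, g, k⟩, hx, rfl⟩ := x
    exact inv_smul_le_iff_of_action.1 (hS.le hx)
  let pull (k : D.ι) (x : {x // x ∈ S ∧ x.2.2 = k}) : Finpartition (D.obj k) :=
    ((partition hR hcov x.1.1).map (smulOrderIso x.1.2.1)).restrict (obj_le x)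
  have mem_map {i : A.ι} {g : G} {h : G} {j : B.ι} (hj : (i, h, j) ∈ R) :
      g • h⁻¹ • B.obj j ∈ ((partition hR hcov i).map (smulOrderIso g)).parts :=
    Finset.mem_map_of_mem _ (mem_parts_partition.2 ⟨h, j, hj, rfl⟩)
  refine ⟨fun k => Finset.univ.inf (pull k), fun k w i g hw hi => ?_, fun k t ht htk h => ?_⟩
  · obtain ⟨_, hpart, hwv⟩ := Finset.inf_le (f := pull k) (Finset.mem_univ ⟨(i, g, k), hi, rfl⟩) hw
    obtain ⟨v, hv, rfl⟩ := Finset.mem_image.1 (Finset.mem_of_mem_erase hpart)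
    obtain ⟨u, hu, rfl⟩ := Finset.mem_map.1 hv
    obtain ⟨h, j, hj, rfl⟩ := mem_parts_partition.1 hu
    exact ⟨h, j, hj, hwv.trans inf_le_left⟩
  · refine exists_le_part_finset_inf ht htk _ _ fun x _ => ?_
    obtain ⟨⟨i, g, k⟩, hx, rfl⟩ := x
    obtain ⟨h, j, hj, hle⟩ := h i g hx
    exact exists_le_part_restrict _ ht htk (mem_map hj) hle

end FamRel

namespace FamRel

lemma part_eq_of_le {α : Type*} [Lattice α] [OrderBot α] {a t : α} {P : Finpartition a}
    {u v : P.parts} (ht : t ≠ ⊥) (hu : t ≤ u) (hv : t ≤ v) : u = v := by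
  by_contra hne
  exact ht (le_bot_iff.1 (P.disjoint u.2 v.2 (hne ∘ Subtype.ext) hu hv))

section Glue

variable {L : Type} [DistribLattice L] [OrderBot L] {G : Type*} {A B D : Tw L}

/-- The members of the target which have no copy in the source. -/
abbrev Compl (R : FamRel G A B) : Type := {j : B.ι // ∀ i g, (i, g, j) ∉ R}

/-- The pushout of `A → B` and `A → D`: the parts of the members of `D` together with the members
of `B` which have no copy in `A`. -/
abbrev glue (R : FamRel G A B) (W : ∀ k, Finpartition (D.obj k)) : Tw L where
  ι := (Σ k, (W k).parts) ⊕ Compl R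
  fin := by
    have := D.fin
    have := B.fin
    infer_instance
  obj := Sum.elim (fun x => x.2.1) fun j => B.obj j.1
  poly := by
    rintro (⟨k, w⟩ | j)
    · exact isPolytope_iff_ne_bot.2 ((W k).ne_bot w.2)
    · exact B.poly j.1

variable [Group G] (R : FamRel G A B) (S : FamRel G A D) (W : ∀ k, Finpartition (D.obj k))

/-- The relation of the map from `D` to the pushout. -/
def glueRight : FamRel G D (glue R W) :=
  {x | match x with
    | (k, γ, Sum.inl y) => γ = 1 ∧ k = y.1
    | (_, _, Sum.inr _) => False}

/-- The relation of the map from `B` to the pushout. A part of a member of `D` lies in a member `B`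
when some copy of that part in `A` does. -/
def glueLeft [MulAction G L] : FamRel G B (glue R W) :=
  {x | match x with
    | (j, γ, Sum.inl y) => ∃ i g h, (i, g, y.1) ∈ S ∧ (i, h, j) ∈ R ∧ g = γ * h ∧
        γ⁻¹ • y.2.1 ≤ B.obj j
    | (j, γ, Sum.inr j') => γ = 1 ∧ j = j'.1}

variable {R S W}

lemma mem_glueRight_inl {k : D.ι} {γ : G} {y : Σ k, (W k).parts} :
    (k, γ, Sum.inl y) ∈ glueRight R W ↔ γ = 1 ∧ k = y.1 := Iff.rfl

lemma notMem_glueRight_inr {k : D.ι} {γ : G} {y : Compl R} :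
    (k, γ, Sum.inr y) ∉ glueRight R W := fun h => h

section

variable [MulAction G L]

lemma mem_glueLeft_inl {j : B.ι} {γ : G} {y : Σ k, (W k).parts} :
    (j, γ, Sum.inl y) ∈ glueLeft R S W ↔ ∃ i g h, (i, g, y.1) ∈ S ∧ (i, h, j) ∈ R ∧ g = γ * h ∧
        γ⁻¹ • y.2.1 ≤ B.obj j := Iff.rfl

lemma mem_glueLeft_inr {j : B.ι} {γ : G} {y : Compl R} :
    (j, γ, Sum.inr y) ∈ glueLeft R S W ↔ γ = 1 ∧ j = y.1 := Iff.rfl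

lemma isCov_glueRight : IsCov (glueRight R W) := by
  intro k c hc
  rw [← (W k).sup_parts]
  refine Finset.sup_le fun w hw => ?_
  rw [id_eq, ← one_smul G w, ← inv_one]
  exact hc 1 (Sum.inl ⟨k, w, hw⟩) (mem_glueRight_inl.2 ⟨rfl, rfl⟩)

end

lemma isInj_glueRight : IsInj (glueRight R W) := by
  rintro k γ k' γ' (⟨l, w⟩ | y) h h'
  · exact ⟨h.2.trans h'.2.symm, h.1.trans h'.1.symm⟩
  · exact h.elim

lemma mem_comp_glueRight_inl {E : Tw L} {V : FamRel G E D} {x : E.ι} {γ : G}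
    {y : Σ k, (W k).parts} : (x, γ, Sum.inl y) ∈ V.comp (glueRight R W) ↔ (x, γ, y.1) ∈ V := by
  rw [mem_comp]
  constructor
  · rintro ⟨γ, k, γ', h, h', rfl⟩
    obtain ⟨rfl, rfl⟩ := mem_glueRight_inl.1 h'
    rwa [one_mul]
  · exact fun h => ⟨γ, y.1, 1, h, mem_glueRight_inl.2 ⟨rfl, rfl⟩, (one_mul γ).symm⟩

lemma notMem_comp_glueRight_inr {E : Tw L} {V : FamRel G E D} {x : E.ι} {γ : G} {y : Compl R} :
    (x, γ, Sum.inr y) ∉ V.comp (glueRight R W) :=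
  fun ⟨_, _, _, _, h, _⟩ => notMem_glueRight_inr h

lemma mem_glueRight_comp {E : Tw L} {Q : FamRel G (glue R W) E} {k : D.ι} {γ : G} {l : E.ι} :
    (k, γ, l) ∈ (glueRight R W).comp Q ↔ ∃ w, (Sum.inl ⟨k, w⟩, γ, l) ∈ Q := by
  rw [mem_comp]
  constructor
  · rintro ⟨γ₁, (⟨k, w⟩ | y), γ₂, h, h', rfl⟩
    · obtain ⟨rfl, rfl⟩ := mem_glueRight_inl.1 h
      exact ⟨w, (mul_one γ₂).symm ▸ h'⟩
    · exact h.elim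
  · exact fun ⟨w, h⟩ => ⟨1, _, γ, mem_glueRight_inl.2 ⟨rfl, rfl⟩, h, (mul_one γ).symm⟩

section

variable [MulAction G L]

lemma mem_comp_glueLeft_inr {E : Tw L} {V : FamRel G E B} {x : E.ι} {γ : G} {y : Compl R} :
    (x, γ, Sum.inr y) ∈ V.comp (glueLeft R S W) ↔ (x, γ, y.1) ∈ V := by
  rw [mem_comp]
  constructor
  · rintro ⟨γ, j, γ', h, h', rfl⟩
    obtain ⟨rfl, rfl⟩ := mem_glueLeft_inr.1 h'
    rwa [one_mul]
  · exact fun h => ⟨γ, y.1, 1, h, mem_glueLeft_inr.2 ⟨rfl, rfl⟩, (one_mul γ).symm⟩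

lemma mem_glueLeft_comp {E : Tw L} {Q : FamRel G (glue R W) E} {x : Compl R} {γ : G} {l : E.ι} :
    (x.1, γ, l) ∈ (glueLeft R S W).comp Q ↔ (Sum.inr x, γ, l) ∈ Q := by
  rw [mem_comp]
  constructor
  · rintro ⟨γ₁, (y | y), γ₂, h, h', rfl⟩
    · obtain ⟨i, -, g, -, hi, -⟩ := mem_glueLeft_inl.1 h
      exact (x.2 _ _ hi).elim
    · obtain ⟨rfl, hxy⟩ := mem_glueLeft_inr.1 h
      obtain rfl := Subtype.ext hxy
      rwa [mul_one]
  · exact fun h => ⟨1, _, γ, mem_glueLeft_inr.2 ⟨rfl, rfl⟩, h, (mul_one γ).symm⟩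

end

end Glue

section Desc

variable {L : Type} [DistribLattice L] [OrderBot L] {G : Type*} [Group G] [MulAction G L]
  {A B D T : Tw L} {R : FamRel G A B} {S : FamRel G A D} {W : ∀ k, Finpartition (D.obj k)}
  {U : FamRel G B T} {V : FamRel G D T}

lemma finite_glueLeft (hR : IsSub R) (hS : IsSub S) : (glueLeft R S W).Finite := by
  have := B.fin
  have := (glue R W).fin
  refine (Set.finite_univ.prod (((Set.finite_singleton (1 : G)).union
    (Set.Finite.image2 (fun g h => g * h⁻¹) (hS.finite.image fun x => x.2.1)
      (hR.finite.image fun x => x.2.1))).prod Set.finite_univ)).subset ?_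
  rintro ⟨j, γ, y | y⟩ h
  · obtain ⟨i, _, m, hi, hj, rfl, -⟩ := mem_glueLeft_inl.1 h
    exact ⟨trivial, Or.inr ⟨_, ⟨_, hi, rfl⟩, _, ⟨_, hj, rfl⟩, mul_inv_cancel_right γ m⟩, trivial⟩
  · exact ⟨trivial, Or.inl h.1, trivial⟩

variable (W U V) in
/-- The relation of the map out of the pushout given by maps out of `B` and `D`. -/
def glueDesc (R : FamRel G A B) : FamRel G (glue R W) T :=
  {x | match x with
    | (Sum.inl y, γ, l) => (y.1, γ, l) ∈ V ∧ γ⁻¹ • T.obj l ≤ y.2.1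
    | (Sum.inr j, γ, l) => (j.1, γ, l) ∈ U}

lemma mem_glueDesc_inl {y : Σ k, (W k).parts} {γ : G} {l : T.ι} :
    (Sum.inl y, γ, l) ∈ glueDesc W U V R ↔ (y.1, γ, l) ∈ V ∧ γ⁻¹ • T.obj l ≤ y.2.1 := Iff.rfl

lemma mem_glueDesc_inr {y : Compl R} {γ : G} {l : T.ι} :
    (Sum.inr y, γ, l) ∈ glueDesc W U V R ↔ (y.1, γ, l) ∈ U := Iff.rfl

lemma isSub_glueDesc (hU : IsSub U) (hV : IsSub V) : IsSub (glueDesc W U V R) where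
  finite := by
    have := (glue R W).fin
    refine (Set.finite_univ.prod ((hU.finite.image Prod.snd).union
      (hV.finite.image Prod.snd))).subset ?_
    rintro ⟨y | y, γ, l⟩ h
    · exact ⟨trivial, Or.inr ⟨_, h.1, rfl⟩⟩
    · exact ⟨trivial, Or.inl ⟨_, h, rfl⟩⟩
  le := by
    rintro (y | y) γ l h
    · exact h.2
    · exact hU.le h
  disj := by
    rintro (y | y) γ l γ' l' h h' hne
    · exact hV.disj h.1 h'.1 hne
    · exact hU.disj h h' hne

end Desc

section Pushout

variable {L : Type} [DistribLattice L] [OrderBot L] {G : Type*} [Group G] [MulAction G L]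
  [CovariantClass G L (· • ·) (· ≤ ·)] {A B D T : Tw L} {R : FamRel G A B} {S : FamRel G A D}
  {W : ∀ k, Finpartition (D.obj k)} {U : FamRel G B T} {V : FamRel G D T}

lemma isSub_glueRight : IsSub (glueRight R W) where
  finite := by
    have := D.fin
    have := (glue R W).fin
    refine (Set.finite_univ.prod ((Set.finite_singleton (1 : G)).prod Set.finite_univ)).subset ?_
    rintro ⟨k, γ, y | y⟩ h
    · exact ⟨trivial, h.1, trivial⟩
    · exact h.elim
  le := by
    rintro k γ (⟨k', w⟩ | y) h
    · obtain ⟨rfl, rfl⟩ := mem_glueRight_inl.1 h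
      rw [inv_one, one_smul]
      exact (W _).le w.2
    · exact h.elim
  disj := by
    rintro k γ (⟨k₁, w⟩ | y) γ' (⟨k₂, w'⟩ | y') h h' hne
    · obtain ⟨rfl, rfl⟩ := mem_glueRight_inl.1 h
      obtain ⟨rfl, hk : k = k₂⟩ := mem_glueRight_inl.1 h'
      subst hk
      refine disjoint_smul_iff_of_action.2 ((W k).disjoint w.2 w'.2 fun hw => hne ?_)
      rw [Subtype.ext hw]
    · exact h'.elim
    · exact h.elim
    · exact h.elim

lemma disjoint_of_mem_glueLeft_inl (hS : IsSub S) (hinj : IsInj R) {j : B.ι} {γ γ' : G}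
    {y y' : Σ k, (W k).parts} (h : (j, γ, Sum.inl y) ∈ glueLeft R S W)
    (h' : (j, γ', Sum.inl y') ∈ glueLeft R S W) (hne : (γ, y) ≠ (γ', y')) :
    Disjoint (γ⁻¹ • y.2.1) (γ'⁻¹ • y'.2.1) := by
  obtain ⟨k, w⟩ := y
  obtain ⟨k', w'⟩ := y'
  obtain ⟨i, _, m, hi, hj, rfl, -⟩ := mem_glueLeft_inl.1 h
  obtain ⟨i', _, m', hi', hj', rfl, -⟩ := mem_glueLeft_inl.1 h'
  obtain ⟨rfl, rfl⟩ := hinj hj hj'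
  by_cases heq : (γ * m, k) = (γ' * m, k')
  · obtain ⟨hγ, rfl⟩ := Prod.mk.inj heq
    obtain rfl := mul_right_cancel hγ
    refine disjoint_smul_iff_of_action.2 ((W k).disjoint w.2 w'.2 fun hw => hne ?_)
    rw [Subtype.ext hw]
  · have hdisj := hS.disj hi hi' heq
    rw [mul_inv_rev, mul_inv_rev, mul_smul, mul_smul, disjoint_smul_iff_of_action] at hdisj
    exact hdisj.mono (smul_le_smul_iff_of_action.2 ((W k).le w.2))
      (smul_le_smul_iff_of_action.2 ((W k').le w'.2))

lemma isSub_glueLeft (hR : IsSub R) (hS : IsSub S) (hinj : IsInj R) : IsSub (glueLeft R S W) where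
  finite := finite_glueLeft hR hS
  le := by
    rintro j γ (y | y) h
    · obtain ⟨-, -, -, -, -, -, hle⟩ := mem_glueLeft_inl.1 h
      exact hle
    · obtain ⟨rfl, rfl⟩ := mem_glueLeft_inr.1 h
      rw [inv_one, one_smul]
      exact le_rfl
  disj := by
    rintro j γ (y | y) γ' (y' | y') h h' hne
    · refine disjoint_of_mem_glueLeft_inl hS hinj h h' fun heq => hne ?_
      rw [(Prod.mk.inj heq).1, (Prod.mk.inj heq).2]
    · obtain ⟨_, _, _, -, hj, -⟩ := mem_glueLeft_inl.1 h
      obtain ⟨-, rfl⟩ := mem_glueLeft_inr.1 h'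
      exact (y'.2 _ _ hj).elim
    · obtain ⟨_, _, _, -, hj, -⟩ := mem_glueLeft_inl.1 h'
      obtain ⟨-, rfl⟩ := mem_glueLeft_inr.1 h
      exact (y.2 _ _ hj).elim
    · obtain ⟨rfl, rfl⟩ := mem_glueLeft_inr.1 h
      obtain ⟨rfl, hy⟩ := mem_glueLeft_inr.1 h'
      exact (hne (by rw [Subtype.ext hy])).elim

lemma comp_glueLeft_eq (hW : IsRefinement R S W) (hinj : IsInj R) :
    R.comp (glueLeft R S W) = S.comp (glueRight R W) := by
  ext ⟨i, γ, y | y⟩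
  · rw [mem_comp_glueRight_inl, mem_comp]
    constructor
    · rintro ⟨m, j, γ', hj, hy, rfl⟩
      obtain ⟨i', _, m', hi', hj', rfl, -⟩ := mem_glueLeft_inl.1 hy
      obtain ⟨rfl, rfl⟩ := hinj hj hj'
      exact hi'
    · intro hγ
      obtain ⟨m, j, hj, hle⟩ := hW.refines y.2.2 hγ
      refine ⟨m, j, γ * m⁻¹, hj, mem_glueLeft_inl.2 ⟨i, γ, m, hγ, hj, by group, ?_⟩, by group⟩
      rwa [inv_smul_le_iff_of_action, mul_smul]
  · rw [mem_comp_glueLeft_inr]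
    exact iff_of_false (y.2 _ _) notMem_comp_glueRight_inr

lemma IsRefinement.exists_part_of_mem (hW : IsRefinement R S W) (hU : IsSub U) (hV : IsSub V)
    (hcomm : R.comp U = S.comp V) {k : D.ι} {γ : G} {l : T.ι} (h : (k, γ, l) ∈ V) :
    ∃ w ∈ (W k).parts, γ⁻¹ • T.obj l ≤ w := by
  refine hW.maximal (smul_obj_ne_bot _ _ _) (hV.le h) fun i g hi => ?_
  obtain ⟨m, j, γ', hj, hl, hγ⟩ := mem_comp.1 (hcomm ▸ mem_comp.2 ⟨_, _, _, hi, h, rfl⟩ :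
    (i, γ * g, l) ∈ R.comp U)
  obtain rfl : γ' = γ * (g * m⁻¹) := by rw [← mul_assoc, hγ, mul_inv_cancel_right]
  refine ⟨m, j, hj, ?_⟩
  rw [← mul_smul, ← inv_smul_le_iff_of_action, ← mul_smul, ← mul_inv_rev]
  exact hU.le hl

lemma glueRight_comp_glueDesc (hW : IsRefinement R S W) (hU : IsSub U) (hV : IsSub V)
    (hcomm : R.comp U = S.comp V) : (glueRight R W).comp (glueDesc W U V R) = V := by
  ext ⟨k, γ, l⟩
  refine mem_glueRight_comp.trans ⟨fun ⟨w, h⟩ => h.1, fun h => ?_⟩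
  obtain ⟨w, hw, hle⟩ := hW.exists_part_of_mem hU hV hcomm h
  exact ⟨⟨w, hw⟩, h, hle⟩

lemma glueLeft_comp_glueDesc_subset (hR : IsSub R) (hU : IsSub U) (hcomm : R.comp U = S.comp V) :
    (glueLeft R S W).comp (glueDesc W U V R) ⊆ U := by
  rintro ⟨j, γ, l⟩ ⟨γ₁, y | y, γ₂, h, h', rfl : γ = γ₂ * γ₁⟩
  · obtain ⟨i, _, m, hi, hj, rfl, hle⟩ := mem_glueLeft_inl.1 h
    obtain ⟨hv, hle'⟩ := mem_glueDesc_inl.1 h'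
    obtain ⟨m', j', γ₃, hj', hl, hγ⟩ := mem_comp.1 (hcomm ▸ mem_comp.2 ⟨_, _, _, hi, hv, rfl⟩ :
      (i, γ₂ * (γ₁ * m), l) ∈ R.comp U)
    have le_left : (γ₂ * (γ₁ * m))⁻¹ • T.obj l ≤ m⁻¹ • B.obj j := by
      rw [mul_inv_rev, mul_inv_rev, mul_smul, mul_smul, smul_le_smul_iff_of_action]
      exact (smul_le_smul_iff_of_action.2 hle').trans hle
    have le_right : (γ₂ * (γ₁ * m))⁻¹ • T.obj l ≤ m'⁻¹ • B.obj j' := by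
      rw [hγ, mul_inv_rev, mul_smul, smul_le_smul_iff_of_action]
      exact hU.le hl
    obtain ⟨rfl, rfl⟩ := hR.eq_of_le hj hj' (smul_obj_ne_bot _ _ _) le_left le_right
    rw [← mul_assoc] at hγ
    rwa [mul_right_cancel hγ]
  · obtain ⟨rfl, rfl⟩ := mem_glueLeft_inr.1 h
    rwa [mul_one]

lemma subset_glueLeft_comp_glueDesc (hW : IsRefinement R S W) (hR : IsSub R) (hU : IsSub U)
    (hV : IsSub V) (hcomm : R.comp U = S.comp V) :
    U ⊆ (glueLeft R S W).comp (glueDesc W U V R) := by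
  rintro ⟨j, γ, l⟩ h
  by_cases hfresh : ∀ i g, (i, g, j) ∉ R
  · exact mem_glueLeft_comp.2 (mem_glueDesc_inr (y := ⟨j, hfresh⟩).2 h)
  push Not at hfresh
  obtain ⟨i, m, hj⟩ := hfresh
  obtain ⟨g, k, γ₂, hk, hl, hγ⟩ := mem_comp.1 (hcomm ▸ mem_comp.2 ⟨_, _, _, hj, h, rfl⟩ :
    (i, γ * m, l) ∈ S.comp V)
  obtain ⟨w, hw, hle⟩ := hW.exists_part_of_mem hU hV hcomm hl
  obtain ⟨m', j', hj', hle'⟩ := hW.refines hw hk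
  have le_left : (γ * m)⁻¹ • T.obj l ≤ m⁻¹ • B.obj j := by
    rw [mul_inv_rev, mul_smul, smul_le_smul_iff_of_action]
    exact hU.le h
  have le_right : (γ * m)⁻¹ • T.obj l ≤ m'⁻¹ • B.obj j' := by
    rw [hγ, mul_inv_rev, mul_smul, inv_smul_le_iff_of_action]
    exact hle.trans hle'
  obtain ⟨rfl, rfl⟩ := hR.eq_of_le hj hj' (smul_obj_ne_bot _ _ _) le_left le_right
  refine mem_comp.2 ⟨g * m⁻¹, Sum.inl ⟨k, w, hw⟩, γ₂, mem_glueLeft_inl.2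
    ⟨i, g, m, hk, hj, by group, ?_⟩, mem_glueDesc_inl.2 ⟨hl, hle⟩, ?_⟩
  · rwa [inv_smul_le_iff_of_action, mul_smul]
  · rw [← mul_assoc, ← hγ, mul_inv_cancel_right]

lemma eq_glueDesc {Q : FamRel G (glue R W) T} (hQ : IsSub Q) (hU : (glueLeft R S W).comp Q = U)
    (hV : (glueRight R W).comp Q = V) : Q = glueDesc W U V R := by
  subst hU hV
  ext ⟨⟨k, w⟩ | y, γ, l⟩
  · rw [mem_glueDesc_inl, mem_glueRight_comp]
    refine ⟨fun h => ⟨⟨w, h⟩, hQ.le h⟩, fun ⟨⟨w', h⟩, hle⟩ => ?_⟩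
    obtain rfl : w = w' := part_eq_of_le (smul_obj_ne_bot _ _ _) hle (hQ.le h)
    exact h
  · rw [mem_glueDesc_inr, mem_glueLeft_comp]

end Pushout

end FamRel

end ScissorsCongruence

namespace ScissorsCongruence

open FamRel

namespace FamRel

section Complement

variable {C : Type u} [Category.{v} C] {G : Type*} [Group G] {A B A' B' : Tw C}
  {R : FamRel G A B} {R' : FamRel G A' B'} {a : FamRel G A A'} {b : FamRel G B B'} {j : B.ι}
  {j' : B'.ι} {β : G}

lemma forall_notMem_of_comp_eq_left (hcomm : R.comp b = a.comp R') (ha : IsOnto a) (hb : IsInj b)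
    (hj : (j, β, j') ∈ b) (h : ∀ i g, (i, g, j) ∉ R) : ∀ i g, (i, g, j') ∉ R' := by
  intro i' m' hm'
  obtain ⟨i, α, hi⟩ := ha i'
  obtain ⟨m, k, γ, hm, hk, -⟩ := mem_comp.1 (hcomm ▸ mem_comp.2 ⟨_, _, _, hi, hm', rfl⟩ :
    (i, m' * α, j') ∈ R.comp b)
  obtain ⟨rfl, -⟩ := hb hk hj
  exact h _ _ hm

lemma forall_notMem_of_comp_eq_right (hcomm : R.comp b = a.comp R') (hj : (j, β, j') ∈ b)
    (h : ∀ i g, (i, g, j') ∉ R') : ∀ i g, (i, g, j) ∉ R := by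
  intro i m hm
  obtain ⟨_, i', _, -, hi', -⟩ := mem_comp.1 (hcomm ▸ mem_comp.2 ⟨_, _, _, hm, hj, rfl⟩ :
    (i, β * m, j') ∈ a.comp R')
  exact h _ _ hi'

end Complement

section GlueMap

variable {L : Type} [DistribLattice L] [OrderBot L] {G : Type*} [Group G]
  {A B D A' B' D' : Tw L} {R : FamRel G A B} {S : FamRel G A D} {W : ∀ k, Finpartition (D.obj k)}
  {R' : FamRel G A' B'} {S' : FamRel G A' D'} {W' : ∀ k, Finpartition (D'.obj k)}
  {a : FamRel G A A'} {b : FamRel G B B'} {d : FamRel G D D'}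
  {q : FamRel G (glue R W) (glue R' W')}

section Right

variable (hd : (glueRight R W).comp q = d.comp (glueRight R' W'))
include hd

lemma exists_inl_mem_iff {k : D.ι} {γ : G} {y : Σ k, (W' k).parts} :
    (∃ w, (Sum.inl ⟨k, w⟩, γ, Sum.inl y) ∈ q) ↔ (k, γ, y.1) ∈ d := by
  rw [← mem_comp_glueRight_inl (W := W'), ← hd, mem_glueRight_comp]

lemma inl_inr_notMem {x : Σ k, (W k).parts} {γ : G} {y : Compl R'} :
    (Sum.inl x, γ, Sum.inr y) ∉ q := fun h =>
  notMem_comp_glueRight_inr (V := d) (W := W') (hd ▸ mem_glueRight_comp.2 ⟨x.2, h⟩)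

end Right

section Left

variable [MulAction G L] (hb : (glueLeft R S W).comp q = b.comp (glueLeft R' S' W'))
include hb

lemma inr_inr_mem_iff {x : Compl R} {γ : G} {y : Compl R'} :
    (Sum.inr x, γ, Sum.inr y) ∈ q ↔ (x.1, γ, y.1) ∈ b := by
  rw [← mem_glueLeft_comp (S := S), hb, mem_comp_glueLeft_inr]

lemma inr_inl_notMem (hcomm : R.comp b = a.comp R') (ha : IsOnto a) (hinj : IsInj b)
    {x : Compl R} {γ : G} {y : Σ k, (W' k).parts} : (Sum.inr x, γ, Sum.inl y) ∉ q := by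
  intro h
  obtain ⟨β, j', γ', hj', hy, -⟩ := mem_comp.1 (hb ▸ mem_glueLeft_comp.2 h :
    (x.1, γ, Sum.inl y) ∈ b.comp (glueLeft R' S' W'))
  obtain ⟨i', -, m', -, hm', -⟩ := mem_glueLeft_inl.1 hy
  exact forall_notMem_of_comp_eq_left hcomm ha hinj hj' x.2 _ _ hm'

end Left

variable [MulAction G L]

lemma isOnto_of_glue_comp (hcomm : R.comp b = a.comp R')
    (hb : (glueLeft R S W).comp q = b.comp (glueLeft R' S' W'))
    (hd : (glueRight R W).comp q = d.comp (glueRight R' W')) (b_onto : IsOnto b)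
    (d_onto : IsOnto d) : IsOnto q := by
  rintro (y | y)
  · obtain ⟨k, γ, hk⟩ := d_onto y.1
    obtain ⟨w, hw⟩ := (exists_inl_mem_iff hd).2 hk
    exact ⟨_, _, hw⟩
  · obtain ⟨j, β, hj⟩ := b_onto y.1
    exact ⟨Sum.inr ⟨j, forall_notMem_of_comp_eq_right hcomm hj y.2⟩, β,
      (inr_inr_mem_iff hb).2 hj⟩

variable [CovariantClass G L (· • ·) (· ≤ ·)]

lemma isInj_of_glue_comp (hq : IsSub q) (hcomm : R.comp b = a.comp R')
    (hb : (glueLeft R S W).comp q = b.comp (glueLeft R' S' W'))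
    (hd : (glueRight R W).comp q = d.comp (glueRight R' W')) (a_onto : IsOnto a)
    (b_inj : IsInj b) (d_inj : IsInj d) : IsInj q := by
  rintro (⟨k, w⟩ | x) γ (⟨k', w'⟩ | x') γ' (y | y) h h'
  · obtain ⟨rfl, rfl⟩ := d_inj ((exists_inl_mem_iff hd).1 ⟨w, h⟩)
      ((exists_inl_mem_iff hd).1 ⟨w', h'⟩)
    obtain rfl : w = w' := part_eq_of_le (smul_obj_ne_bot _ _ _) (hq.le h) (hq.le h')
    exact ⟨rfl, rfl⟩
  · exact (inl_inr_notMem hd h).elim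
  · exact (inr_inl_notMem hb hcomm a_onto b_inj h').elim
  · exact (inl_inr_notMem hd h).elim
  · exact (inr_inl_notMem hb hcomm a_onto b_inj h).elim
  · exact (inl_inr_notMem hd h').elim
  · exact (inr_inl_notMem hb hcomm a_onto b_inj h).elim
  · obtain ⟨hx, rfl⟩ := b_inj ((inr_inr_mem_iff hb).1 h) ((inr_inr_mem_iff hb).1 h')
    exact ⟨congrArg Sum.inr (Subtype.ext hx), rfl⟩

lemma le_of_isCov_glueRight_comp {T : Tw L} {Q : FamRel G (glue R W) T} (hQ : IsSub Q)
    (hsub : IsSub ((glueRight R W).comp Q)) (hcov : IsCov ((glueRight R W).comp Q))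
    {k : D.ι} {w : (W k).parts} {c : L}
    (hc : ∀ γ l, (Sum.inl ⟨k, w⟩, γ, l) ∈ Q → γ⁻¹ • T.obj l ≤ c) : (w : L) ≤ c := by
  rw [← inf_eq_right.2 ((W k).le w.2)]
  refine hcov.inf_le hsub fun γ l h => ?_
  obtain ⟨w', hw'⟩ := mem_glueRight_comp.1 h
  by_cases heq : w' = w
  · subst heq
    exact inf_le_left.trans (hc γ l hw')
  · have hdisj := (W k).disjoint w'.2 w.2 (heq ∘ Subtype.ext)
    exact (hdisj.mono_left (hQ.le hw')).le_bot.trans bot_le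

lemma isCov_of_glue_comp (hq : IsSub q) (hsub : IsSub (d.comp (glueRight R' W')))
    (hcomm : R.comp b = a.comp R')
    (hb : (glueLeft R S W).comp q = b.comp (glueLeft R' S' W'))
    (hd : (glueRight R W).comp q = d.comp (glueRight R' W')) (a_onto : IsOnto a)
    (b_inj : IsInj b) (b_cov : IsCov b) (d_cov : IsCov d) : IsCov q := by
  rintro (⟨k, w⟩ | x) c hc
  · exact le_of_isCov_glueRight_comp hq (hd ▸ hsub) (hd ▸ d_cov.comp isCov_glueRight) hc
  · refine b_cov x.1 c fun β j hj => hc β (Sum.inr ⟨j, ?_⟩) ((inr_inr_mem_iff hb).2 hj)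
    exact forall_notMem_of_comp_eq_left hcomm a_onto b_inj hj x.2

end GlueMap

end FamRel

namespace Fam

variable {G L : Type} [Group G] [DistribLattice L] [OrderBot L] [DoubleCategory.{0, w} L]
  [MulAction G L] [CovariantClass G L (· • ·) (· ≤ ·)] [IsActionDoubleCategory G L]
  {A B D : Fam G L} {f : A ⟶ B} {g : A ⟶ D} {W : ∀ k, Finpartition (D.tw.obj k)}

/-- The map from `B` to the pushout of `f : A ⟶ B` and `g : A ⟶ D`. -/
def glueInl (hf : cof G L f) (g : A ⟶ D) (W : ∀ k, Finpartition (D.tw.obj k)) :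
    B ⟶ (⟨glue (toRel f) W⟩ : Fam G L) :=
  ofRel (glueLeft (toRel f) (toRel g) W)
    (isSub_glueLeft (isSub_toRel f) (isSub_toRel g) ((cof_iff f).1 hf).2)

/-- The map from `D` to the pushout of `f : A ⟶ B` and `g : A ⟶ D`. -/
def glueInr (f : A ⟶ B) (W : ∀ k, Finpartition (D.tw.obj k)) :
    D ⟶ (⟨glue (toRel f) W⟩ : Fam G L) :=
  ofRel (glueRight (toRel f) W) isSub_glueRight

@[simp] lemma toRel_glueInl (hf : cof G L f) :
    toRel (glueInl hf g W) = glueLeft (toRel f) (toRel g) W := toRel_ofRel _ _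

@[simp] lemma toRel_glueInr : toRel (glueInr f W) = glueRight (toRel f) W := toRel_ofRel _ _

lemma cof_glueInr : cof G L (glueInr f W) :=
  (cof_iff _).2 (toRel_glueInr (f := f) (W := W) ▸ ⟨isCov_glueRight, isInj_glueRight⟩)

lemma isPushout_glue (hf : cof G L f) (hW : IsRefinement (toRel f) (toRel g) W) :
    IsPushout f g (glueInl hf g W) (glueInr f W) := by
  have hcomm (s : PushoutCocone f g) :
      (toRel f).comp (toRel s.inl) = (toRel g).comp (toRel s.inr) := by
    rw [← toRel_comp, ← toRel_comp, s.condition]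
  refine ⟨⟨toRel_injective ?_⟩, ⟨PushoutCocone.IsColimit.mk _
    (fun s => ofRel (glueDesc W (toRel s.inl) (toRel s.inr) (toRel f))
      (isSub_glueDesc (isSub_toRel _) (isSub_toRel _)))
    (fun s => toRel_injective ?_) (fun s => toRel_injective ?_) fun s m hl hr =>
      toRel_injective ?_⟩⟩
  · rw [toRel_comp, toRel_comp, toRel_glueInl, toRel_glueInr]
    exact comp_glueLeft_eq hW ((cof_iff f).1 hf).2
  · rw [toRel_comp, toRel_ofRel, toRel_glueInl]
    exact (glueLeft_comp_glueDesc_subset (isSub_toRel _) (isSub_toRel _) (hcomm s)).antisymm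
      (subset_glueLeft_comp_glueDesc hW (isSub_toRel _) (isSub_toRel _) (isSub_toRel _) (hcomm s))
  · rw [toRel_comp, toRel_ofRel, toRel_glueInr]
    exact glueRight_comp_glueDesc hW (isSub_toRel _) (isSub_toRel _) (hcomm s)
  · rw [toRel_ofRel]
    refine eq_glueDesc (S := toRel g) (isSub_toRel m) ?_ ?_
    · rw [← hl, toRel_comp, toRel_glueInl]
    · rw [← hr, toRel_comp, toRel_glueInr]

lemma exists_isRefinement_toRel (hf : cof G L f) (g : A ⟶ D) :
    ∃ W, IsRefinement (toRel f) (toRel g) W :=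
  exists_isRefinement (isSub_toRel f) ((cof_iff f).1 hf).1 (isSub_toRel g)

lemma weq_glue {A' B' D' : Fam G L} {f' : A' ⟶ B'} {g' : A' ⟶ D'}
    {W' : ∀ k, Finpartition (D'.tw.obj k)} (hf : cof G L f) (hf' : cof G L f') {a : A ⟶ A'}
    {b : B ⟶ B'} {d : D ⟶ D'}
    {q : (⟨glue (toRel f) W⟩ : Fam G L) ⟶ ⟨glue (toRel f') W'⟩} (ha : weq G L a)
    (hb : weq G L b) (hd : weq G L d) (hcomm : f ≫ b = a ≫ f')
    (hleft : glueInl hf g W ≫ q = b ≫ glueInl hf' g' W')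
    (hright : glueInr f W ≫ q = d ≫ glueInr f' W') : weq G L q := by
  have hsub := isSub_toRel (d ≫ glueInr f' W')
  replace hcomm := congrArg toRel hcomm
  replace hleft := congrArg toRel hleft
  replace hright := congrArg toRel hright
  simp only [toRel_comp, toRel_glueInl, toRel_glueInr] at hsub hcomm hleft hright
  obtain ⟨-, -, a_onto⟩ := (weq_iff a).1 ha
  obtain ⟨b_cov, b_inj, b_onto⟩ := (weq_iff b).1 hb
  obtain ⟨d_cov, d_inj, d_onto⟩ := (weq_iff d).1 hd
  have hq := isSub_toRel q
  exact (weq_iff q).2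
    ⟨isCov_of_glue_comp hq hsub hcomm hleft hright a_onto b_inj b_cov d_cov,
      isInj_of_glue_comp hq hcomm hleft hright a_onto b_inj d_inj,
      isOnto_of_glue_comp hcomm hleft hright b_onto d_onto⟩

variable (G L) in
theorem isWaldhausen : IsWaldhausen (cof G L) (weq G L) where
  hasZero := ⟨⟨zero G L, isZero_zero⟩⟩
  cof_of_iso f _ := (weq_of_isIso f).cof
  cof_comp _ _ hf hg := cof_comp hf hg
  cof_of_zero f hZ := by
    have := (isZero_iff _).1 hZ
    exact (cof_iff f).2 ⟨fun i => isEmptyElim i, fun i => isEmptyElim i⟩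
  hasPushout f g hf := by
    obtain ⟨W, hW⟩ := exists_isRefinement_toRel hf g
    exact (isPushout_glue hf hW).hasPushout
  cof_pushout {A B D Q f g i j} h hf := by
    obtain ⟨W, hW⟩ := exists_isRefinement_toRel hf g
    rw [← IsPushout.inr_isoIsPushout_hom _ _ (isPushout_glue hf hW) h]
    exact cof_comp cof_glueInr (weq_of_isIso _).cof
  we_of_iso f _ := weq_of_isIso f
  we_comp _ _ hf hg := weq_comp hf hg
  gluing {A B D Q A' B' D' Q' f g i j f' g' i' j'} a b d q h h' hf hf' ha hb hd
      hfb _ hiq hjq := by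
    obtain ⟨W, hW⟩ := exists_isRefinement_toRel hf g
    obtain ⟨W', hW'⟩ := exists_isRefinement_toRel hf' g'
    let α := IsPushout.isoIsPushout _ _ (isPushout_glue hf hW) h
    let β := IsPushout.isoIsPushout _ _ (isPushout_glue hf' hW') h'
    have hq : weq G L (α.hom ≫ q ≫ β.inv) := by
      refine weq_glue hf hf' ha hb hd hfb (g := g) (g' := g') ?_ ?_
      · rw [IsPushout.inl_isoIsPushout_hom_assoc, reassoc_of% hiq,
          IsPushout.inl_isoIsPushout_inv]
      · rw [IsPushout.inr_isoIsPushout_hom_assoc, reassoc_of% hjq,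
          IsPushout.inr_isoIsPushout_inv]
    have factor : q = α.inv ≫ (α.hom ≫ q ≫ β.inv) ≫ β.hom := by
      simp only [Category.assoc, Iso.inv_hom_id, Category.comp_id, Iso.inv_hom_id_assoc]
    rw [factor]
    exact weq_comp (weq_of_isIso _) (weq_comp hq (weq_of_isIso _))

end Fam

end ScissorsCongruence

namespace ScissorsCongruence

namespace K0

variable {E : Type u} [Category.{v} E] {cof we : MorphismProperty E}

lemma of_eq_of_we {A B : E} {f : A ⟶ B} (hf : we f) : of cof we A = of cof we B :=
  QuotientAddGroup.eq_iff_sub_mem.2 (AddSubgroup.subset_closure (Or.inl ⟨A, B, f, hf, rfl⟩))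

lemma of_eq_add_of_isPushout {A B Q Z : E} {f : A ⟶ B} {z : A ⟶ Z} {g : B ⟶ Q} {y : Z ⟶ Q}
    (hf : cof f) (hZ : IsZero Z) (h : IsPushout f z g y) :
    of cof we B = of cof we A + of cof we Q :=
  QuotientAddGroup.eq_iff_sub_mem.2 (AddSubgroup.subset_closure
    (Or.inr ⟨A, B, Q, Z, f, z, g, y, hf, hZ, h, rfl⟩))

variable {Γ : Type*} [AddCommGroup Γ]

/-- The homomorphism on `K₀` induced by a function on objects which respects weak equivalences and
is additive on cofibration sequences. -/
def lift (φ : E → Γ) (hwe : ∀ ⦃A B : E⦄ (f : A ⟶ B), we f → φ A = φ B)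
    (hcof : ∀ ⦃A B Q Z : E⦄ {f : A ⟶ B} {z : A ⟶ Z} {g : B ⟶ Q} {y : Z ⟶ Q}, cof f → IsZero Z →
      IsPushout f z g y → φ B = φ A + φ Q) : K0 cof we →+ Γ :=
  QuotientAddGroup.lift _ (FreeAbelianGroup.lift φ) <| (AddSubgroup.closure_le _).2 <| by
    rintro _ (⟨A, B, f, hf, rfl⟩ | ⟨A, B, Q, Z, f, z, g, y, hf, hZ, h, rfl⟩)
    · simpa [sub_eq_zero] using hwe f hf
    · simpa [sub_eq_zero] using hcof hf hZ h

@[simp] lemma lift_of {φ : E → Γ} {hwe : ∀ ⦃A B : E⦄ (f : A ⟶ B), we f → φ A = φ B}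
    {hcof : ∀ ⦃A B Q Z : E⦄ {f : A ⟶ B} {z : A ⟶ Z} {g : B ⟶ Q} {y : Z ⟶ Q}, cof f → IsZero Z →
      IsPushout f z g y → φ B = φ A + φ Q} (A : E) : lift φ hwe hcof (of cof we A) = φ A :=
  FreeAbelianGroup.lift_apply_of φ A

end K0

/-- A finitely additive function on a lattice with least element, invariant under the action
of `G`. -/
structure InvariantValuation (G L Γ : Type*) [SemilatticeSup L] [OrderBot L] [SMul G L]
    [AddCommGroup Γ] where
  toFun : L → Γ
  map_sup_of_disjoint {P Q : L} : Disjoint P Q → toFun (P ⊔ Q) = toFun P + toFun Q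
  map_smul (g : G) (P : L) : toFun (g • P) = toFun P

namespace InvariantValuation

instance {G L Γ : Type*} [SemilatticeSup L] [OrderBot L] [SMul G L] [AddCommGroup Γ] :
    CoeFun (InvariantValuation G L Γ) fun _ => L → Γ := ⟨toFun⟩

section

variable {G L Γ : Type*} [SemilatticeSup L] [OrderBot L] [SMul G L] [AddCommGroup Γ]
  (μ : InvariantValuation G L Γ)

lemma map_bot : μ ⊥ = 0 := by
  have h := μ.map_sup_of_disjoint (disjoint_bot_left (a := (⊥ : L)))
  rwa [bot_sup_eq, left_eq_add] at h

/-- Every invariant valuation with values in a group of the universe `w` factors uniquely through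
the universal one. -/
structure IsUniversal : Prop where
  closure_range : AddSubgroup.closure (Set.range μ) = ⊤
  exists_lift {Δ : Type w} [AddCommGroup Δ] (ν : InvariantValuation G L Δ) :
    ∃ φ : Γ →+ Δ, ∀ P, φ (μ P) = ν P

end

lemma map_finset_sup {G L Γ : Type*} [DistribLattice L] [OrderBot L] [SMul G L] [AddCommGroup Γ]
    (μ : InvariantValuation G L Γ) {ι : Type*} {t : Finset ι} {U : ι → L}
    (h : (t : Set ι).PairwiseDisjoint U) : μ (t.sup U) = ∑ i ∈ t, μ (U i) := by
  classical
  induction t using Finset.induction_on with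
  | empty => exact μ.map_bot
  | insert a t ha ih =>
    rw [Finset.coe_insert, Set.pairwiseDisjoint_insert_of_notMem (Finset.mem_coe.not.2 ha)] at h
    rw [Finset.sup_insert, Finset.sum_insert ha,
      μ.map_sup_of_disjoint (Finset.disjoint_sup_right.2 h.2), ih h.1]

end InvariantValuation

namespace FamRel

variable {L : Type u} {G Γ : Type*} [Group G] [DistribLattice L] [OrderBot L] [MulAction G L]
  [AddCommGroup Γ] (μ : InvariantValuation G L Γ) {A B : Tw L} {R : FamRel G A B}

lemma map_obj_eq_sum [DecidableEq A.ι] (hR : IsSub R) (hcov : IsCov R) (i : A.ι) :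
    μ (A.obj i) = ∑ x ∈ hR.finite.toFinset with x.1 = i, μ (B.obj x.2.2) := by
  have hsup : A.obj i =
      {x ∈ hR.finite.toFinset | x.1 = i}.sup fun x => x.2.1⁻¹ • B.obj x.2.2 := by
    refine le_antisymm (hcov i _ fun g j hj => ?_) (Finset.sup_le fun x hx => ?_)
    · exact Finset.le_sup (f := fun x : A.ι × G × B.ι => x.2.1⁻¹ • B.obj x.2.2) (b := (i, g, j))
        (Finset.mem_filter.2 ⟨hR.finite.mem_toFinset.2 hj, rfl⟩)
    · obtain ⟨hxR, rfl⟩ := Finset.mem_filter.1 hx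
      exact hR.le (hR.finite.mem_toFinset.1 hxR)
  rw [hsup, μ.map_finset_sup]
  · exact Finset.sum_congr rfl fun x _ => μ.map_smul _ _
  · rintro ⟨i₁, g, j⟩ hx ⟨i₂, g', j'⟩ hx' hne
    simp only [Finset.coe_filter, Set.Finite.mem_toFinset, Set.mem_ofPred_eq] at hx hx'
    obtain ⟨hx, rfl⟩ := hx
    obtain ⟨hx', rfl⟩ := hx'
    exact hR.disj hx hx' fun h => hne (Prod.ext rfl h)

lemma finsum_map_obj_eq (hR : IsSub R) (hcov : IsCov R) (hinj : IsInj R) :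
    ∑ᶠ i, μ (A.obj i) = ∑ᶠ j ∈ {j | ∃ i g, (i, g, j) ∈ R}, μ (B.obj j) := by
  classical
  have := A.fin
  cases nonempty_fintype A.ι
  have himage : (fun x : A.ι × G × B.ι => x.2.2) '' R = {j | ∃ i g, (i, g, j) ∈ R} := by
    ext j
    exact ⟨fun ⟨x, hx, h⟩ => ⟨x.1, x.2.1, h ▸ hx⟩, fun ⟨i, g, h⟩ => ⟨_, h, rfl⟩⟩
  have hinjOn : R.InjOn fun x => x.2.2 := by
    rintro ⟨i, g, j⟩ hx ⟨i', g', j'⟩ hx' (rfl : j = j')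
    obtain ⟨rfl, rfl⟩ := hinj hx hx'
    rfl
  calc ∑ᶠ i, μ (A.obj i) = ∑ i, ∑ x ∈ hR.finite.toFinset with x.1 = i, μ (B.obj x.2.2) := by
        rw [finsum_eq_sum_of_fintype]
        exact Finset.sum_congr rfl fun i _ => map_obj_eq_sum μ hR hcov i
    _ = ∑ x ∈ hR.finite.toFinset, μ (B.obj x.2.2) := Finset.sum_fiberwise _ _ _
    _ = ∑ᶠ x ∈ R, μ (B.obj x.2.2) := (finsum_mem_eq_finite_toFinset_sum _ _).symm
    _ = ∑ᶠ j ∈ {j | ∃ i g, (i, g, j) ∈ R}, μ (B.obj j) := by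
        rw [← himage, finsum_mem_image hinjOn]

end FamRel

namespace Fam

open FamRel

variable {G L : Type} {Γ : Type*} [Group G] [DistribLattice L] [OrderBot L]
  [DoubleCategory.{0, w} L] [MulAction G L] [CovariantClass G L (· • ·) (· ≤ ·)]
  [IsActionDoubleCategory G L] [AddCommGroup Γ] (μ : InvariantValuation G L Γ) {A B : Fam G L}

lemma finsum_eq_of_weq {f : A ⟶ B} (hf : weq G L f) :
    ∑ᶠ i, μ (A.tw.obj i) = ∑ᶠ j, μ (B.tw.obj j) := by
  obtain ⟨hcov, hinj, honto⟩ := (weq_iff f).1 hf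
  have huniv : {j | ∃ i g, (i, g, j) ∈ toRel f} = Set.univ := Set.eq_univ_of_forall honto
  rw [finsum_map_obj_eq μ (isSub_toRel f) hcov hinj, huniv, finsum_mem_univ]

lemma finsum_eq_add_of_cof {Z : Fam G L} {f : A ⟶ B} (hf : cof G L f) (hZ : IsZero Z)
    (W : ∀ k, Finpartition (Z.tw.obj k)) :
    ∑ᶠ j, μ (B.tw.obj j) =
      ∑ᶠ i, μ (A.tw.obj i) + ∑ᶠ k, μ ((glue (toRel f) W).obj k) := by
  have := (isZero_iff Z).1 hZ
  have := B.tw.fin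
  obtain ⟨hcov, hinj⟩ := (cof_iff f).1 hf
  let e : FamRel.Compl (toRel f) ≃ (glue (toRel f) W).ι := (Equiv.emptySum _ _).symm
  have hglue : ∑ᶠ k, μ ((glue (toRel f) W).obj k) =
      ∑ᶠ j ∈ Set.univ \ {j | ∃ i g, (i, g, j) ∈ toRel f}, μ (B.tw.obj j) := by
    have hcompl : Set.univ \ {j | ∃ i g, (i, g, j) ∈ toRel f} =
        {j | ∀ i g, (i, g, j) ∉ toRel f} := by
      ext j
      simp only [Set.mem_sdiff, Set.mem_univ, true_and, Set.mem_ofPred_eq, not_exists]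
    rw [hcompl, ← finsum_set_coe_eq_finsum_mem, ← finsum_comp_equiv e]
    rfl
  rw [finsum_map_obj_eq μ (isSub_toRel f) hcov hinj, hglue,
    finsum_mem_add_sdiff (Set.subset_univ _) Set.finite_univ, finsum_mem_univ]

variable (G L) in
/-- The homomorphism on `K₀` which adds up the values of an invariant valuation. -/
noncomputable def k0Sum : K0 (cof G L) (weq G L) →+ Γ :=
  K0.lift (fun A => ∑ᶠ i, μ (A.tw.obj i)) (fun _ _ _ hf => finsum_eq_of_weq μ hf)
    fun A B Q Z f z g y hf hZ h => by
      obtain ⟨W, hW⟩ := exists_isRefinement_toRel hf z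
      rw [finsum_eq_add_of_cof μ hf hZ W, ← finsum_eq_of_weq μ
        (weq_of_isIso (IsPushout.isoIsPushout _ _ (isPushout_glue hf hW) h).hom)]

end Fam

lemma closure_range_mk_of {α : Type*} (N : AddSubgroup (FreeAbelianGroup α)) :
    AddSubgroup.closure (Set.range fun a : α =>
      (QuotientAddGroup.mk (FreeAbelianGroup.of a) : FreeAbelianGroup α ⧸ N)) = ⊤ := by
  refine (AddSubgroup.eq_top_iff' _).2 fun x => ?_
  obtain ⟨z, rfl⟩ := QuotientAddGroup.mk_surjective x
  induction z using FreeAbelianGroup.induction_on with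
  | zero => exact zero_mem _
  | of a => exact AddSubgroup.subset_closure ⟨a, rfl⟩
  | neg a ha => exact neg_mem ha
  | add y z hy hz => exact add_mem hy hz

namespace InvariantValuation.IsUniversal

variable {G L : Type*} [SemilatticeSup L] [OrderBot L] [SMul G L]

lemma exists_addEquiv {Γ : Type v} {Δ : Type w} [AddCommGroup Γ] [AddCommGroup Δ]
    {μ : InvariantValuation G L Γ} {ν : InvariantValuation G L Δ} (hμ : IsUniversal.{w} μ)
    (hν : IsUniversal.{v} ν) : ∃ e : Γ ≃+ Δ, ∀ P, e (μ P) = ν P := by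
  obtain ⟨φ, hφ⟩ := hμ.exists_lift ν
  obtain ⟨ψ, hψ⟩ := hν.exists_lift μ
  refine ⟨AddMonoidHom.toAddEquiv φ ψ ?_ ?_, hφ⟩
  · refine AddMonoidHom.eq_of_eqOn_dense hμ.closure_range ?_
    rintro _ ⟨P, rfl⟩
    exact (congrArg ψ (hφ P)).trans (hψ P)
  · refine AddMonoidHom.eq_of_eqOn_dense hν.closure_range ?_
    rintro _ ⟨P, rfl⟩
    exact (congrArg φ (hψ P)).trans (hφ P)

end InvariantValuation.IsUniversal

namespace FamRel

section Matching

variable {L : Type u} {G : Type*} [PartialOrder L] {A B : Tw L}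

/-- The relation which matches the member `A.obj i` with its translate `B.obj (e i)` by `g i`. -/
def matching (e : A.ι → B.ι) (g : A.ι → G) : FamRel G A B :=
  Set.range fun i => (i, g i, e i)

variable {e : A.ι → B.ι} {g : A.ι → G}

lemma mem_matching {i : A.ι} {k : G} {j : B.ι} :
    (i, k, j) ∈ matching e g ↔ g i = k ∧ e i = j := by
  simp only [matching, Set.mem_range, Prod.mk.injEq, exists_eq_left]

lemma isInj_matching (he : Function.Injective e) : IsInj (matching e g) := by
  intro i k i' k' j hj hj'
  obtain ⟨rfl, rfl⟩ := mem_matching.1 hj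
  obtain ⟨rfl, hi⟩ := mem_matching.1 hj'
  obtain rfl := he hi
  exact ⟨rfl, rfl⟩

variable [Group G] [MulAction G L] (h : ∀ i, g i • A.obj i = B.obj (e i))
include h

lemma isCov_matching : IsCov (matching e g) := by
  intro i c hc
  have hle := hc _ _ (mem_matching.2 ⟨rfl, rfl⟩)
  rwa [← h, inv_smul_smul] at hle

lemma isSub_matching [OrderBot L] : IsSub (matching e g) where
  finite := have := A.fin; Set.finite_range _
  le i k j hj := by
    obtain ⟨rfl, rfl⟩ := mem_matching.1 hj
    rw [← h, inv_smul_smul]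
  disj i k j k' j' hj hj' hne := by
    obtain ⟨rfl, rfl⟩ := mem_matching.1 hj
    obtain ⟨rfl, rfl⟩ := mem_matching.1 hj'
    exact (hne rfl).elim

end Matching

end FamRel

namespace Fam

open FamRel

variable {G L : Type} [Group G] [DistribLattice L] [OrderBot L] [DoubleCategory.{0, w} L]
  [MulAction G L] [CovariantClass G L (· • ·) (· ≤ ·)] [IsActionDoubleCategory G L]
  {A B D : Fam G L}

/-- The class of a family in `K₀`. -/
noncomputable abbrev k0Class (A : Fam G L) : K0 (cof G L) (weq G L) := K0.of _ _ A

lemma k0Class_eq_of_equiv (e : A.tw.ι ≃ B.tw.ι) (g : A.tw.ι → G)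
    (h : ∀ i, g i • A.tw.obj i = B.tw.obj (e i)) : k0Class A = k0Class B := by
  refine K0.of_eq_of_we (f := ofRel (matching e g) (isSub_matching h)) ?_
  rw [weq_iff, toRel_ofRel]
  exact ⟨isCov_matching h, isInj_matching e.injective,
    fun j => ⟨e.symm j, _, mem_matching.2 ⟨rfl, e.apply_symm_apply j⟩⟩⟩

lemma k0Class_eq_add {e : A.tw.ι → B.tw.ι} {e' : D.tw.ι → B.tw.ι} (he : Function.Injective e)
    (he' : Function.Injective e') (hcompl : IsCompl (Set.range e) (Set.range e'))
    (h : ∀ i, A.tw.obj i = B.tw.obj (e i)) (h' : ∀ k, D.tw.obj k = B.tw.obj (e' k)) :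
    k0Class B = k0Class A + k0Class D := by
  have one_smul_obj (i : A.tw.ι) : (1 : G) • A.tw.obj i = B.tw.obj (e i) :=
    (one_smul _ _).trans (h i)
  let f : A ⟶ B := ofRel (matching e (1 : A.tw.ι → G)) (isSub_matching one_smul_obj)
  have hf : cof G L f :=
    (cof_iff f).2 <| by
      rw [toRel_ofRel]
      exact ⟨isCov_matching one_smul_obj, isInj_matching he⟩
  have hrange (j : B.tw.ι) : j ∈ Set.range e' ↔ ∀ i g, (i, g, j) ∉ toRel f := by
    rw [← hcompl.compl_eq]
    simp only [f, toRel_ofRel, mem_matching, Set.mem_compl_iff, Set.mem_range, not_exists]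
    exact ⟨fun hj i _ h => hj i h.2, fun hj i h => hj i _ ⟨rfl, h⟩⟩
  obtain ⟨W, hW⟩ := exists_isRefinement_toRel hf (isZero_zero.from_ A)
  let E : D.tw.ι ≃ (glue (toRel f) W).ι :=
    ((Equiv.ofInjective e' he').trans (Equiv.subtypeEquivRight hrange)).trans
      (Equiv.emptySum (Σ k : Empty, (W k).parts) _).symm
  have hD : k0Class D = k0Class ⟨glue (toRel f) W⟩ :=
    k0Class_eq_of_equiv E 1 fun k => (one_smul _ _).trans (h' k)
  rw [hD]
  exact K0.of_eq_add_of_isPushout hf isZero_zero (isPushout_glue hf hW)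

lemma k0Class_eq_zero [IsEmpty A.tw.ι] : k0Class A = 0 := by
  have h : k0Class A = k0Class A + k0Class A := k0Class_eq_add (e := id) (e' := id)
    Function.injective_id Function.injective_id
    ⟨Set.disjoint_iff.2 fun i _ => isEmptyElim i, codisjoint_iff.2 (Subsingleton.elim _ _)⟩
    (fun i => rfl) fun i => rfl
  rwa [left_eq_add] at h

/-- The family with the given members. -/
def ofMembers {ι : Type} [Finite ι] (a : ι → L) (ha : ∀ i, IsPolytope (a i)) : Fam G L :=
  ⟨⟨ι, inferInstance, a, ha⟩⟩

variable (G) in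
/-- The family with one member. -/
abbrev single (P : L) (hP : IsPolytope P) : Fam G L :=
  SC.single (IsActionDoubleCategory.isPolytopeComplex G L) P hP

lemma k0Class_ofMembers {ι : Type} [Finite ι] (a : ι → L) (ha : ∀ i, IsPolytope (a i)) :
    k0Class (ofMembers a ha : Fam G L) = ∑ᶠ i, k0Class (single G (a i) (ha i)) := by
  revert a ha
  refine Finite.induction_empty_option (P := fun ι => ∀ [Finite ι] (a : ι → L)
    (ha : ∀ i, IsPolytope (a i)), k0Class (ofMembers a ha : Fam G L) =
      ∑ᶠ i, k0Class (single G (a i) (ha i))) ?_ ?_ ?_ ι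
  · intro ι κ e ih _ a ha
    have := Finite.of_equiv κ e.symm
    rw [← finsum_comp_equiv e]
    exact (k0Class_eq_of_equiv (A := ofMembers (a ∘ e) fun i => ha (e i))
      (B := ofMembers a ha) e 1 fun i => one_smul _ _).symm.trans (ih _ _)
  · intro _ a ha
    rw [finsum_of_isEmpty]
    have : IsEmpty (ofMembers a ha : Fam G L).tw.ι := inferInstanceAs (IsEmpty PEmpty)
    exact k0Class_eq_zero
  · intro ι _ ih _ a ha
    rw [finsum_option (Set.toFinite _), ← ih (fun i => a (some i)) fun i => ha (some i), add_comm]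
    have isCompl_range_some : IsCompl (Set.range (some : ι → Option ι))
        (Set.range fun _ : Unit => none) := by
      rw [Set.range_const]
      exact Set.isCompl_range_some_none ι
    exact k0Class_eq_add (e := some) (e' := fun _ : Unit => none) (Option.some_injective _)
      (fun _ _ _ => rfl) isCompl_range_some (fun i => rfl) fun _ => rfl

lemma k0Class_single_eq {ι : Type} [Finite ι] {P : L} {a : ι → L} (hP : IsPolytope P)
    (ha : ∀ i, IsPolytope (a i)) (hdisj : Pairwise (Function.onFun Disjoint a))
    (hlub : IsLUB (Set.range a) P) :
    k0Class (single G P hP) = k0Class (ofMembers a ha) := by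
  let R : FamRel G (single G P hP).tw (ofMembers a ha : Fam G L).tw := {x | x.2.1 = 1}
  have hsub : IsSub R :=
    { finite := by
        refine (Set.finite_range fun i : ι => ((), (1 : G), i)).subset ?_
        rintro ⟨_, _, i⟩ (rfl : _ = 1)
        exact ⟨i, rfl⟩
      le := by
        rintro _ _ i (rfl : _ = 1)
        rw [inv_one, one_smul]
        exact hlub.1 ⟨i, rfl⟩
      disj := by
        rintro _ _ i _ i' (rfl : _ = 1) (rfl : _ = 1) hne
        rw [inv_one, one_smul, one_smul]
        exact hdisj fun h => hne (congrArg _ h) }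
  refine K0.of_eq_of_we (f := ofRel R hsub) ((weq_iff _).2 ?_)
  rw [toRel_ofRel]
  refine ⟨fun _ c hc => hlub.2 ?_, ?_, fun i => ⟨(), 1, rfl⟩⟩
  · rintro _ ⟨i, rfl⟩
    have hle := hc 1 i rfl
    rwa [inv_one, one_smul] at hle
  · rintro _ _ _ _ _ (rfl : _ = 1) (rfl : _ = 1)
    exact ⟨rfl, rfl⟩

end Fam

section Universal

open Fam

variable (G L : Type) [Group G] [DistribLattice L] [OrderBot L] [DoubleCategory.{0, w} L]
  [MulAction G L] [CovariantClass G L (· • ·) (· ≤ ·)] [IsActionDoubleCategory G L]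

open Classical in
/-- The invariant valuation with values in `K₀` given by the classes of the one-member families. -/
noncomputable def k0Valuation : InvariantValuation G L (K0 (cof G L) (weq G L)) where
  toFun P := if hP : IsPolytope P then k0Class (single G P hP) else 0
  map_sup_of_disjoint {P Q} h := by
    by_cases hP : IsPolytope P
    swap; · rw [dif_neg hP, zero_add, not_not.1 (isPolytope_iff_ne_bot.not.1 hP), bot_sup_eq]
    by_cases hQ : IsPolytope Q
    swap; · rw [dif_neg hQ, add_zero, not_not.1 (isPolytope_iff_ne_bot.not.1 hQ), sup_bot_eq]
    have hPQ : IsPolytope (P ⊔ Q) :=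
      isPolytope_iff_ne_bot.2 (ne_bot_of_le_ne_bot (isPolytope_iff_ne_bot.1 hP) le_sup_left)
    have hmem : ∀ b, IsPolytope (bif b then P else Q) := Bool.forall_bool.2 ⟨hQ, hP⟩
    have hdisj : Pairwise (Function.onFun Disjoint fun b => bif b then P else Q) := by
      rintro (_ | _) (_ | _) hne
      exacts [(hne rfl).elim, h.symm, h, (hne rfl).elim]
    have hlub : IsLUB (Set.range fun b => bif b then P else Q) (P ⊔ Q) := by
      rw [Bool.range_eq, Set.pair_comm]
      exact isLUB_pair
    rw [dif_pos hP, dif_pos hQ, dif_pos hPQ, k0Class_single_eq hPQ hmem hdisj hlub]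
    exact (k0Class_ofMembers _ hmem).trans <| by
      rw [finsum_eq_sum_of_fintype, Fintype.sum_bool]; rfl
  map_smul g P := by
    by_cases hP : IsPolytope P
    · have hgP : IsPolytope (g • P) := isPolytope_iff_ne_bot.2
        (smul_eq_bot_iff_of_action.not.2 (isPolytope_iff_ne_bot.1 hP))
      rw [dif_pos hP, dif_pos hgP]
      exact (k0Class_eq_of_equiv (Equiv.refl Unit) (fun _ => g) fun _ => rfl).symm
    · rw [not_not.1 (isPolytope_iff_ne_bot.not.1 hP), smul_eq_bot_iff_of_action.2 rfl]

variable {G L} in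
lemma k0Valuation_apply {P : L} (hP : IsPolytope P) :
    k0Valuation G L P = k0Class (single G P hP) := dif_pos hP

lemma isUniversal_k0Valuation : InvariantValuation.IsUniversal.{v} (k0Valuation G L) where
  closure_range := by
    rw [eq_top_iff, ← closure_range_mk_of, AddSubgroup.closure_le]
    rintro _ ⟨A, rfl⟩
    have := A.tw.fin
    cases nonempty_fintype A.tw.ι
    have hA : k0Class A = ∑ i, k0Valuation G L (A.tw.obj i) :=
      (k0Class_ofMembers A.tw.obj A.tw.poly).trans <| (finsum_eq_sum_of_fintype _).trans <|
        Finset.sum_congr rfl fun i _ => (k0Valuation_apply (A.tw.poly i)).symm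
    change k0Class A ∈ _
    rw [hA]
    exact sum_mem fun i _ => AddSubgroup.subset_closure ⟨_, rfl⟩
  exists_lift ν := by
    refine ⟨k0Sum G L ν, fun P => ?_⟩
    by_cases hP : IsPolytope P
    · rw [k0Valuation_apply hP]
      exact (K0.lift_of _).trans (finsum_unique (α := Unit) _)
    · rw [not_not.1 (isPolytope_iff_ne_bot.not.1 hP), InvariantValuation.map_bot, map_zero,
        ν.map_bot]

end Universal

namespace SpaceForm

variable {X : SpaceForm} {G : Subgroup (Equiv.Perm X.Pt)} [hG : Fact (G ≤ X.isometryGroup)]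

instance : IsActionDoubleCategory G (X.Obj G) where
  elt σ := ⟨σ.1, σ.2.1⟩
  hmk g h := ⟨g.1, g.2, congrArg Obj.carrier h⟩
  elt_smul σ := Obj.ext σ.2.2
  elt_hmk _ _ := rfl
  elt_injective h := Subtype.ext (congrArg (fun k : G => k.1) h)
  elt_hcomp _ _ := rfl
  sq_iff := ⟨fun h => Subtype.ext h, fun h => congrArg (fun k : G => k.1) h⟩

open Classical in
/-- The invariant valuation with values in `𝒫(X, G)` given by the classes of polytopes. -/
noncomputable def scissorsValuation :
    InvariantValuation G (X.Obj G) (X.ScissorsGroup G) where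
  toFun P :=
    if hP : P.carrier.Nonempty then ScissorsGroup.of X G ⟨P.carrier, P.isSimplexUnion, hP⟩ else 0
  map_sup_of_disjoint {P Q} h := by
    by_cases hP : P.carrier.Nonempty
    swap; · rw [dif_neg hP, zero_add, not_not.1 (Obj.ne_bot_iff.not.2 hP), bot_sup_eq]
    by_cases hQ : Q.carrier.Nonempty
    swap; · rw [dif_neg hQ, add_zero, not_not.1 (Obj.ne_bot_iff.not.2 hQ), sup_bot_eq]
    have hPQ : (P ⊔ Q).carrier.Nonempty := hP.mono Set.subset_union_left
    rw [dif_pos hP, dif_pos hQ, dif_pos hPQ]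
    exact QuotientAddGroup.eq_iff_sub_mem.2 (AddSubgroup.subset_closure
      (Or.inr ⟨_, _, _, Obj.disjoint_iff_vol_inter.1 h, rfl, rfl⟩))
  map_smul g P := by
    by_cases hP : P.carrier.Nonempty
    · have hgP : (g • P).carrier.Nonempty := hP.image _
      rw [dif_pos hP, dif_pos hgP]
      exact Eq.symm (QuotientAddGroup.eq_iff_sub_mem.2 (AddSubgroup.subset_closure
        (Or.inl ⟨_, _, g.1, g.2, rfl, rfl⟩)))
    · rw [not_not.1 (Obj.ne_bot_iff.not.2 hP), smul_eq_bot_iff_of_action.2 rfl]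

lemma scissorsValuation_toObj (P : X.Polytope) :
    scissorsValuation (P.toObj : X.Obj G) = ScissorsGroup.of X G P := dif_pos P.2.2

lemma isUniversal_scissorsValuation :
    InvariantValuation.IsUniversal.{w} (scissorsValuation (X := X) (G := G)) where
  closure_range := by
    rw [eq_top_iff, ← closure_range_mk_of]
    refine AddSubgroup.closure_mono ?_
    rintro _ ⟨P, rfl⟩
    exact ⟨P.toObj, scissorsValuation_toObj P⟩
  exists_lift ν := by
    let φ : X.ScissorsGroup G →+ _ :=
      QuotientAddGroup.lift _ (FreeAbelianGroup.lift fun P => ν P.toObj) <|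
        (AddSubgroup.closure_le _).2 <| by
          rintro _ (⟨P, Q, g, hg, h, rfl⟩ | ⟨P, Q, R, hvol, hR, rfl⟩)
          · have hQ : (Q.toObj : X.Obj G) = (⟨g, hg⟩ : G) • P.toObj := Obj.ext h.symm
            simp [hQ, ν.map_smul]
          · have hRsup : (R.toObj : X.Obj G) = P.toObj ⊔ Q.toObj := Obj.ext hR
            have hdisj : Disjoint (P.toObj : X.Obj G) Q.toObj := Obj.disjoint_iff_vol_inter.2 hvol
            simp [hRsup, ν.map_sup_of_disjoint hdisj]
    refine ⟨φ, fun P => ?_⟩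
    by_cases hP : P.carrier.Nonempty
    · exact (congrArg φ (scissorsValuation_toObj ⟨P.carrier, P.isSimplexUnion, hP⟩)).trans
        (FreeAbelianGroup.lift_apply_of _ _)
    · rw [not_not.1 (Obj.ne_bot_iff.not.2 hP), InvariantValuation.map_bot, map_zero, ν.map_bot]

end SpaceForm

end ScissorsCongruence

theorem mainTheorem2_general {G L : Type} {Γ : Type*} [Group G] [DistribLattice L] [OrderBot L]
    [DoubleCategory.{0, w} L] [MulAction G L] [CovariantClass G L (· • ·) (· ≤ ·)]
    [IsActionDoubleCategory G L] [AddCommGroup Γ] {μ : InvariantValuation G L Γ}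
    (hμ : InvariantValuation.IsUniversal.{1} μ) :
    ∃ J : GrothendieckTopology L,
      (∀ (P : L) (ι : Type) (U : ι → L) (f : ∀ i, U i ⟶ P),
        IsCovering J U f ↔ ∃ t : Finset ι, t.sup U = P) ∧
      ∃ h : IsPolytopeComplex J,
        IsWaldhausen (SC.cofibrations h) (SC.weakEquivalences h) ∧
        ∃ e : K0 (SC.cofibrations h) (SC.weakEquivalences h) ≃+ Γ,
          ∀ (P : L) (hP : IsPolytope P), e (K0.of _ _ (SC.single h P hP)) = μ P := by
  obtain ⟨e, he⟩ := (isUniversal_k0Valuation G L).exists_addEquiv hμ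
  exact ⟨finiteCoverTopology L, fun _ _ => isCovering_iff_exists_finset,
    IsActionDoubleCategory.isPolytopeComplex G L, Fam.isWaldhausen G L, e,
    fun P hP => (congrArg e (k0Valuation_apply hP).symm).trans (he P)⟩

theorem mainTheorem2 (X : SpaceForm) (G : Subgroup (Equiv.Perm X.Pt))
    (hG : G ≤ X.isometryGroup) :
    ∃ J : CategoryTheory.GrothendieckTopology (X.Obj G),
      (∀ (P : X.Obj G) (ι : Type) (U : ι → X.Obj G) (f : ∀ i, U i ⟶ P),
        IsCovering J U f ↔ ∃ t : Finset ι, ⋃ i ∈ t, (U i).carrier = P.carrier) ∧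
      ∃ h : IsPolytopeComplex J,
        IsWaldhausen (SC.cofibrations h) (SC.weakEquivalences h) ∧
        ∃ e : K0 (SC.cofibrations h) (SC.weakEquivalences h) ≃+ X.ScissorsGroup G,
          ∀ P : X.Polytope,
            e (K0.of _ _ (SC.single h P.toObj P.isPolytope_toObj)) =
              SpaceForm.ScissorsGroup.of X G P := by
  have : Fact (G ≤ X.isometryGroup) := ⟨hG⟩
  obtain ⟨J, hJ, h, hW, e, he⟩ := mainTheorem2_general
    (SpaceForm.isUniversal_scissorsValuation (X := X) (G := G))
  refine ⟨J, fun P ι U f => (hJ P ι U f).trans (exists_congr fun t => ?_), h, hW, e,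
    fun P => (he _ P.isPolytope_toObj).trans (SpaceForm.scissorsValuation_toObj P)⟩
  rw [SpaceForm.Obj.ext_iff, SpaceForm.Obj.finset_sup_carrier]
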